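/- Let $m,n\ge 1$ be integers, $0<\alpha<n$, $q>0$, $1<p_1,\dots,p_m<\infty$ with $$\frac1{p_1}+\cdots+\frac1{p_m}=\frac1q+\frac{\alpha}{n},$$ put $p_i'=p_i/(p_i-1)$ and $\vec P=(p_1,\dots,p_m)$, and suppose that $$\min\Big\{\frac{\max_i p_i'}{q},\ \min_j\frac{\max\big(\{q\}\cup\{p_i':i\ne j\}\big)}{p_j'}\Big\}\le 1-\frac{\alpha}{n}.$$ For weights (non-negative locally integrable functions) $w_1,\dots,w_m$ on $\mathbb R^n$ write $\vec w=(w_1,\dots,w_m)$, $u_{\vec w}=\big(\prod_{i=1}^m w_i\big)^q$, $\sigma_i=w_i^{-p_i'}$ and $$[\vec w]_{A_{\vec P,q}}=\sup_{Q}\Big(\frac1{|Q|}\int_Q u_{\vec w}\Big)\prod_{i=1}^m\Big(\frac1{|Q|}\int_Q\sigma_i\Big)^{q/p_i'},$$ the supremum being over all cubes $Q\subset\mathbb R^n$ with sides parallel to the axes (with the conventions $0^{-p_i'}=\infty$ and $0\cdot\infty=0$). Write $\vec w\in A_{\vec P,q}$ if $[\vec w]_{A_{\vec P,q}}<\infty$.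 Let $$\mathcal I_\alpha(\vec f)(x)=\int_{(\mathbb R^{n})^m}\frac{f_1(y_1)\cdots f_m(y_m)}{(|x-y_1|+\cdots+|x-y_m|)^{mn-\alpha}}\,dy_1\cdots dy_m .$$ Then there is a constant $C$, depending only on $m,n,\alpha,\vec P,q$, such that for all $\vec w\in A_{\vec P,q}$ and all (real- or complex-valued) $f_i\in L^{p_i}(w_i^{p_i})$, $1\le i\le m$, the integral defining $\mathcal I_\alpha(\vec f)(x)$ converges absolutely for $u_{\vec w}$-almost every $x$, $\mathcal I_\alpha(\vec f)\in L^q(u_{\vec w})$, and $$\|\mathcal I_\alpha(\vec f)\|_{L^q(u_{\vec w})}\le C\,[\vec w]_{A_{\vec P,q}}^{(1-\frac{\alpha}{n})\max_i\{1,\,p_i'/q\}}\prod_{i=1}^m\|f_i\|_{L^{p_i}(w_i^{p_i})}.$$ Moreover the exponent of $[\vec w]_{A_{\vec P,q}}$ is sharp: for these $m,n,\alpha,\vec P,q$ and any real $s<(1-\frac{\alpha}{n})\max_i\{1,\,p_i'/q\}$, there is no constant $C$ such that $$\|\mathcal I_\alpha(\vec f)\|_{L^q(u_{\vec w})}\le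 C\,[\vec w]_{A_{\vec P,q}}^{s}\prod_{i=1}^m\|f_i\|_{L^{p_i}(w_i^{p_i})}$$ for all $\vec w\in A_{\vec P,q}$ and all $f_i\in L^{p_i}(w_i^{p_i})$. -/

import Mathlib

open MeasureTheory
open scoped ENNReal NNReal

noncomputable section

/-- The axis-parallel cube in `ℝⁿ` with lower corner `a` and side length `l`. -/
def cube {n : ℕ} (a : EuclideanSpace ℝ (Fin n)) (l : ℝ) : Set (EuclideanSpace ℝ (Fin n)) :=
  {x | ∀ k, a k ≤ x k ∧ x k < a k + l}

/-- A weight: a non-negative locally integrable function on `ℝⁿ`. -/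
structure IsWeight {n : ℕ} (w : EuclideanSpace ℝ (Fin n) → ℝ) : Prop where
  nonneg : ∀ x, 0 ≤ w x
  locallyIntegrable : LocallyIntegrable w volume

/-- `u_w = (∏ᵢ wᵢ) ^ q`. -/
def productWeight {m n : ℕ} (q : ℝ) (w : Fin m → EuclideanSpace ℝ (Fin n) → ℝ)
    (x : EuclideanSpace ℝ (Fin n)) : ℝ≥0∞ :=
  (∏ i, ENNReal.ofReal (w i x)) ^ q

/-- `σ = w ^ (-p')` with `p' = p / (p - 1)`. It takes values in `[0, ∞]`, and equals `∞` where
`w` vanishes. -/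
def dualWeight {n : ℕ} (p : ℝ) (w : EuclideanSpace ℝ (Fin n) → ℝ)
    (x : EuclideanSpace ℝ (Fin n)) : ℝ≥0∞ :=
  ENNReal.ofReal (w x) ^ (-p.conjExponent)

/-- The constant `[w]_{A_{P,q}}`, a supremum over all cubes of products of averages. -/
def multiWeightConst {m n : ℕ} (p : Fin m → ℝ) (q : ℝ)
    (w : Fin m → EuclideanSpace ℝ (Fin n) → ℝ) : ℝ≥0∞ :=
  ⨆ (a : EuclideanSpace ℝ (Fin n)) (l : ℝ) (_ : 0 < l),
    (⨍⁻ x in cube a l, productWeight q w x ∂volume) *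
      ∏ i, (⨍⁻ x in cube a l, dualWeight (p i) (w i) x ∂volume) ^ (q / (p i).conjExponent)

/-- The class `A_{P,q}` of multiple weights. -/
def IsMultiWeight {m n : ℕ} (p : Fin m → ℝ) (q : ℝ)
    (w : Fin m → EuclideanSpace ℝ (Fin n) → ℝ) : Prop :=
  (∀ i, IsWeight (w i)) ∧ multiWeightConst p q w < ∞

/-- The measure `w ^ p dx`. -/
def powMeasure {n : ℕ} (p : ℝ) (w : EuclideanSpace ℝ (Fin n) → ℝ) :
    Measure (EuclideanSpace ℝ (Fin n)) :=
  volume.withDensity fun x => ENNReal.ofReal (w x) ^ p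

/-- The measure `u_w dx`. -/
def productMeasure {m n : ℕ} (q : ℝ) (w : Fin m → EuclideanSpace ℝ (Fin n) → ℝ) :
    Measure (EuclideanSpace ℝ (Fin n)) :=
  volume.withDensity (productWeight q w)

/-- The integrand `f₁(y₁) ⋯ f_m(y_m) / (|x - y₁| + ⋯ + |x - y_m|) ^ (mn - α)`. -/
def fracIntegrand {𝕜 : Type*} [RCLike 𝕜] {m n : ℕ} (α : ℝ)
    (f : Fin m → EuclideanSpace ℝ (Fin n) → 𝕜) (x : EuclideanSpace ℝ (Fin n))
    (y : Fin m → EuclideanSpace ℝ (Fin n)) : 𝕜 :=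
  ((∑ i, ‖x - y i‖) ^ ((m : ℝ) * n - α))⁻¹ • ∏ i, f i (y i)

/-- The multilinear fractional integral operator `I_α`. -/
def fracIntegral {𝕜 : Type*} [RCLike 𝕜] {m n : ℕ} (α : ℝ)
    (f : Fin m → EuclideanSpace ℝ (Fin n) → 𝕜) (x : EuclideanSpace ℝ (Fin n)) : 𝕜 :=
  ∫ y, fracIntegrand α f x y

/-- The exponent `(1 - α / n) maxᵢ {1, pᵢ' / q}`. -/
def sharpExponent {m : ℕ} (n : ℕ) (α : ℝ) (p : Fin m → ℝ) (q : ℝ) : ℝ :=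
  (1 - α / n) * ⨆ i, max 1 ((p i).conjExponent / q)

end

/-!
**The norm inequality.** Put `θ = 1 - α / n` and `s = m - α / n`, and treat the measures `u_w dx`
and `σᵢ dx` on an equal footing: they are indexed by `Option (Fin m)` and carry the exponents
`t = q, p₁', …, p_m'`, for which `∑ 1 / t = s`. The weight condition says that
`∏ μₖ(Q) ^ (1 / tₖ) ≤ [w] ^ (1 / q) |Q| ^ s` for all cubes `Q`, and Hölder's inequality gives
`|E| ^ s ≤ ∏ μₖ(E) ^ (1 / tₖ)` for all measurable `E`, since the corresponding product of densities
is `1`. The hypothesis on the exponents provides an index `k₀` with `tₖ ≤ t_{k₀} θ` for all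
`k ≠ k₀` and `1 < t_{k₀} θ` (`exists_distinguished`).

By the one-third trick the kernel is dominated by finitely many dyadic sums
(`lintegral_kernel_le`), and each of these by the sum over a sparse subfamily (`exists_isSparse`):
every member `Q` contains a set `E Q` of at least half its measure, and these sets overlap at most
twice. For such a pair the two inequalities above combine to an estimate of the coefficient of `Q`
by `[w] ^ (t_{k₀} θ / q)` and powers of the `μₖ(E Q)` (`rpow_neg_mul_prod_le`). What remains is a sum
over `Q` of products of averages with respect to the `μₖ`; Hölder's inequality reduces it to
`∑ ⟨g⟩_Q ^ p μₖ(E Q) ≲ ∫ g ^ p dμₖ`, which is the boundedness of the maximal function of a laminar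
family on `L^p(μₖ)`, uniform in the measure (`lintegral_familyMaximal_rpow_le`); at `k₀` a fractional
variant absorbs the excess `1 - θ` of the exponents (`setLAverage_rpow_mul_rpow_le`). For `q > 1` the
multilinear form is estimated and tested against a power of the operator itself; for `q ≤ 1` the
power `q` is subadditive, and `k₀` is one of the `pⱼ'` (`sparse_operator_le`). In both cases
`t_{k₀} θ / q ≤ θ max {1, pᵢ' / q}`, and `[w] ≥ 1`. If some `wᵢ` vanishes on a set of positive measure
then `u_w = 0` almost everywhere, and there is nothing to prove (`productMeasure_eq_zero_or`).

**Sharpness.** Let `j` maximize `max {1, pⱼ' / q}`, let all the other weights be `1`, and let `w_j` be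
a power of `‖x‖` such that `σ_j` (if `q ≤ pⱼ'`) or `u_w` (if `pⱼ' < q`) equals `‖x‖ ^ (δ - n)`. Then
`[w]` is at most of the order `δ ^ (-min {1, q / pⱼ'})`. If `fᵢ ^ pᵢ wᵢ ^ pᵢ = ‖x‖ ^ (δ - n)` on the unit
ball, then `∏ ‖fᵢ‖` is of the order `δ ^ (-1 / q - α / n)`, while the norm of the fractional integral
is at least of the order `δ ^ (-1 - 1 / q)`: in the first case because `f_j` has mass of the order
`1 / δ` near the origin, in the second one because about `1 / δ` annuli contribute equally
(`exists_example_of_le`, `exists_example_of_gt`). The quotient is `δ ^ (-θ)`, so that `δ → 0` rules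
out every exponent below `θ max {1, pⱼ' / q}`.
-/

/-! ### Laminar families and their maximal functions -/

/-- Hölder's inequality for finite sums of products of several factors. -/
theorem ENNReal.sum_prod_rpow_le {ι κ : Type*} (A : Finset κ) (s : Finset ι)
    (f : ι → κ → ℝ≥0∞) {p : ι → ℝ} (hp : ∑ i ∈ s, p i = 1) (h0 : ∀ i ∈ s, 0 ≤ p i) :
    ∑ a ∈ A, ∏ i ∈ s, f i a ^ p i ≤ ∏ i ∈ s, (∑ a ∈ A, f i a) ^ p i := by
  let _ : MeasurableSpace A := ⊤
  have h := ENNReal.lintegral_prod_norm_pow_le (μ := Measure.count) (α := A) s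
    (f := fun i a => f i a) (fun i _ => (measurable_from_top).aemeasurable) hp h0
  simp only [lintegral_count, tsum_fintype] at h
  rw [Finset.sum_coe_sort A (fun a => ∏ i ∈ s, f i a ^ p i)] at h
  refine h.trans (le_of_eq (Finset.prod_congr rfl fun i _ => ?_))
  rw [Finset.sum_coe_sort A (fun a => f i a)]

/-- A family of sets is laminar if any two of its members are nested or disjoint. -/
def IsLaminar {X : Type*} (F : Set (Set X)) : Prop :=
  ∀ P ∈ F, ∀ Q ∈ F, P ⊆ Q ∨ Q ⊆ P ∨ Disjoint P Q

theorem IsLaminar.mono {X : Type*} {F G : Set (Set X)} (h : IsLaminar F) (hG : G ⊆ F) :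
    IsLaminar G := fun P hP Q hQ => h P (hG hP) Q (hG hQ)

/-- The maximal members of a finite laminar family are disjoint and have the same union. -/
theorem IsLaminar.exists_pairwiseDisjoint {X : Type*} {F : Finset (Set X)}
    (hF : IsLaminar (F : Set (Set X))) :
    ∃ G ⊆ F, (G : Set (Set X)).PairwiseDisjoint (fun Q => Q) ∧ (⋃ Q ∈ G, Q) = ⋃ Q ∈ F, Q := by
  classical
  refine ⟨F.filter (fun Q => Maximal (· ∈ F) Q), Finset.filter_subset _ _, ?_, ?_⟩
  · intro P hP Q hQ hPQ
    simp only [Finset.coe_filter, Set.mem_ofPred_eq] at hP hQ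
    rcases hF P hP.1 Q hQ.1 with h | h | h
    · exact absurd (hP.2.eq_of_le hQ.1 h) hPQ
    · exact absurd (hQ.2.eq_of_le hP.1 h).symm hPQ
    · exact h
  · refine subset_antisymm ?_ ?_
    · exact Set.biUnion_subset_biUnion_left (fun Q hQ => (Finset.mem_filter.1 hQ).1)
    · refine Set.iUnion₂_subset fun Q hQ => ?_
      obtain ⟨R, hQR, hR⟩ := F.exists_le_maximal hQ
      exact (show Q ⊆ R from hQR).trans
        (Set.subset_biUnion_of_mem (u := fun Q : Set X => Q)
          (show R ∈ (F.filter (fun Q => Maximal (· ∈ F) Q)) from Finset.mem_filter.2 ⟨hR.1, hR⟩))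

section Maximal

variable {X : Type*} [MeasurableSpace X]

/-- The maximal function of `g` over a finite family `F` of sets: the largest average of `g` over
the members of `F` that contain the point. -/
noncomputable def familyMaximal (μ : Measure X) (F : Finset (Set X)) (g : X → ℝ≥0∞) (x : X) :
    ℝ≥0∞ :=
  F.sup fun Q => Q.indicator (fun _ => ⨍⁻ y in Q, g y ∂μ) x

theorem le_familyMaximal (μ : Measure X) {F : Finset (Set X)} (g : X → ℝ≥0∞) {Q : Set X}
    (hQ : Q ∈ F) {x : X} (hx : x ∈ Q) : ⨍⁻ y in Q, g y ∂μ ≤ familyMaximal μ F g x := by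
  have := Finset.le_sup (f := fun Q : Set X => Q.indicator (fun _ => ⨍⁻ y in Q, g y ∂μ) x) hQ
  rwa [Set.indicator_of_mem hx] at this

theorem measurable_familyMaximal (μ : Measure X) {F : Finset (Set X)} (g : X → ℝ≥0∞)
    (hF : ∀ Q ∈ F, MeasurableSet Q) : Measurable (familyMaximal μ F g) := by
  unfold familyMaximal
  simp only [Finset.sup_eq_iSup]
  exact Measurable.biSup _ F.countable_toSet
    (fun Q hQ => measurable_const.indicator (hF Q hQ))

theorem familyMaximal_superlevel (μ : Measure X) (F : Finset (Set X)) (g : X → ℝ≥0∞) (t : ℝ≥0∞) :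
    {x | t < familyMaximal μ F g x} =
      ⋃ Q ∈ F.filter (fun Q => t < ⨍⁻ y in Q, g y ∂μ), Q := by
  ext x
  simp only [familyMaximal, Set.mem_ofPred_eq, Finset.lt_sup_iff, Finset.mem_filter,
    Set.mem_iUnion, exists_prop]
  constructor
  · rintro ⟨Q, hQ, h⟩
    by_cases hx : x ∈ Q
    · rw [Set.indicator_of_mem hx] at h
      exact ⟨Q, ⟨hQ, h⟩, hx⟩
    · rw [Set.indicator_of_notMem hx] at h
      exact absurd h not_lt_zero
  · rintro ⟨Q, ⟨hQ, h⟩, hx⟩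
    exact ⟨Q, hQ, by rwa [Set.indicator_of_mem hx]⟩

/-- The weak type estimate for the maximal function of a laminar family. -/
theorem mul_measure_familyMaximal_le (μ : Measure X) {F : Finset (Set X)}
    (hF : IsLaminar (F : Set (Set X))) (hm : ∀ Q ∈ F, MeasurableSet Q)
    (g : X → ℝ≥0∞) (t : ℝ≥0∞) :
    t * μ {x | t < familyMaximal μ F g x} ≤ ∫⁻ x in {x | t < familyMaximal μ F g x}, g x ∂μ := by
  rw [familyMaximal_superlevel]
  obtain ⟨G, hG, hd, hU⟩ := (hF.mono (G := (F.filter (fun Q => t < ⨍⁻ y in Q, g y ∂μ) :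
    Set (Set X))) (by intro Q hQ; exact (Finset.mem_filter.1 hQ).1)).exists_pairwiseDisjoint
  have hGm : ∀ Q ∈ G, MeasurableSet Q := fun Q hQ => hm Q (Finset.mem_filter.1 (hG hQ)).1
  rw [← hU, lintegral_biUnion_finset hd hGm, measure_biUnion_finset hd hGm, Finset.mul_sum]
  refine Finset.sum_le_sum fun Q hQ => ?_
  have ht := (Finset.mem_filter.1 (hG hQ)).2
  rw [setLAverage_eq] at ht
  exact ENNReal.mul_le_of_le_div ht.le

/-- Hölder's inequality on a set of finite or infinite measure. -/
theorem setLIntegral_le_of_lintegral_rpow (μ : Measure X) {p : ℝ} (hp : 1 < p) {g : X → ℝ≥0∞}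
    (hg : AEMeasurable g μ) (Q : Set X) :
    ∫⁻ x in Q, g x ∂μ ≤ (∫⁻ x, g x ^ p ∂μ) ^ (1 / p) * μ Q ^ (1 - 1 / p) := by
  have hc : p.HolderConjugate p.conjExponent := Real.HolderConjugate.conjExponent hp
  have h := ENNReal.lintegral_mul_le_Lp_mul_Lq (μ.restrict Q) hc hg.restrict
    (aemeasurable_const (b := (1 : ℝ≥0∞)))
  simp only [Pi.mul_apply, mul_one, ENNReal.one_rpow, lintegral_const, one_mul,
    Measure.restrict_apply MeasurableSet.univ, Set.univ_inter] at h
  refine h.trans ?_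
  rw [show 1 / p.conjExponent = 1 - 1 / p by
    have := hc.inv_add_inv_eq_one; simp only [one_div]; linarith]
  gcongr
  exact Measure.restrict_le_self

/-- Averages of a function in `L^p` are finite. -/
theorem setLAverage_lt_top_of_lintegral_rpow (μ : Measure X) {p : ℝ} (hp : 1 < p) {g : X → ℝ≥0∞}
    (hg : AEMeasurable g μ) (hfin : ∫⁻ x, g x ^ p ∂μ ≠ ∞) {Q : Set X} (h0 : μ Q ≠ 0)
    (h1 : μ Q ≠ ∞) : ⨍⁻ x in Q, g x ∂μ < ∞ := by
  have h1p : 1 / p ≤ 1 := by rw [div_le_one (by linarith)]; exact hp.le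
  rw [setLAverage_eq]
  refine ENNReal.div_lt_top ?_ h0
  refine ((setLIntegral_le_of_lintegral_rpow μ hp hg Q).trans_lt (ENNReal.mul_lt_top ?_ ?_)).ne
  · exact ENNReal.rpow_lt_top_of_nonneg (by positivity) hfin
  · exact ENNReal.rpow_lt_top_of_nonneg (by linarith) h1

/-- The maximal function of a finite laminar family is bounded on `L^p(μ)` for every `μ`, with a
norm that does not depend on `μ` or on the family. -/
theorem lintegral_familyMaximal_rpow_le (μ : Measure X) {F : Finset (Set X)}
    (hF : IsLaminar (F : Set (Set X))) (hm : ∀ Q ∈ F, MeasurableSet Q)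
    (h0 : ∀ Q ∈ F, μ Q ≠ 0) (h1 : ∀ Q ∈ F, μ Q ≠ ∞) {p : ℝ} (hp : 1 < p)
    {g : X → ℝ≥0∞} (hg : AEMeasurable g μ) :
    ∫⁻ x, familyMaximal μ F g x ^ p ∂μ ≤
      ENNReal.ofReal (p / (p - 1)) ^ p * ∫⁻ x, g x ^ p ∂μ := by
  have hp0 : 0 < p := by linarith
  have hp1 : 0 < p - 1 := by linarith
  by_cases hfin : ∫⁻ x, g x ^ p ∂μ = ∞
  · rw [hfin, ENNReal.mul_top]
    · exact le_top
    · have : 0 < ENNReal.ofReal (p / (p - 1)) := by simp; positivity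
      exact (ENNReal.rpow_pos this ENNReal.ofReal_ne_top).ne'
  set M := familyMaximal μ F g with hM
  have hMm : Measurable M := measurable_familyMaximal μ g hm
  have hav : ∀ Q ∈ F, ⨍⁻ x in Q, g x ∂μ < ∞ := fun Q hQ =>
    setLAverage_lt_top_of_lintegral_rpow μ hp hg hfin (h0 Q hQ) (h1 Q hQ)
  have hMtop : ∀ x, M x ≠ ∞ := by
    intro x
    refine ((Finset.sup_lt_iff (by simp)).2 fun Q hQ => ?_).ne
    by_cases hx : x ∈ Q
    · rw [Set.indicator_of_mem hx]; exact hav Q hQ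
    · rw [Set.indicator_of_notMem hx]; simp
  -- `M` takes finitely many values and vanishes off a set of finite measure, so that `∫ M ^ p` is
  -- finite and can be cancelled at the end
  have hMfin : ∫⁻ x, M x ^ p ∂μ ≠ ∞ := by
    have hle : ∀ x, M x ^ p ≤ ∑ Q ∈ F, Q.indicator (fun _ => (⨍⁻ y in Q, g y ∂μ) ^ p) x := by
      intro x
      rcases F.eq_empty_or_nonempty with rfl | hne
      · simp [hM, familyMaximal, hp0]
      obtain ⟨Q, hQ, he⟩ := F.exists_mem_eq_sup hne
        (fun Q => Q.indicator (fun _ => ⨍⁻ y in Q, g y ∂μ) x)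
      have : M x = Q.indicator (fun _ => ⨍⁻ y in Q, g y ∂μ) x := he
      rw [this]
      refine le_trans (le_of_eq ?_) (Finset.single_le_sum (fun _ _ => zero_le) hQ)
      by_cases hx : x ∈ Q
      · rw [Set.indicator_of_mem hx, Set.indicator_of_mem hx]
      · rw [Set.indicator_of_notMem hx, Set.indicator_of_notMem hx, ENNReal.zero_rpow_of_pos hp0]
    refine ((lintegral_mono hle).trans_lt ?_).ne
    rw [lintegral_finsetSum _ (fun Q hQ => measurable_const.indicator (hm Q hQ))]
    refine ENNReal.sum_lt_top.2 fun Q hQ => ?_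
    rw [lintegral_indicator_const (hm Q hQ)]
    exact ENNReal.mul_lt_top (ENNReal.rpow_lt_top_of_nonneg hp0.le (hav Q hQ).ne) (h1 Q hQ).lt_top
  -- the layer cake formula for `∫ M ^ r`
  have hlayer : ∀ (ν : Measure X) (r : ℝ), 0 < r → ∫⁻ x, M x ^ r ∂ν =
      ENNReal.ofReal r * ∫⁻ t in Set.Ioi (0 : ℝ), ν {x | ENNReal.ofReal t < M x} *
        ENNReal.ofReal (t ^ (r - 1)) := by
    intro ν r hr
    have h := lintegral_rpow_eq_lintegral_meas_lt_mul ν (f := fun x => (M x).toReal)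
      (Filter.Eventually.of_forall fun x => ENNReal.toReal_nonneg)
      hMm.ennreal_toReal.aemeasurable hr
    have e1 : ∀ x, ENNReal.ofReal ((M x).toReal ^ r) = M x ^ r := by
      intro x
      rw [← ENNReal.ofReal_rpow_of_nonneg ENNReal.toReal_nonneg hr.le,
        ENNReal.ofReal_toReal (hMtop x)]
    simp only [e1] at h
    rw [h]
    congr 1
    refine setLIntegral_congr_fun measurableSet_Ioi fun t ht => ?_
    have : {a | t < (M a).toReal} = {x | ENNReal.ofReal t < M x} := by
      ext x
      exact (ENNReal.ofReal_lt_iff_lt_toReal (le_of_lt ht) (hMtop x)).symm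
    simp only [this]
  have hkey : ∫⁻ x, M x ^ p ∂μ ≤ ENNReal.ofReal (p / (p - 1)) * ∫⁻ x, g x * M x ^ (p - 1) ∂μ := by
    have e2 : ∫⁻ x, g x * M x ^ (p - 1) ∂μ = ∫⁻ x, M x ^ (p - 1) ∂(μ.withDensity g) := by
      rw [lintegral_withDensity_eq_lintegral_mul₀ hg (hMm.pow_const _).aemeasurable]
      rfl
    rw [e2, hlayer μ p hp0, hlayer _ (p - 1) hp1, ← mul_assoc,
      ← ENNReal.ofReal_mul (by positivity), div_mul_cancel₀ _ hp1.ne']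
    gcongr 1
    refine setLIntegral_mono' measurableSet_Ioi fun t ht => ?_
    have ht0 : (0 : ℝ) < t := ht
    have hw := mul_measure_familyMaximal_le μ hF hm g (ENNReal.ofReal t)
    have hms : MeasurableSet {x | ENNReal.ofReal t < M x} := measurableSet_lt measurable_const hMm
    rw [withDensity_apply _ hms]
    calc μ {x | ENNReal.ofReal t < M x} * ENNReal.ofReal (t ^ (p - 1))
        = (ENNReal.ofReal t * μ {x | ENNReal.ofReal t < M x}) *
            ENNReal.ofReal (t ^ (p - 1 - 1)) := by
          rw [show t ^ (p - 1) = t * t ^ (p - 1 - 1) by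
            rw [← Real.rpow_one_add' ht0.le (by linarith)]; ring_nf, ENNReal.ofReal_mul ht0.le]
          ring
      _ ≤ _ := by gcongr
  have hhol : ∫⁻ x, g x * M x ^ (p - 1) ∂μ ≤
      (∫⁻ x, g x ^ p ∂μ) ^ (1 / p) * (∫⁻ x, M x ^ p ∂μ) ^ (1 - 1 / p) := by
    have hc : p.HolderConjugate p.conjExponent := Real.HolderConjugate.conjExponent hp
    have h := ENNReal.lintegral_mul_le_Lp_mul_Lq μ hc hg (hMm.pow_const (p - 1)).aemeasurable
    simp only [Pi.mul_apply, ← ENNReal.rpow_mul] at h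
    rwa [show 1 / p.conjExponent = 1 - 1 / p by
      have := hc.inv_add_inv_eq_one; simp only [one_div]; linarith,
      show (p - 1) * p.conjExponent = p by
        unfold Real.conjExponent; field_simp] at h
  set I := ∫⁻ x, M x ^ p ∂μ
  rcases eq_or_ne I 0 with hI | hI
  · rw [hI]; exact zero_le
  have h3 : I ^ (1 / p) ≤ ENNReal.ofReal (p / (p - 1)) * (∫⁻ x, g x ^ p ∂μ) ^ (1 / p) := by
    have h4 : I ^ (1 / p) * I ^ (1 - 1 / p) ≤
        ENNReal.ofReal (p / (p - 1)) * (∫⁻ x, g x ^ p ∂μ) ^ (1 / p) * I ^ (1 - 1 / p) := by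
      rw [← ENNReal.rpow_add _ _ hI hMfin, add_sub_cancel, ENNReal.rpow_one, mul_assoc]
      exact hkey.trans (by gcongr)
    refine (ENNReal.mul_le_mul_iff_left ?_ ?_).1 h4
    · exact (ENNReal.rpow_pos (pos_iff_ne_zero.2 hI) hMfin).ne'
    · exact ENNReal.rpow_ne_top_of_ne_zero hI hMfin
  have h5 := ENNReal.rpow_le_rpow h3 hp0.le
  rwa [ENNReal.mul_rpow_of_nonneg _ _ hp0.le, ← ENNReal.rpow_mul, ← ENNReal.rpow_mul,
    one_div_mul_cancel hp0.ne', ENNReal.rpow_one, ENNReal.rpow_one] at h5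

/-- A Carleson-type embedding: if `E Q ⊆ Q` have overlap at most `2`, the averages of `g` over `Q`
weighted by `μ (E Q)` are controlled in `ℓ^p` by the `L^p` norm of `g`. -/
theorem sum_setLAverage_rpow_mul_le (μ : Measure X) {F : Finset (Set X)}
    (hF : IsLaminar (F : Set (Set X))) (hm : ∀ Q ∈ F, MeasurableSet Q)
    (h0 : ∀ Q ∈ F, μ Q ≠ 0) (h1 : ∀ Q ∈ F, μ Q ≠ ∞) {E : Set X → Set X}
    (hE : ∀ Q ∈ F, E Q ⊆ Q) (hEm : ∀ Q ∈ F, MeasurableSet (E Q))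
    (hov : ∀ x, ∑ Q ∈ F, (E Q).indicator (fun _ => (1 : ℝ≥0∞)) x ≤ 2) {p : ℝ} (hp : 1 < p)
    {g : X → ℝ≥0∞} (hg : AEMeasurable g μ) :
    ∑ Q ∈ F, (⨍⁻ x in Q, g x ∂μ) ^ p * μ (E Q) ≤
      2 * ENNReal.ofReal (p / (p - 1)) ^ p * ∫⁻ x, g x ^ p ∂μ := by
  have hp0 : 0 ≤ p := by linarith
  calc ∑ Q ∈ F, (⨍⁻ x in Q, g x ∂μ) ^ p * μ (E Q)
      = ∫⁻ x, ∑ Q ∈ F, (E Q).indicator (fun _ => (⨍⁻ x in Q, g x ∂μ) ^ p) x ∂μ := by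
        rw [lintegral_finsetSum _ (fun Q hQ => measurable_const.indicator (hEm Q hQ))]
        exact Finset.sum_congr rfl fun Q hQ => (lintegral_indicator_const (hEm Q hQ) _).symm
    _ ≤ ∫⁻ x, 2 * familyMaximal μ F g x ^ p ∂μ := by
        refine lintegral_mono fun x => ?_
        calc ∑ Q ∈ F, (E Q).indicator (fun _ => (⨍⁻ x in Q, g x ∂μ) ^ p) x
            ≤ ∑ Q ∈ F, (E Q).indicator (fun _ => (1 : ℝ≥0∞)) x * familyMaximal μ F g x ^ p := by
              refine Finset.sum_le_sum fun Q hQ => ?_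
              by_cases hx : x ∈ E Q
              · simp only [Set.indicator_of_mem hx, one_mul]
                exact ENNReal.rpow_le_rpow (le_familyMaximal μ g hQ (hE Q hQ hx)) hp0
              · simp [Set.indicator_of_notMem hx]
          _ ≤ 2 * familyMaximal μ F g x ^ p := by
              rw [← Finset.sum_mul]; gcongr; exact hov x
    _ = 2 * ∫⁻ x, familyMaximal μ F g x ^ p ∂μ :=
        lintegral_const_mul _ ((measurable_familyMaximal μ g hm).pow_const _)
    _ ≤ _ := by
        rw [mul_assoc]; gcongr; exact lintegral_familyMaximal_rpow_le μ hF hm h0 h1 hp hg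

end Maximal

/-! ### Sparse families -/

section Sparse

variable {X : Type*} [MeasurableSpace X]

/-- `F` is a finite laminar family of measurable sets of positive finite measure, and the sets
`E Q ⊆ Q` carry at least half of the measure of `Q` and have overlap at most `2`. -/
structure IsSparse (μ : Measure X) (F : Finset (Set X)) (E : Set X → Set X) : Prop where
  laminar : IsLaminar (F : Set (Set X))
  measurableSet : ∀ Q ∈ F, MeasurableSet Q
  measure_ne_zero : ∀ Q ∈ F, μ Q ≠ 0
  measure_ne_top : ∀ Q ∈ F, μ Q ≠ ∞
  subset : ∀ Q ∈ F, E Q ⊆ Q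
  measurableSet' : ∀ Q ∈ F, MeasurableSet (E Q)
  measure_le : ∀ Q ∈ F, μ Q ≤ 2 * μ (E Q)
  overlap : ∀ x, ∑ Q ∈ F, (E Q).indicator (fun _ => (1 : ℝ≥0∞)) x ≤ 2

/-- If the product of the averages of `g i` over each member of a laminar family inside `P` is at
least `2 ^ m` times the product over `P`, the family covers at most half of `P`. -/
theorem two_mul_measure_biUnion_le {ι : Type*} [Fintype ι] [Nonempty ι] (μ : Measure X)
    {C : Finset (Set X)} (hC : IsLaminar (C : Set (Set X))) (hm : ∀ Q ∈ C, MeasurableSet Q)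
    (h1 : ∀ Q ∈ C, μ Q ≠ 0) (h2 : ∀ Q ∈ C, μ Q ≠ ∞)
    {P : Set X} (hP0 : μ P ≠ 0) (hP1 : μ P ≠ ∞) (hCP : ∀ Q ∈ C, Q ⊆ P) {g : ι → X → ℝ≥0∞}
    (hgtop : ∀ i, ∫⁻ x in P, g i x ∂μ ≠ ∞)
    (hv : ∏ i, ⨍⁻ x in P, g i x ∂μ ≠ 0)
    (hbig : ∀ Q ∈ C, (2 : ℝ≥0∞) ^ Fintype.card ι * ∏ i, ⨍⁻ x in P, g i x ∂μ ≤
      ∏ i, ⨍⁻ x in Q, g i x ∂μ) :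
    2 * μ (⋃ Q ∈ C, Q) ≤ μ P := by
  obtain ⟨G, hG, hd, hU⟩ := hC.exists_pairwiseDisjoint
  have hGm : ∀ Q ∈ G, MeasurableSet Q := fun Q hQ => hm Q (hG hQ)
  set m : ℝ := (Fintype.card ι : ℝ) with hmdef
  have hm0 : 0 < m := by rw [hmdef]; exact_mod_cast Fintype.card_pos
  set b : ι → ℝ≥0∞ := fun i => ⨍⁻ x in P, g i x ∂μ with hb
  have hbi : ∀ i, b i ≠ 0 := fun i h => hv (Finset.prod_eq_zero (Finset.mem_univ i) h)
  have hbt : ∀ i, b i ≠ ∞ := fun i => by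
    simp only [hb, setLAverage_eq]
    exact (ENNReal.div_lt_top (hgtop i) hP0).ne
  set B : ℝ≥0∞ := ∏ i, b i with hB
  have hBt : B ≠ ∞ := ENNReal.prod_ne_top fun i _ => hbt i
  -- roots of order `m`, to which Hölder's inequality for sums over the maximal sets applies
  have hroot : ∀ Q ∈ G, μ Q * (2 * B ^ (1 / m)) ≤ ∏ i, (∫⁻ x in Q, g i x ∂μ) ^ (1 / m) := by
    intro Q hQ
    have hQ0 := h1 Q (hG hQ)
    have hQ1 := h2 Q (hG hQ)
    have h := ENNReal.rpow_le_rpow (hbig Q (hG hQ)) (show 0 ≤ 1 / m by positivity)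
    rw [ENNReal.mul_rpow_of_nonneg _ _ (by positivity), ← ENNReal.rpow_natCast, ← ENNReal.rpow_mul,
      mul_one_div_cancel hm0.ne', ENNReal.rpow_one] at h
    calc μ Q * (2 * B ^ (1 / m)) ≤ μ Q * ∏ i, (⨍⁻ x in Q, g i x ∂μ) ^ (1 / m) := by
          gcongr
          rwa [ENNReal.prod_rpow_of_nonneg (by positivity)]
      _ = ∏ i, (∫⁻ x in Q, g i x ∂μ) ^ (1 / m) := by
        have hQm : μ Q = ∏ _i : ι, μ Q ^ (1 / m) := by
          rw [Finset.prod_const, Finset.card_univ, ← ENNReal.rpow_natCast, ← ENNReal.rpow_mul,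
            ← hmdef, one_div_mul_cancel hm0.ne', ENNReal.rpow_one]
        conv_lhs => rw [hQm]
        rw [← Finset.prod_mul_distrib]
        refine Finset.prod_congr rfl fun i _ => ?_
        rw [← ENNReal.mul_rpow_of_nonneg _ _ (by positivity), setLAverage_eq,
          ENNReal.mul_div_cancel hQ0 hQ1]
  have hsum : (∑ Q ∈ G, μ Q) * (2 * B ^ (1 / m)) ≤ μ P * B ^ (1 / m) := by
    calc (∑ Q ∈ G, μ Q) * (2 * B ^ (1 / m))
        ≤ ∑ Q ∈ G, ∏ i, (∫⁻ x in Q, g i x ∂μ) ^ (1 / m) := by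
          rw [Finset.sum_mul]; exact Finset.sum_le_sum hroot
      _ ≤ ∏ i, (∑ Q ∈ G, ∫⁻ x in Q, g i x ∂μ) ^ (1 / m) := by
          refine ENNReal.sum_prod_rpow_le G Finset.univ (fun i Q => ∫⁻ x in Q, g i x ∂μ) ?_ ?_
          · rw [Finset.sum_const, Finset.card_univ, nsmul_eq_mul, ← hmdef,
              mul_one_div_cancel hm0.ne']
          · intro i _; positivity
      _ ≤ ∏ i, (∫⁻ x in P, g i x ∂μ) ^ (1 / m) := by
          refine Finset.prod_le_prod' fun i _ => ?_
          refine ENNReal.rpow_le_rpow ?_ (by positivity)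
          rw [← lintegral_biUnion_finset hd hGm]
          exact lintegral_mono_set (Set.iUnion₂_subset fun Q hQ => hCP Q (hG hQ))
      _ = μ P * B ^ (1 / m) := by
          have hPm : μ P = ∏ _i : ι, μ P ^ (1 / m) := by
            rw [Finset.prod_const, Finset.card_univ, ← ENNReal.rpow_natCast, ← ENNReal.rpow_mul,
              ← hmdef, one_div_mul_cancel hm0.ne', ENNReal.rpow_one]
          conv_rhs => rw [hPm, hB, ← ENNReal.prod_rpow_of_nonneg (by positivity),
            ← Finset.prod_mul_distrib]
          refine Finset.prod_congr rfl fun i _ => ?_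
          rw [← ENNReal.mul_rpow_of_nonneg _ _ (by positivity), hb]
          simp only
          rw [setLAverage_eq, ENNReal.mul_div_cancel hP0 hP1]
  rw [← hU, measure_biUnion_finset hd hGm]
  have hBr : B ^ (1 / m) ≠ 0 := (ENNReal.rpow_pos (pos_iff_ne_zero.2 hv) hBt).ne'
  have hBrt : B ^ (1 / m) ≠ ∞ := ENNReal.rpow_ne_top_of_nonneg (by positivity) hBt
  refine (ENNReal.mul_le_mul_iff_left hBr hBrt).1 ?_
  calc 2 * (∑ Q ∈ G, μ Q) * B ^ (1 / m) = (∑ Q ∈ G, μ Q) * (2 * B ^ (1 / m)) := by ring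
    _ ≤ _ := hsum

open Classical in
/-- Sparse domination: a positive operator over a finite laminar family `F`, with coefficients `c`
that sum like a geometric series along chains, is controlled by the same operator over a sparse
subfamily. The subfamily consists of the sets at which the level of the product of averages
exceeds all levels seen at larger sets. -/
theorem exists_isSparse {ι : Type*} [Fintype ι] [Nonempty ι] (μ : Measure X)
    {F : Finset (Set X)} (hF : IsLaminar (F : Set (Set X))) (hm : ∀ Q ∈ F, MeasurableSet Q)
    (h0 : ∀ Q ∈ F, μ Q ≠ 0) (h1 : ∀ Q ∈ F, μ Q ≠ ∞) {g : ι → X → ℝ≥0∞}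
    (hgtop : ∀ Q ∈ F, ∀ i, ∫⁻ x in Q, g i x ∂μ ≠ ∞)
    (hv : ∀ Q ∈ F, ∏ i, ⨍⁻ x in Q, g i x ∂μ ≠ 0) {c : Set X → ℝ≥0∞} {K : ℝ≥0∞}
    (hc : ∀ R ∈ F, ∀ x ∈ R, ∑ Q ∈ F with Q ⊆ R, Q.indicator (fun _ => c Q) x ≤ K * c R) :
    ∃ S ⊆ F, ∃ E, IsSparse μ S E ∧ ∀ x,
      ∑ Q ∈ F, Q.indicator (fun _ => c Q * ∏ i, ⨍⁻ y in Q, g i y ∂μ) x ≤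
        2 ^ Fintype.card ι * K *
          ∑ Q ∈ S, Q.indicator (fun _ => c Q * ∏ i, ⨍⁻ y in Q, g i y ∂μ) x := by
  classical
  set v : Set X → ℝ≥0∞ := fun Q => ∏ i, ⨍⁻ y in Q, g i y ∂μ with hvdef
  set a : ℝ≥0∞ := 2 ^ Fintype.card ι with ha
  have ha1 : 1 < a := one_lt_pow₀ (by norm_num) Fintype.card_ne_zero
  have ha0 : a ≠ 0 := (zero_lt_one.trans ha1).ne'
  have hat : a ≠ ∞ := by rw [ha]; exact ENNReal.pow_ne_top (by norm_num)
  have hvt : ∀ Q ∈ F, v Q ≠ ∞ := fun Q hQ => ENNReal.prod_ne_top fun i _ => by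
    rw [setLAverage_eq]
    exact (ENNReal.div_lt_top (hgtop Q hQ i) (h0 Q hQ)).ne
  have hlev : ∀ Q : Set X, ∃ k : ℤ, Q ∈ F → a ^ k < v Q ∧ v Q ≤ a ^ (k + 1) := by
    intro Q
    by_cases hQ : Q ∈ F
    · obtain ⟨k, hk⟩ := ENNReal.exists_mem_Ioc_zpow (hv Q hQ) (hvt Q hQ) ha1 hat
      exact ⟨k, fun _ => hk⟩
    · exact ⟨0, fun h => absurd h hQ⟩
  choose k hk using hlev
  have hmono : ∀ {i j : ℤ}, i ≤ j → a ^ i ≤ a ^ j := fun h => ENNReal.zpow_le_of_le ha1.le h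
  -- `k Q` is the level of `Q`: the product of averages lies in `(a ^ k Q, a ^ (k Q + 1)]`
  set S := F.filter (fun R => ∀ P ∈ F, R ⊂ P → k P < k R) with hS
  set Ch : Set X → Finset (Set X) := fun P => S.filter (fun R => R ⊆ P ∧ k P + 2 ≤ k R) with hCh
  -- a jump by two levels makes the product of averages grow by the factor `a = 2 ^ m` at least
  set E : Set X → Set X := fun P => P \ ⋃ R ∈ Ch P, R with hE
  have hSF : S ⊆ F := Finset.filter_subset _ _
  have hChF : ∀ P, Ch P ⊆ F := fun P => (Finset.filter_subset _ _).trans hSF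
  refine ⟨S, hSF, E, ⟨hF.mono hSF, fun Q hQ => hm Q (hSF hQ), fun Q hQ => h0 Q (hSF hQ),
    fun Q hQ => h1 Q (hSF hQ), fun Q _ => Set.sdiff_subset, fun Q hQ => ?_, fun P hP => ?_, ?_⟩, ?_⟩
  · exact (hm Q (hSF hQ)).diff (Finset.measurableSet_biUnion _ fun R hR => hm R (hChF Q hR))
  · have hPF := hSF hP
    have hmU : MeasurableSet (⋃ R ∈ Ch P, R) :=
      Finset.measurableSet_biUnion _ fun R hR => hm R (hChF P hR)
    have hsub : ∀ R ∈ Ch P, R ⊆ P := fun R hR => (Finset.mem_filter.1 hR).2.1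
    have hhalf := two_mul_measure_biUnion_le μ (hF.mono (hChF P))
      (fun Q hQ => hm Q (hChF P hQ)) (fun Q hQ => h0 Q (hChF P hQ)) (fun Q hQ => h1 Q (hChF P hQ))
      (h0 P hPF) (h1 P hPF) hsub (hgtop P hPF) (hv P hPF) (fun R hR => by
        have h2 := (Finset.mem_filter.1 hR).2.2
        calc a * v P ≤ a * a ^ (k P + 1) := by gcongr; exact (hk P hPF).2
          _ = a ^ (k P + 2) := by
            rw [show k P + 2 = 1 + (k P + 1) by ring, ENNReal.zpow_add ha0 hat 1 (k P + 1), zpow_one]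
          _ ≤ a ^ (k R) := hmono h2
          _ ≤ v R := (hk R (hChF P hR)).1.le)
    have hUP : (⋃ R ∈ Ch P, R) ⊆ P := Set.iUnion₂_subset hsub
    have hadd : μ (⋃ R ∈ Ch P, R) + μ (E P) = μ P := by
      rw [hE, measure_add_sdiff hmU.nullMeasurableSet, Set.union_eq_self_of_subset_left hUP]
    have hUt : μ (⋃ R ∈ Ch P, R) ≠ ∞ := ne_top_of_le_ne_top (h1 P hPF) (measure_mono hUP)
    rw [← hadd, two_mul] at hhalf
    have hle := (ENNReal.add_le_add_iff_left hUt).1 hhalf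
    rw [← hadd, two_mul]
    gcongr
  · intro x
    -- the members `P` of `S` with `x ∈ E P` form a chain on which the level is injective and takes
    -- at most two values
    rw [show ∑ Q ∈ S, (E Q).indicator (fun _ => (1 : ℝ≥0∞)) x =
        ((S.filter (fun Q => x ∈ E Q)).card : ℝ≥0∞) by
      simp only [Set.indicator_apply]
      rw [← Finset.sum_filter, Finset.sum_const, nsmul_eq_mul, mul_one]]
    set T := S.filter (fun Q => x ∈ E Q) with hT
    have hxT : ∀ P ∈ T, x ∈ P := fun P hP => ((Finset.mem_filter.1 hP).2).1
    have hTS : ∀ P ∈ T, P ∈ S := fun P hP => (Finset.mem_filter.1 hP).1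
    have hcomp : ∀ P ∈ T, ∀ Q ∈ T, P ≠ Q → (P ⊂ Q ∧ k Q < k P) ∨ (Q ⊂ P ∧ k P < k Q) := by
      intro P hP Q hQ hPQ
      have hP' := Finset.mem_filter.1 (hTS P hP)
      have hQ' := Finset.mem_filter.1 (hTS Q hQ)
      rcases hF P hP'.1 Q hQ'.1 with h | h | h
      · have := h.ssubset_of_ne hPQ
        exact Or.inl ⟨this, hP'.2 Q hQ'.1 this⟩
      · have := h.ssubset_of_ne hPQ.symm
        exact Or.inr ⟨this, hQ'.2 P hP'.1 this⟩
      · exact absurd (hxT Q hQ) (Set.disjoint_left.1 h (hxT P hP))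
    have hcard : T.card ≤ 2 := by
      rcases T.eq_empty_or_nonempty with he | hne
      · simp [he]
      obtain ⟨P0, hP0, hmin⟩ := T.exists_min_image k hne
      have hmaps : ∀ P ∈ T, k P ∈ Finset.Icc (k P0) (k P0 + 1) := by
        intro P hP
        refine Finset.mem_Icc.2 ⟨hmin P hP, ?_⟩
        by_contra hlt
        push Not at hlt
        have hne' : P ≠ P0 := by rintro rfl; omega
        rcases hcomp P hP P0 hP0 hne' with ⟨h, _⟩ | ⟨_, h⟩
        · have hmem : P ∈ Ch P0 :=
            Finset.mem_filter.2 ⟨hTS P hP, h.subset, by omega⟩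
          exact ((Finset.mem_filter.1 hP0).2).2 (Set.mem_biUnion hmem (hxT P hP))
        · omega
      have hinj : Set.InjOn k T := by
        intro P hP Q hQ hPQ
        by_contra hne'
        rcases hcomp P hP Q hQ hne' with ⟨_, h⟩ | ⟨_, h⟩ <;> omega
      have := Finset.card_le_card_of_injOn k hmaps hinj
      rw [Int.card_Icc] at this
      omega
    exact_mod_cast hcard
  · intro x
    -- every `Q` is charged to the largest set above it whose level is at least that of `Q`
    have hπ : ∀ Q ∈ F, ∃ R ∈ S, Q ⊆ R ∧ v Q ≤ a * v R := by
      intro Q hQ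
      obtain ⟨R, hQR, hR⟩ := (F.filter (fun R => Q ⊆ R ∧ k Q ≤ k R)).exists_le_maximal
        (Finset.mem_filter.2 ⟨hQ, subset_rfl, le_rfl⟩)
      have hR1 := Finset.mem_filter.1 hR.1
      refine ⟨R, Finset.mem_filter.2 ⟨hR1.1, fun P hP hRP => ?_⟩, hR1.2.1, ?_⟩
      · by_contra hlt
        push Not at hlt
        have := hR.2 (Finset.mem_filter.2 ⟨hP, hR1.2.1.trans hRP.subset, hR1.2.2.trans hlt⟩)
          hRP.subset
        exact hRP.not_subset this
      · calc v Q ≤ a ^ (k Q + 1) := (hk Q hQ).2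
          _ ≤ a ^ (k R + 1) := hmono (by omega)
          _ = a * a ^ (k R) := by rw [add_comm, ENNReal.zpow_add ha0 hat 1 (k R), zpow_one]
          _ ≤ a * v R := by gcongr; exact (hk R hR1.1).1.le
    calc ∑ Q ∈ F, Q.indicator (fun _ => c Q * v Q) x
        ≤ ∑ Q ∈ F, ∑ R ∈ S with Q ⊆ R, Q.indicator (fun _ => c Q) x * (a * v R) := by
          refine Finset.sum_le_sum fun Q hQ => ?_
          obtain ⟨R, hR, hQR, hle⟩ := hπ Q hQ
          refine le_trans ?_ (Finset.single_le_sum (f := fun R => Q.indicator (fun _ => c Q) x *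
            (a * v R)) (fun _ _ => zero_le) (Finset.mem_filter.2 ⟨hR, hQR⟩))
          by_cases hx : x ∈ Q
          · simp only [Set.indicator_of_mem hx]; gcongr
          · simp [Set.indicator_of_notMem hx]
      _ = ∑ R ∈ S, (∑ Q ∈ F with Q ⊆ R, Q.indicator (fun _ => c Q) x) * (a * v R) := by
          simp only [Finset.sum_filter, Finset.sum_mul]
          rw [Finset.sum_comm]
          refine Finset.sum_congr rfl fun R _ => Finset.sum_congr rfl fun Q _ => ?_
          split_ifs <;> simp
      _ ≤ ∑ R ∈ S, a * K * R.indicator (fun _ => c R * v R) x := by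
          refine Finset.sum_le_sum fun R hR => ?_
          by_cases hx : x ∈ R
          · rw [Set.indicator_of_mem hx]
            calc _ ≤ (K * c R) * (a * v R) := by gcongr; exact hc R (hSF hR) x hx
              _ = a * K * (c R * v R) := by ring
          · rw [Finset.sum_eq_zero]
            · simp
            · intro Q hQ
              exact Set.indicator_of_notMem (fun h => hx ((Finset.mem_filter.1 hQ).2 h)) _
      _ = _ := by rw [Finset.mul_sum]

end Sparse

/-! ### Weighted estimates for sparse families -/

/-- The numerical inequality behind both weighted estimates. Here `V`, `X k` and `W`, `Y k` are the
Lebesgue measure and the weighted measures of a cube and of a large subset, `H` is a power of the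
weight constant, and `k₀` is the distinguished index, for which `t k₀ * θ` dominates all the other
exponents `t k`. -/
theorem rpow_neg_mul_prod_le {κ : Type*} [Fintype κ] [DecidableEq κ] (k₀ : κ) {t e : κ → ℝ}
    {s θ : ℝ} {V W H : ℝ≥0∞} {X Y : κ → ℝ≥0∞} (ht : ∀ k, 0 < t k) (hs : 0 ≤ s)
    (hT : 1 < t k₀ * θ) (hXt : ∀ k, X k ≠ ∞) (hY0 : ∀ k, Y k ≠ 0) (hYX : ∀ k, Y k ≤ X k)
    (hV0 : V ≠ 0) (hVt : V ≠ ∞) (hVW : V ≤ 2 * W) (hH : ∏ k, X k ^ (1 / t k) ≤ H * V ^ s)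
    (hW : W ^ s ≤ ∏ k, Y k ^ (1 / t k)) (he₀ : e k₀ = 1) (he : ∀ k, k ≠ k₀ → e k ≤ t k₀ * θ / t k) :
    V ^ (-s) * ∏ k, X k ^ e k ≤ 2 ^ (s * (t k₀ * θ - 1)) * H ^ (t k₀ * θ) *
      ∏ k, (if k = k₀ then X k ^ (1 - θ) * Y k ^ (θ - 1 / t k) else Y k ^ (e k - 1 / t k)) := by
  set T := t k₀ * θ with hTdef
  have hX0 : ∀ k, X k ≠ 0 := fun k h => hY0 k (le_zero_iff.1 (h ▸ hYX k))
  have hYt : ∀ k, Y k ≠ ∞ := fun k => ne_top_of_le_ne_top (hXt k) (hYX k)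
  have hT0 : 0 ≤ T := by linarith
  have hT1 : 0 ≤ T - 1 := by linarith
  have hθ : T / t k₀ = θ := by rw [hTdef, mul_div_cancel_left₀ _ (ht k₀).ne']
  have hVs : V ^ (-s) * V ^ (s * T) = V ^ (s * (T - 1)) := by
    rw [← ENNReal.rpow_add _ _ hV0 hVt]; congr 1; ring
  -- the weight condition is used to the power `T` for the whole cube, and the reverse inequality
  -- `hW` to the power `T - 1` for the large subset; this cancels all powers of `V` and `W`
  calc V ^ (-s) * ∏ k, X k ^ e k
      = V ^ (-s) * ((∏ k, X k ^ (1 / t k)) ^ T * ∏ k, X k ^ (e k - T / t k)) := by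
        rw [← ENNReal.prod_rpow_of_nonneg hT0, ← Finset.prod_mul_distrib]
        congr 1
        refine Finset.prod_congr rfl fun k _ => ?_
        rw [← ENNReal.rpow_mul, ← ENNReal.rpow_add _ _ (hX0 k) (hXt k)]
        congr 1; ring
    _ ≤ V ^ (-s) * ((H * V ^ s) ^ T * ∏ k, X k ^ (e k - T / t k)) := by gcongr
    _ = H ^ T * V ^ (s * (T - 1)) * ∏ k, X k ^ (e k - T / t k) := by
        rw [ENNReal.mul_rpow_of_nonneg _ _ hT0, ← ENNReal.rpow_mul, ← hVs]; ring
    _ ≤ H ^ T * (2 * W) ^ (s * (T - 1)) * ∏ k, X k ^ (e k - T / t k) := by gcongr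
    _ = 2 ^ (s * (T - 1)) * H ^ T * ((W ^ s) ^ (T - 1) * ∏ k, X k ^ (e k - T / t k)) := by
        rw [ENNReal.mul_rpow_of_nonneg _ _ (by positivity), ENNReal.rpow_mul W]; ring
    _ ≤ 2 ^ (s * (T - 1)) * H ^ T *
          ((∏ k, Y k ^ (1 / t k)) ^ (T - 1) * ∏ k, X k ^ (e k - T / t k)) := by gcongr
    _ = 2 ^ (s * (T - 1)) * H ^ T *
          ∏ k, (Y k ^ ((T - 1) / t k) * X k ^ (e k - T / t k)) := by
        rw [← ENNReal.prod_rpow_of_nonneg hT1, ← Finset.prod_mul_distrib]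
        congr 1
        refine Finset.prod_congr rfl fun k _ => ?_
        rw [← ENNReal.rpow_mul]
        congr 2; ring
    _ ≤ _ := by
        gcongr with k _
        split_ifs with hk
        · subst hk
          rw [he₀, hθ, mul_comm, show (T - 1) / t k = θ - 1 / t k by rw [sub_div, hθ]]
        · have hle : X k ^ (e k - T / t k) ≤ Y k ^ (e k - T / t k) := by
            rw [← neg_neg (e k - T / t k), ENNReal.rpow_neg (X k), ENNReal.rpow_neg (Y k)]
            refine ENNReal.inv_le_inv.2 (ENNReal.rpow_le_rpow (hYX k) ?_)
            have := he k hk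
            linarith
          calc _ ≤ Y k ^ ((T - 1) / t k) * Y k ^ (e k - T / t k) := by gcongr
            _ = Y k ^ (e k - 1 / t k) := by
              rw [← ENNReal.rpow_add _ _ (hY0 k) (hYt k)]; congr 1; ring

section

variable {X : Type*} [MeasurableSpace X]

/-- The fractional form of the averaging step: raising an average to a larger power costs exactly
the corresponding power of the `L^p` norm. -/
theorem setLAverage_rpow_mul_rpow_le (μ : Measure X) {p β : ℝ} (hp : 1 < p) (hβ : 0 ≤ β)
    (hβp : β < 1 / p) {g : X → ℝ≥0∞} (hg : AEMeasurable g μ) {Q : Set X} (h0 : μ Q ≠ 0)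
    (h1 : μ Q ≠ ∞) :
    (⨍⁻ x in Q, g x ∂μ) ^ (1 / (1 / p - β)) * μ Q ^ (β / (1 / p - β)) ≤
      (⨍⁻ x in Q, g x ∂μ) ^ p * (∫⁻ x, g x ^ p ∂μ) ^ (β / (1 / p - β)) := by
  set ρ := 1 / p - β with hρ
  have hρ0 : 0 < ρ := by rw [hρ]; linarith
  have hp0 : 0 < p := by linarith
  have hpρ : p * ρ + p * β = 1 := by rw [hρ]; field_simp; ring
  have hex : 1 / ρ - p = p * (β / ρ) := by field_simp; linarith
  have hex0 : 0 ≤ 1 / ρ - p := by rw [hex]; positivity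
  have hav : (⨍⁻ x in Q, g x ∂μ) * μ Q ^ (1 / p) ≤ (∫⁻ x, g x ^ p ∂μ) ^ (1 / p) := by
    have h := setLIntegral_le_of_lintegral_rpow μ hp hg Q
    rw [setLAverage_eq]
    calc (∫⁻ x in Q, g x ∂μ) / μ Q * μ Q ^ (1 / p)
        ≤ ((∫⁻ x, g x ^ p ∂μ) ^ (1 / p) * μ Q ^ (1 - 1 / p)) / μ Q * μ Q ^ (1 / p) := by gcongr
      _ = (∫⁻ x, g x ^ p ∂μ) ^ (1 / p) * (μ Q ^ (1 - 1 / p) * μ Q ^ (1 / p) / μ Q) := by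
        simp only [div_eq_mul_inv]; ring
      _ = _ := by
        rw [← ENNReal.rpow_add _ _ h0 h1, sub_add_cancel, ENNReal.rpow_one,
          ENNReal.div_self h0 h1, mul_one]
  set A := ⨍⁻ x in Q, g x ∂μ
  calc A ^ (1 / ρ) * μ Q ^ (β / ρ)
      = A ^ p * (A * μ Q ^ (1 / p)) ^ (1 / ρ - p) := by
        rw [ENNReal.mul_rpow_of_nonneg _ _ hex0, ← mul_assoc,
          ← ENNReal.rpow_add_of_nonneg _ _ hp0.le hex0, ← ENNReal.rpow_mul, hex]
        congr 2
        · rw [← hex]; ring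
        · field_simp
    _ ≤ A ^ p * ((∫⁻ x, g x ^ p ∂μ) ^ (1 / p)) ^ (1 / ρ - p) := by gcongr
    _ = _ := by
        rw [← ENNReal.rpow_mul, hex]
        congr 2
        field_simp

/-- Hölder's inequality over the members of a sparse family, followed by the Carleson-type embedding
for each of the measures. The excess `β` in the sum of the exponents is absorbed by the fractional
form of the embedding at the index `k₀`. -/
theorem sum_prod_setLAverage_rpow_le {κ : Type*} [Fintype κ] [DecidableEq κ] (k₀ : κ) {r β : ℝ}
    {p : κ → ℝ} (hp : ∀ k, 1 < p k) (hr : 0 < r) (hβ : 0 ≤ β) (hβp : β < 1 / p k₀)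
    (hsum : ∑ k, 1 / p k = 1 / r + β) :
    ∃ C : ℝ≥0, ∀ (lam : Measure X) (F : Finset (Set X)) (E : Set X → Set X), IsSparse lam F E →
      ∀ (ν : κ → Measure X), (∀ k, ∀ Q ∈ F, ν k Q ≠ 0) → (∀ k, ∀ Q ∈ F, ν k Q ≠ ∞) →
      ∀ g : κ → X → ℝ≥0∞, (∀ k, AEMeasurable (g k) (ν k)) →
      ∑ Q ∈ F, (∏ k, (⨍⁻ x in Q, g k x ∂(ν k)) *
        (if k = k₀ then ν k Q ^ β * ν k (E Q) ^ (1 / p k - β) else ν k (E Q) ^ (1 / p k))) ^ r ≤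
      C * (∏ k, (∫⁻ x, g k x ^ p k ∂(ν k)) ^ (1 / p k)) ^ r := by
  set ρ : κ → ℝ := fun k => if k = k₀ then 1 / p k - β else 1 / p k with hρ
  have hp0 : ∀ k, 0 < p k := fun k => by linarith [hp k]
  have hρ0 : ∀ k, 0 < ρ k := by
    intro k
    simp only [hρ]
    split_ifs with h
    · subst h; linarith
    · exact one_div_pos.2 (hp0 k)
  have hρsum : ∑ k, ρ k * r = 1 := by
    have h1 : ∀ k, ρ k = 1 / p k - if k = k₀ then β else 0 := by
      intro k; simp only [hρ]; split_ifs <;> simp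
    rw [← Finset.sum_mul]
    simp only [h1, Finset.sum_sub_distrib, hsum, Finset.sum_ite_eq', Finset.mem_univ, if_true]
    field_simp
    ring
  set D : κ → ℝ≥0 := fun k => 2 * (Real.toNNReal (p k / (p k - 1))) ^ p k with hD
  refine ⟨∏ k, D k ^ (ρ k * r), ?_⟩
  intro lam F E hFE ν hν0 hνt g hg
  set N : κ → ℝ≥0∞ := fun k => ∫⁻ x, g k x ^ p k ∂(ν k) with hN
  set a : κ → Set X → ℝ≥0∞ := fun k Q =>
    if k = k₀ then (⨍⁻ x in Q, g k x ∂(ν k)) ^ (1 / (1 / p k - β)) *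
      ν k Q ^ (β / (1 / p k - β)) * ν k (E Q)
    else (⨍⁻ x in Q, g k x ∂(ν k)) ^ p k * ν k (E Q) with ha
  have hemb : ∀ k, ∑ Q ∈ F, (⨍⁻ x in Q, g k x ∂(ν k)) ^ p k * ν k (E Q) ≤ D k * N k := by
    intro k
    have h := sum_setLAverage_rpow_mul_le (ν k) hFE.laminar hFE.measurableSet (hν0 k) (hνt k)
      hFE.subset hFE.measurableSet' hFE.overlap (hp k) (hg k)
    refine h.trans (le_of_eq ?_)
    simp only [hD, hN, ENNReal.coe_mul, ENNReal.coe_ofNat]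
    rw [ENNReal.coe_rpow_of_nonneg _ (hp0 k).le]
    rfl
  have hfac : ∀ k Q, Q ∈ F → (⨍⁻ x in Q, g k x ∂(ν k)) *
      (if k = k₀ then ν k Q ^ β * ν k (E Q) ^ (1 / p k - β) else ν k (E Q) ^ (1 / p k)) =
      a k Q ^ ρ k := by
    intro k Q _
    simp only [ha, hρ]
    split_ifs with h
    · have h0 : 0 < 1 / p k - β := by subst h; linarith
      rw [ENNReal.mul_rpow_of_nonneg _ _ h0.le, ENNReal.mul_rpow_of_nonneg _ _ h0.le,
        ← ENNReal.rpow_mul, ← ENNReal.rpow_mul, one_div_mul_cancel h0.ne',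
        div_mul_cancel₀ _ h0.ne', ENNReal.rpow_one, mul_assoc]
    · have h0 : 0 < 1 / p k := one_div_pos.2 (hp0 k)
      rw [ENNReal.mul_rpow_of_nonneg _ _ h0.le, ← ENNReal.rpow_mul,
        mul_one_div_cancel (hp0 k).ne', ENNReal.rpow_one]
  have hasum : ∀ k, (∑ Q ∈ F, a k Q) ^ (ρ k * r) ≤
      (D k ^ (ρ k * r) : ℝ≥0) * (N k ^ (1 / p k)) ^ r := by
    intro k
    have h0 := hρ0 k
    have hDr : ((D k ^ (ρ k * r) : ℝ≥0) : ℝ≥0∞) = (D k : ℝ≥0∞) ^ (ρ k * r) :=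
      ENNReal.coe_rpow_of_nonneg _ (by positivity)
    rw [hDr]
    by_cases hk : k = k₀
    · have hρk : ρ k = 1 / p k - β := by simp only [hρ, if_pos hk]
      have hβk : β < 1 / p k := by subst hk; exact hβp
      have hle : ∑ Q ∈ F, a k Q ≤ D k * (N k * N k ^ (β / ρ k)) := by
        calc ∑ Q ∈ F, a k Q
            ≤ ∑ Q ∈ F, (⨍⁻ x in Q, g k x ∂(ν k)) ^ p k * ν k (E Q) * N k ^ (β / ρ k) := by
              refine Finset.sum_le_sum fun Q hQ => ?_
              simp only [ha, if_pos hk]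
              have := setLAverage_rpow_mul_rpow_le (ν k) (hp k) hβ hβk (hg k) (hν0 k Q hQ)
                (hνt k Q hQ)
              rw [hρk, mul_right_comm _ _ (N k ^ _)]
              gcongr ?_ * _
          _ ≤ D k * N k * N k ^ (β / ρ k) := by
              rw [← Finset.sum_mul]; gcongr ?_ * _; exact hemb k
          _ = _ := by ring
      calc (∑ Q ∈ F, a k Q) ^ (ρ k * r)
          ≤ (D k * (N k * N k ^ (β / ρ k))) ^ (ρ k * r) :=
            ENNReal.rpow_le_rpow hle (by positivity)
        _ = _ := by
          rw [ENNReal.mul_rpow_of_nonneg _ _ (by positivity)]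
          congr 1
          have h1 : N k * N k ^ (β / ρ k) = N k ^ (1 + β / ρ k) := by
            rw [ENNReal.rpow_add_of_nonneg _ _ zero_le_one (by positivity), ENNReal.rpow_one]
          rw [h1, ← ENNReal.rpow_mul, ← ENNReal.rpow_mul]
          congr 1
          have : ρ k + β = 1 / p k := by rw [hρk]; ring
          rw [← this]
          field_simp
    · have hρk : ρ k = 1 / p k := by simp only [hρ, if_neg hk]
      have hle : ∑ Q ∈ F, a k Q ≤ D k * N k := by
        simp only [ha, if_neg hk]; exact hemb k
      calc (∑ Q ∈ F, a k Q) ^ (ρ k * r)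
          ≤ (D k * N k) ^ (ρ k * r) := ENNReal.rpow_le_rpow hle (by positivity)
        _ = _ := by
          rw [ENNReal.mul_rpow_of_nonneg _ _ (by positivity), hρk, ENNReal.rpow_mul (N k)]
  calc _ = ∑ Q ∈ F, ∏ k, a k Q ^ (ρ k * r) := by
        refine Finset.sum_congr rfl fun Q hQ => ?_
        rw [← ENNReal.prod_rpow_of_nonneg hr.le]
        refine Finset.prod_congr rfl fun k _ => ?_
        rw [hfac k Q hQ, ← ENNReal.rpow_mul]
    _ ≤ ∏ k, (∑ Q ∈ F, a k Q) ^ (ρ k * r) :=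
        ENNReal.sum_prod_rpow_le F Finset.univ a hρsum fun k _ =>
          mul_nonneg (hρ0 k).le hr.le
    _ ≤ ∏ k, ((D k ^ (ρ k * r) : ℝ≥0) * (N k ^ (1 / p k)) ^ r : ℝ≥0∞) :=
        Finset.prod_le_prod' fun k _ => hasum k
    _ = _ := by
        rw [Finset.prod_mul_distrib, ENNReal.ofNNReal_finsetProd, ENNReal.prod_rpow_of_nonneg hr.le]

end

section

variable {X : Type*} [MeasurableSpace X]

/-- If a power of `lam W` is positive and controlled by a product of powers of the `ν k W`, none of
these vanishes. -/
theorem ne_zero_of_rpow_le_prod {κ : Type*} [Fintype κ] {lam : Measure X} {ν : κ → Measure X}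
    {t : κ → ℝ} {s : ℝ} (ht : ∀ k, 0 < t k) {W : Set X} (hlamt : lam W ≠ ∞)
    (hlam : lam W ≠ 0) (hW : lam W ^ s ≤ ∏ k, ν k W ^ (1 / t k)) (k : κ) : ν k W ≠ 0 := by
  intro h
  have h1 : ∏ k, ν k W ^ (1 / t k) = 0 :=
    Finset.prod_eq_zero (Finset.mem_univ k) (by
      rw [h, ENNReal.zero_rpow_of_pos (one_div_pos.2 (ht k))])
  rw [h1] at hW
  exact (ENNReal.rpow_pos (pos_iff_ne_zero.2 hlam) hlamt).ne' (le_zero_iff.1 hW)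

theorem IsSparse.measure_ne_zero' {lam : Measure X} {F : Finset (Set X)} {E : Set X → Set X}
    (h : IsSparse lam F E) {Q : Set X} (hQ : Q ∈ F) : lam (E Q) ≠ 0 := by
  intro h0
  have := h.measure_le Q hQ
  rw [h0, mul_zero] at this
  exact h.measure_ne_zero Q hQ (le_zero_iff.1 this)

theorem IsSparse.measure_ne_top' {lam : Measure X} {F : Finset (Set X)} {E : Set X → Set X}
    (h : IsSparse lam F E) {Q : Set X} (hQ : Q ∈ F) : lam (E Q) ≠ ∞ :=
  ne_top_of_le_ne_top (h.measure_ne_top Q hQ) (measure_mono (h.subset Q hQ))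

theorem one_div_conjExponent {t : ℝ} (ht : 1 < t) : 1 / t.conjExponent = 1 - 1 / t := by
  have := (Real.HolderConjugate.conjExponent ht).inv_add_inv_eq_one
  simp only [one_div]; linarith

theorem one_lt_conjExponent {t : ℝ} (ht : 1 < t) : 1 < t.conjExponent :=
  (Real.HolderConjugate.conjExponent ht).symm.lt

theorem setLIntegral_eq_mul_setLAverage (μ : Measure X) (g : X → ℝ≥0∞) {Q : Set X} (h0 : μ Q ≠ 0)
    (h1 : μ Q ≠ ∞) : ∫⁻ x in Q, g x ∂μ = μ Q * ⨍⁻ x in Q, g x ∂μ := by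
  rw [setLAverage_eq, ENNReal.mul_div_cancel h0 h1]

/-- The bound for the multilinear form associated with a sparse family. The measures enter
symmetrically, apart from the distinguished index `k₀`. -/
theorem sparse_form_le {κ : Type*} [Fintype κ] [DecidableEq κ] {t : κ → ℝ} {s θ : ℝ}
    (ht : ∀ k, 1 < t k) (hs : ∑ k, 1 / t k = s) (hsθ : s + 2 - θ = Fintype.card κ)
    (hθ : θ ≤ 1) (k₀ : κ) (hT : 1 < t k₀ * θ) (hmax : ∀ k, k ≠ k₀ → t k ≤ t k₀ * θ) :
    ∃ C : ℝ≥0, ∀ (lam : Measure X) (F : Finset (Set X)) (E : Set X → Set X), IsSparse lam F E →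
      ∀ (ν : κ → Measure X) (H : ℝ≥0∞), (∀ k, ∀ Q ∈ F, ν k Q ≠ ∞) →
      (∀ Q ∈ F, ∏ k, ν k Q ^ (1 / t k) ≤ H * lam Q ^ s) →
      (∀ W, MeasurableSet W → lam W ^ s ≤ ∏ k, ν k W ^ (1 / t k)) →
      ∀ g : κ → X → ℝ≥0∞, (∀ k, AEMeasurable (g k) (ν k)) →
      ∑ Q ∈ F, lam Q ^ (-s) * ∏ k, ∫⁻ x in Q, g k x ∂(ν k) ≤
        C * H ^ (t k₀ * θ) *
          ∏ k, (∫⁻ x, g k x ^ (t k).conjExponent ∂(ν k)) ^ (1 / (t k).conjExponent) := by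
  have ht0 : ∀ k, 0 < t k := fun k => by linarith [ht k]
  have hs0 : 0 < s := by
    rw [← hs]
    exact Finset.sum_pos (fun k _ => one_div_pos.2 (ht0 k)) ⟨k₀, Finset.mem_univ _⟩
  have hβ : 1 - θ < 1 / (t k₀).conjExponent := by
    rw [one_div_conjExponent (ht k₀)]
    have : 1 / t k₀ < θ := by rw [div_lt_iff₀ (ht0 k₀)]; linarith
    linarith
  have hsum : ∑ k, 1 / (t k).conjExponent = 1 / 1 + (1 - θ) := by
    simp only [one_div_conjExponent (ht _), Finset.sum_sub_distrib, hs, Finset.sum_const,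
      Finset.card_univ, nsmul_eq_mul, ← hsθ]
    ring
  obtain ⟨C, hC⟩ := sum_prod_setLAverage_rpow_le (X := X) k₀ (p := fun k => (t k).conjExponent)
    (fun k => one_lt_conjExponent (ht k)) zero_lt_one (by linarith) hβ hsum
  have h2 : (2 : ℝ≥0∞) ^ (s * (t k₀ * θ - 1)) ≠ ∞ :=
    ENNReal.rpow_ne_top_of_nonneg (mul_nonneg hs0.le (by linarith)) (by norm_num)
  refine ⟨((2 : ℝ≥0∞) ^ (s * (t k₀ * θ - 1))).toNNReal * C, ?_⟩
  intro lam F E hFE ν H hνt hH hW g hg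
  have hνE0 : ∀ k, ∀ Q ∈ F, ν k (E Q) ≠ 0 := fun k Q hQ =>
    ne_zero_of_rpow_le_prod ht0 (hFE.measure_ne_top' hQ) (hFE.measure_ne_zero' hQ)
      (hW _ (hFE.measurableSet' Q hQ)) k
  have hνE : ∀ k, ∀ Q ∈ F, ν k (E Q) ≤ ν k Q := fun k Q hQ => measure_mono (hFE.subset Q hQ)
  have hν0 : ∀ k, ∀ Q ∈ F, ν k Q ≠ 0 := fun k Q hQ h =>
    hνE0 k Q hQ (le_zero_iff.1 (h ▸ hνE k Q hQ))
  have hCg := hC lam F E hFE ν hν0 hνt g hg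
  simp only [ENNReal.rpow_one] at hCg
  rw [ENNReal.coe_mul, ENNReal.coe_toNNReal h2]
  calc ∑ Q ∈ F, lam Q ^ (-s) * ∏ k, ∫⁻ x in Q, g k x ∂(ν k)
      = ∑ Q ∈ F, (lam Q ^ (-s) * ∏ k, ν k Q ^ (1 : ℝ)) * ∏ k, ⨍⁻ x in Q, g k x ∂(ν k) := by
        refine Finset.sum_congr rfl fun Q hQ => ?_
        rw [mul_assoc, ← Finset.prod_mul_distrib]
        congr 1
        refine Finset.prod_congr rfl fun k _ => ?_
        rw [ENNReal.rpow_one, setLIntegral_eq_mul_setLAverage _ _ (hν0 k Q hQ) (hνt k Q hQ)]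
    _ ≤ ∑ Q ∈ F, (2 ^ (s * (t k₀ * θ - 1)) * H ^ (t k₀ * θ) *
          ∏ k, (if k = k₀ then ν k Q ^ (1 - θ) * ν k (E Q) ^ (θ - 1 / t k)
            else ν k (E Q) ^ (1 - 1 / t k))) * ∏ k, ⨍⁻ x in Q, g k x ∂(ν k) := by
        refine Finset.sum_le_sum fun Q hQ => ?_
        gcongr ?_ * _
        refine rpow_neg_mul_prod_le k₀ ht0 hs0.le hT (fun k => hνt k Q hQ)
          (fun k => hνE0 k Q hQ) (fun k => hνE k Q hQ) (hFE.measure_ne_zero Q hQ)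
          (hFE.measure_ne_top Q hQ) (hFE.measure_le Q hQ) (hH Q hQ)
          (hW _ (hFE.measurableSet' Q hQ)) rfl (fun k hk => ?_)
        rw [le_div_iff₀ (ht0 k), one_mul]
        exact hmax k hk
    _ = 2 ^ (s * (t k₀ * θ - 1)) * H ^ (t k₀ * θ) * ∑ Q ∈ F, ∏ k, (⨍⁻ x in Q, g k x ∂(ν k)) *
          (if k = k₀ then ν k Q ^ (1 - θ) * ν k (E Q) ^ (1 / (t k).conjExponent - (1 - θ))
            else ν k (E Q) ^ (1 / (t k).conjExponent)) := by
        rw [Finset.mul_sum]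
        refine Finset.sum_congr rfl fun Q _ => ?_
        rw [Finset.prod_mul_distrib, mul_assoc, mul_comm (∏ k, ⨍⁻ x in Q, g k x ∂(ν k))]
        congr 2
        refine Finset.prod_congr rfl fun k _ => ?_
        rw [one_div_conjExponent (ht k), show 1 - 1 / t k - (1 - θ) = θ - 1 / t k by ring]
    _ ≤ _ := (mul_le_mul_right hCg _).trans (le_of_eq (by ring))

/-- The value at `x` of the positive operator over the family `F` whose coefficient at `Q` is
`lam Q ^ (-s) * ∏ᵢ ∫_Q g i dν i`. -/
noncomputable def familyOperator {ι : Type*} [Fintype ι] (lam : Measure X) (s : ℝ)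
    (F : Finset (Set X)) (ν : ι → Measure X) (g : ι → X → ℝ≥0∞) (x : X) : ℝ≥0∞ :=
  ∑ Q ∈ F, Q.indicator (fun _ => lam Q ^ (-s) * ∏ i, ∫⁻ y in Q, g i y ∂(ν i)) x

/-- The weighted bound for a sparse operator. If the target exponent exceeds `1` it follows from
the bound for the multilinear form by testing against a power of the operator itself; otherwise
the target exponent turns the sum into a sum of powers. -/
theorem sparse_operator_le {ι : Type*} [Fintype ι] [DecidableEq ι] {t : Option ι → ℝ} {s θ : ℝ}
    (ht : ∀ i, 1 < t (some i)) (hq : 0 < t none) (hs : ∑ k, 1 / t k = s)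
    (hsθ : s + 1 - θ = Fintype.card ι) (hθ : θ ≤ 1) (k₀ : Option ι)
    (hT : 1 < t k₀ * θ) (hmax : ∀ k, k ≠ k₀ → t k ≤ t k₀ * θ) :
    ∃ C : ℝ≥0, ∀ (lam : Measure X) (F : Finset (Set X)) (E : Set X → Set X), IsSparse lam F E →
      ∀ (ν : Option ι → Measure X) (H : ℝ≥0∞), (∀ k, ∀ Q ∈ F, ν k Q ≠ ∞) →
      (∀ Q ∈ F, ∏ k, ν k Q ^ (1 / t k) ≤ H * lam Q ^ s) →
      (∀ W, MeasurableSet W → lam W ^ s ≤ ∏ k, ν k W ^ (1 / t k)) →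
      ∀ g : ι → X → ℝ≥0∞, (∀ i, AEMeasurable (g i) (ν (some i))) →
      (∀ i, ∫⁻ x, g i x ^ (t (some i)).conjExponent ∂(ν (some i)) ≠ ∞) →
      ∫⁻ x, familyOperator lam s F (fun i => ν (some i)) g x ^ t none ∂(ν none) ≤
        (C * H ^ (t k₀ * θ) * ∏ i, (∫⁻ x, g i x ^ (t (some i)).conjExponent ∂(ν (some i))) ^
          (1 / (t (some i)).conjExponent)) ^ t none := by
  have ht0 : ∀ k, 0 < t k := by
    rintro (_ | i)
    · exact hq
    · linarith [ht i]
  have hs0 : 0 < s := by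
    rw [← hs]
    exact Finset.sum_pos (fun k _ => one_div_pos.2 (ht0 k)) ⟨k₀, Finset.mem_univ _⟩
  rcases lt_or_ge 1 (t none) with hq1 | hq1
  · have ht1 : ∀ k, 1 < t k := by
      rintro (_ | i)
      · exact hq1
      · exact ht i
    obtain ⟨C, hC⟩ := sparse_form_le (X := X) ht1 hs
      (by rw [Fintype.card_option]; push_cast; rw [← hsθ]; ring) hθ k₀ hT hmax
    refine ⟨C, ?_⟩
    intro lam F E hFE ν H hνt hH hW g hg hgfin
    set q := t none with hqdef
    set S : X → ℝ≥0∞ := familyOperator lam s F (fun i => ν (some i)) g with hS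
    set a : Set X → ℝ≥0∞ := fun Q => lam Q ^ (-s) * ∏ i, ∫⁻ y in Q, g i y ∂(ν (some i)) with ha
    have hSm : Measurable S := by
      simp only [hS]
      exact Finset.measurable_sum _ fun Q hQ =>
        measurable_const.indicator (hFE.measurableSet Q hQ)
    have hat : ∀ Q ∈ F, a Q ≠ ∞ := by
      intro Q hQ
      refine ENNReal.mul_ne_top ?_ (ENNReal.prod_ne_top fun i _ => ?_)
      · exact ENNReal.rpow_ne_top_of_ne_zero (hFE.measure_ne_zero Q hQ)
          (hFE.measure_ne_top Q hQ)
      · refine ne_top_of_le_ne_top ?_ (setLIntegral_le_of_lintegral_rpow (ν (some i))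
          (one_lt_conjExponent (ht i)) (hg i) Q)
        have h1 := one_lt_conjExponent (ht i)
        refine ENNReal.mul_ne_top (ENNReal.rpow_ne_top_of_nonneg (by positivity) (hgfin i))
          (ENNReal.rpow_ne_top_of_nonneg ?_ (hνt _ Q hQ))
        rw [sub_nonneg, div_le_one (by linarith)]; exact h1.le
    set I := ∫⁻ x, S x ^ q ∂(ν none) with hI
    -- `I` is finite, so that a power of it can be cancelled at the end
    have hIt : I ≠ ∞ := by
      have hle : ∀ x, S x ^ q ≤ (⋃ Q ∈ F, Q).indicator (fun _ => (∑ Q ∈ F, a Q) ^ q) x := by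
        intro x
        by_cases hx : x ∈ ⋃ Q ∈ F, Q
        · rw [Set.indicator_of_mem hx]
          refine ENNReal.rpow_le_rpow (Finset.sum_le_sum fun Q _ => ?_) hq.le
          exact Set.indicator_le_self' (fun _ _ => zero_le) x
        · rw [Set.indicator_of_notMem hx]
          have : S x = 0 := Finset.sum_eq_zero fun Q hQ =>
            Set.indicator_of_notMem (fun h => hx (Set.mem_biUnion hQ h)) _
          rw [this, ENNReal.zero_rpow_of_pos hq]
      refine ne_top_of_le_ne_top ?_ (lintegral_mono hle)
      rw [lintegral_indicator_const (Finset.measurableSet_biUnion _ hFE.measurableSet)]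
      refine ENNReal.mul_ne_top
        (ENNReal.rpow_ne_top_of_nonneg hq.le (ENNReal.sum_ne_top.2 hat)) ?_
      refine ne_top_of_le_ne_top ?_ (measure_biUnion_finset_le F _)
      exact ENNReal.sum_ne_top.2 fun Q hQ => hνt none Q hQ
    set G : Option ι → X → ℝ≥0∞ := fun k => k.elim (fun x => S x ^ (q - 1)) g with hG
    have hform := hC lam F E hFE ν H hνt hH hW G (by
      rintro (_ | i)
      · exact (hSm.pow_const _).aemeasurable
      · exact hg i)
    have hlhs : ∑ Q ∈ F, lam Q ^ (-s) * ∏ k, ∫⁻ x in Q, G k x ∂(ν k) = I := by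
      calc _ = ∑ Q ∈ F, a Q * ∫⁻ x in Q, S x ^ (q - 1) ∂(ν none) := by
            refine Finset.sum_congr rfl fun Q _ => ?_
            rw [Fintype.prod_option]
            simp only [hG, Option.elim, ha]
            ring
        _ = ∫⁻ x, ∑ Q ∈ F, Q.indicator (fun _ => a Q) x * S x ^ (q - 1) ∂(ν none) := by
            rw [lintegral_finsetSum (f := fun Q x => Q.indicator (fun _ => a Q) x * S x ^ (q - 1)) F
              fun Q hQ =>
              (measurable_const.indicator (hFE.measurableSet Q hQ)).mul (hSm.pow_const _)]
            refine Finset.sum_congr rfl fun Q hQ => ?_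
            rw [← lintegral_const_mul _ (hSm.pow_const _),
              ← lintegral_indicator (hFE.measurableSet Q hQ)]
            refine lintegral_congr fun x => ?_
            by_cases hx : x ∈ Q
            · simp [Set.indicator_of_mem hx]
            · simp [Set.indicator_of_notMem hx]
        _ = I := by
            refine lintegral_congr fun x => ?_
            rw [← Finset.sum_mul]
            change S x * S x ^ (q - 1) = S x ^ q
            conv_lhs => rw [← ENNReal.rpow_one (S x), ← ENNReal.rpow_mul, one_mul]
            rw [← ENNReal.rpow_add_of_nonneg _ _ zero_le_one (by linarith), add_sub_cancel]
    have hnone : ∫⁻ x, G none x ^ (t none).conjExponent ∂(ν none) = I := by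
      refine lintegral_congr fun x => ?_
      simp only [hG, Option.elim]
      rw [← ENNReal.rpow_mul]
      congr 1
      rw [← hqdef]
      have : q - 1 ≠ 0 := by linarith
      unfold Real.conjExponent
      field_simp
    rw [hlhs, Fintype.prod_option, hnone, one_div_conjExponent hq1] at hform
    simp only [hG, Option.elim] at hform
    rcases eq_or_ne I 0 with h0 | h0
    · rw [h0]; exact zero_le
    set P := ∏ i, (∫⁻ x, g i x ^ (t (some i)).conjExponent ∂(ν (some i))) ^
          (1 / (t (some i)).conjExponent) with hP
    have hroot : I ^ (1 / q) ≤ C * H ^ (t k₀ * θ) * P := by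
      have h4 : I ^ (1 / q) * I ^ (1 - 1 / q) ≤ C * H ^ (t k₀ * θ) * P * I ^ (1 - 1 / q) := by
        rw [← ENNReal.rpow_add _ _ h0 hIt, add_sub_cancel, ENNReal.rpow_one]
        exact hform.trans (le_of_eq (by ring))
      refine (ENNReal.mul_le_mul_iff_left ?_ ?_).1 h4
      · exact (ENNReal.rpow_pos (pos_iff_ne_zero.2 h0) hIt).ne'
      · exact ENNReal.rpow_ne_top_of_ne_zero h0 hIt
    calc I = (I ^ (1 / q)) ^ q := by
          rw [← ENNReal.rpow_mul, one_div_mul_cancel hq.ne', ENNReal.rpow_one]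
      _ ≤ _ := ENNReal.rpow_le_rpow hroot hq.le
  · -- since `t none * θ ≤ 1`, the distinguished index is one of the `some j`
    obtain ⟨j, rfl⟩ : ∃ j, k₀ = some j := by
      rcases k₀ with _ | j
      · have : t none * θ ≤ 1 * 1 := by
          by_cases h : 0 ≤ θ
          · exact mul_le_mul hq1 hθ h zero_le_one
          · push Not at h
            nlinarith
        linarith
      · exact ⟨j, rfl⟩
    have hsum : ∑ i, 1 / (t (some i)).conjExponent = 1 / t none + (1 - θ) := by
      rw [Fintype.sum_option] at hs
      simp only [one_div_conjExponent (ht _), Finset.sum_sub_distrib, Finset.sum_const,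
        Finset.card_univ, nsmul_eq_mul, ← hsθ]
      linarith
    have hβ : 1 - θ < 1 / (t (some j)).conjExponent := by
      rw [one_div_conjExponent (ht j)]
      have : 1 / t (some j) < θ := by rw [div_lt_iff₀ (ht0 _)]; linarith
      linarith
    obtain ⟨C, hC⟩ := sum_prod_setLAverage_rpow_le (X := X) j
      (p := fun i => (t (some i)).conjExponent)
      (fun k => one_lt_conjExponent (ht k)) hq (by linarith) hβ hsum
    have h2 : (2 : ℝ≥0∞) ^ (s * (t (some j) * θ - 1)) ≠ ∞ :=
      ENNReal.rpow_ne_top_of_nonneg (mul_nonneg hs0.le (by linarith)) (by norm_num)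
    refine ⟨((2 : ℝ≥0∞) ^ (s * (t (some j) * θ - 1))).toNNReal * C ^ (1 / t none), ?_⟩
    intro lam F E hFE ν H hνt hH hW g hg hgfin
    rw [ENNReal.coe_mul, ENNReal.coe_toNNReal h2,
      ENNReal.coe_rpow_of_nonneg _ (one_div_pos.2 hq).le]
    set q := t none with hqdef
    have hνE0 : ∀ k, ∀ Q ∈ F, ν k (E Q) ≠ 0 := fun k Q hQ =>
      ne_zero_of_rpow_le_prod ht0 (hFE.measure_ne_top' hQ) (hFE.measure_ne_zero' hQ)
        (hW _ (hFE.measurableSet' Q hQ)) k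
    have hνE : ∀ k, ∀ Q ∈ F, ν k (E Q) ≤ ν k Q := fun k Q hQ => measure_mono (hFE.subset Q hQ)
    have hν0 : ∀ k, ∀ Q ∈ F, ν k Q ≠ 0 := fun k Q hQ h =>
      hνE0 k Q hQ (le_zero_iff.1 (h ▸ hνE k Q hQ))
    have hCg := hC lam F E hFE (fun i => ν (some i)) (fun i => hν0 _) (fun i => hνt _) g hg
    set T := t (some j) * θ with hTdef
    -- the exponent of the target measure is `1 / q`, so that its power cancels completely
    let e : Option ι → ℝ := fun k => k.elim (1 / q) (fun _ => 1)
    have hcoef : ∀ Q ∈ F, lam Q ^ (-s) * (ν none Q ^ (1 / q) * ∏ i, ν (some i) Q) ≤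
        2 ^ (s * (T - 1)) * H ^ T * ∏ i, (if i = j then
          ν (some i) Q ^ (1 - θ) * ν (some i) (E Q) ^ (1 / (t (some i)).conjExponent - (1 - θ))
          else ν (some i) (E Q) ^ (1 / (t (some i)).conjExponent)) := by
      intro Q hQ
      have h := rpow_neg_mul_prod_le (some j) (e := e) ht0 hs0.le hT (fun k => hνt k Q hQ)
          (fun k => hνE0 k Q hQ) (fun k => hνE k Q hQ) (hFE.measure_ne_zero Q hQ)
          (hFE.measure_ne_top Q hQ) (hFE.measure_le Q hQ) (hH Q hQ)
          (hW _ (hFE.measurableSet' Q hQ)) rfl (by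
            rintro (_ | i) hk
            · exact div_le_div_of_nonneg_right hT.le hq.le
            · change 1 ≤ T / t (some i)
              rw [le_div_iff₀ (ht0 _), one_mul]
              exact hmax _ hk)
      rw [Fintype.prod_option, Fintype.prod_option] at h
      simp only [e, Option.elim, ENNReal.rpow_one, reduceCtorEq, if_false, Option.some.injEq,
        ← hqdef, sub_self, ENNReal.rpow_zero, one_mul] at h
      refine h.trans (le_of_eq ?_)
      congr 1
      refine Finset.prod_congr rfl fun i _ => ?_
      rw [one_div_conjExponent (ht i), show 1 - 1 / t (some i) - (1 - θ) = θ - 1 / t (some i) by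
        ring]
    calc ∫⁻ x, familyOperator lam s F (fun i => ν (some i)) g x ^ q ∂(ν none)
        ≤ ∫⁻ x, ∑ Q ∈ F, Q.indicator
            (fun _ => (lam Q ^ (-s) * ∏ i, ∫⁻ y in Q, g i y ∂(ν (some i))) ^ q) x ∂(ν none) := by
          refine lintegral_mono fun x => ?_
          refine (Finset.le_sum_of_subadditive (fun y : ℝ≥0∞ => y ^ q)
            (by simp [hq]) (fun a b => ENNReal.rpow_add_le_add_rpow a b hq.le hq1) F _).trans ?_
          refine Finset.sum_le_sum fun Q _ => ?_
          by_cases hx : x ∈ Q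
          · simp [Set.indicator_of_mem hx]
          · simp [Set.indicator_of_notMem hx, hq]
      _ = ∑ Q ∈ F, (lam Q ^ (-s) * ∏ i, ∫⁻ y in Q, g i y ∂(ν (some i))) ^ q * ν none Q := by
          rw [lintegral_finsetSum _ fun Q hQ =>
            measurable_const.indicator (hFE.measurableSet Q hQ)]
          exact Finset.sum_congr rfl fun Q hQ =>
            lintegral_indicator_const (hFE.measurableSet Q hQ) _
      _ ≤ ∑ Q ∈ F, (2 ^ (s * (T - 1)) * H ^ T) ^ q *
            (∏ i, (⨍⁻ y in Q, g i y ∂(ν (some i))) * (if i = j then ν (some i) Q ^ (1 - θ) *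
              ν (some i) (E Q) ^ (1 / (t (some i)).conjExponent - (1 - θ))
              else ν (some i) (E Q) ^ (1 / (t (some i)).conjExponent))) ^ q := by
          refine Finset.sum_le_sum fun Q hQ => ?_
          have hνq : ν none Q = (ν none Q ^ (1 / q)) ^ q := by
            rw [← ENNReal.rpow_mul, one_div_mul_cancel hq.ne', ENNReal.rpow_one]
          conv_lhs => rw [hνq]
          rw [← ENNReal.mul_rpow_of_nonneg _ _ hq.le, ← ENNReal.mul_rpow_of_nonneg _ _ hq.le]
          refine ENNReal.rpow_le_rpow ?_ hq.le
          rw [Finset.prod_mul_distrib]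
          calc lam Q ^ (-s) * (∏ i, ∫⁻ y in Q, g i y ∂(ν (some i))) * ν none Q ^ (1 / q)
              = (lam Q ^ (-s) * (ν none Q ^ (1 / q) * ∏ i, ν (some i) Q)) *
                ∏ i, ⨍⁻ y in Q, g i y ∂(ν (some i)) := by
                rw [Finset.prod_congr rfl fun i _ => setLIntegral_eq_mul_setLAverage (ν (some i))
                  (g i) (hν0 _ Q hQ) (hνt _ Q hQ), Finset.prod_mul_distrib]
                ring
            _ ≤ _ := mul_le_mul_left (hcoef Q hQ) _
            _ = _ := by ring
      _ ≤ (2 ^ (s * (T - 1)) * H ^ T) ^ q * (C * (∏ i, (∫⁻ x, g i x ^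
            (t (some i)).conjExponent ∂(ν (some i))) ^ (1 / (t (some i)).conjExponent)) ^ q) := by
          rw [← Finset.mul_sum]
          exact mul_le_mul_right hCg _
      _ = _ := by
          have hCq : ((C : ℝ≥0∞) ^ (1 / q)) ^ q = C := by
            rw [← ENNReal.rpow_mul, one_div_mul_cancel hq.ne', ENNReal.rpow_one]
          simp only [ENNReal.mul_rpow_of_nonneg _ _ hq.le, hCq]
          ring

end

/-! ### Cubes and dyadic grids -/

/-- Tonelli's theorem for a product of functions of one variable each; almost everywhere
measurability suffices. -/
theorem lintegral_fin_prod_eq_prod {m : ℕ} {X : Type*} [MeasurableSpace X] (μ : Measure X)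
    [SigmaFinite μ] (f : Fin m → X → ℝ≥0∞) (hf : ∀ i, AEMeasurable (f i) μ) :
    ∫⁻ y : Fin m → X, ∏ i, f i (y i) ∂(Measure.pi fun _ => μ) = ∏ i, ∫⁻ x, f i x ∂μ := by
  induction m with
  | zero => simp
  | succ m ih =>
    have hq : ∀ i : Fin m, AEMeasurable (fun y : Fin m → X => f i.succ (y i))
        (Measure.pi fun _ => μ) := fun i =>
      (hf i.succ).comp_quasiMeasurePreserving (Measure.quasiMeasurePreserving_eval (fun _ => μ) i)
    calc ∫⁻ y : Fin (m + 1) → X, ∏ i, f i (y i) ∂(Measure.pi fun _ => μ)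
        = ∫⁻ z : X × (Fin m → X), f 0 z.1 * ∏ i : Fin m, f i.succ (z.2 i)
            ∂(μ.prod (Measure.pi fun _ => μ)) := by
          rw [← ((measurePreserving_piFinSuccAbove
            (fun _ : Fin (m + 1) => μ) 0).symm).lintegral_comp_emb
            (MeasurableEquiv.measurableEmbedding _) (fun y => ∏ i, f i (y i))]
          refine lintegral_congr fun z => ?_
          rw [Fin.prod_univ_succ]
          rfl
      _ = (∫⁻ x, f 0 x ∂μ) * ∏ i : Fin m, ∫⁻ x, f i.succ x ∂μ := by
          rw [← ih (fun i => f i.succ) (fun i => hf i.succ)]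
          exact lintegral_prod_mul (hf 0) (Finset.aemeasurable_fun_prod _ fun i _ => hq i)
      _ = _ := by rw [Fin.prod_univ_succ]

section Cubes

variable {n : ℕ}

theorem cube_eq_preimage (a : EuclideanSpace ℝ (Fin n)) (l : ℝ) :
    cube a l = WithLp.ofLp ⁻¹' (Set.univ.pi fun k => Set.Ico (a k) (a k + l)) := by
  ext x; simp [cube, Set.mem_pi]

theorem measurableSet_cube (a : EuclideanSpace ℝ (Fin n)) (l : ℝ) : MeasurableSet (cube a l) := by
  rw [cube_eq_preimage]
  exact (PiLp.volume_preserving_ofLp (Fin n)).measurable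
    (MeasurableSet.univ_pi fun k => measurableSet_Ico)

theorem volume_cube (a : EuclideanSpace ℝ (Fin n)) (l : ℝ) :
    volume (cube a l) = ENNReal.ofReal l ^ n := by
  rw [cube_eq_preimage, (PiLp.volume_preserving_ofLp (Fin n)).measure_preimage
    (MeasurableSet.univ_pi fun k => measurableSet_Ico).nullMeasurableSet, volume_pi_pi]
  simp [Real.volume_Ico]

end Cubes

section Dyadic

variable {n : ℕ}

/-- The translation, at scale `2 ^ (-k)` and in units of that scale, of the dyadic grid indexed by
`τ`. In each coordinate the grid is either the standard one or is shifted by one third, with a sign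
that alternates with the scale, which keeps consecutive scales nested. -/
noncomputable def gridOffset (τ : Fin n → Bool) (k : ℤ) (j : Fin n) : ℝ :=
  if τ j then (-1) ^ k / 3 else 0

/-- The cell of side length `2 ^ (-k)` and position `z` in the dyadic grid indexed by `τ`. -/
def gridCell (τ : Fin n → Bool) (k : ℤ) (z : Fin n → ℤ) : Set (EuclideanSpace ℝ (Fin n)) :=
  {x | ∀ j, ⌊(2 : ℝ) ^ k * x j - gridOffset τ k j⌋ = z j}

/-- The collection of all cells of the dyadic grid indexed by `τ`. -/
def dyadicGrid (τ : Fin n → Bool) : Set (Set (EuclideanSpace ℝ (Fin n))) :=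
  Set.range fun p : ℤ × (Fin n → ℤ) => gridCell τ p.1 p.2

theorem countable_dyadicGrid (τ : Fin n → Bool) : (dyadicGrid τ).Countable :=
  Set.countable_range _

theorem gridCell_eq_cube (τ : Fin n → Bool) (k : ℤ) (z : Fin n → ℤ) :
    gridCell τ k z =
      cube (WithLp.toLp 2 fun j => (2 : ℝ) ^ (-k) * (z j + gridOffset τ k j)) ((2 : ℝ) ^ (-k)) := by
  ext x
  refine forall_congr' fun j => ?_
  have h2 : (0 : ℝ) < 2 ^ k := by positivity
  rw [Int.floor_eq_iff, zpow_neg]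
  have e1 : ((2 : ℝ) ^ k)⁻¹ * (z j + gridOffset τ k j) ≤ x j ↔
      z j + gridOffset τ k j ≤ 2 ^ k * x j := by
    rw [inv_mul_le_iff₀ h2]
  have e2 : x j < ((2 : ℝ) ^ k)⁻¹ * (z j + gridOffset τ k j) + ((2 : ℝ) ^ k)⁻¹ ↔
      2 ^ k * x j < z j + gridOffset τ k j + 1 := by
    rw [← mul_add_one, lt_inv_mul_iff₀ h2]
  simp only [e1, e2]
  constructor <;> rintro ⟨h, h'⟩ <;> constructor <;> linarith

theorem measurableSet_gridCell (τ : Fin n → Bool) (k : ℤ) (z : Fin n → ℤ) :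
    MeasurableSet (gridCell τ k z) := by
  rw [gridCell_eq_cube]; exact measurableSet_cube _ _

theorem volume_gridCell (τ : Fin n → Bool) (k : ℤ) (z : Fin n → ℤ) :
    volume (gridCell τ k z) = ENNReal.ofReal ((2 : ℝ) ^ (-k)) ^ n := by
  rw [gridCell_eq_cube]; exact volume_cube _ _

/-- Each cell of a grid lies in a single cell of the next coarser scale. -/
theorem floor_eq_of_floor_succ_eq (τ : Fin n → Bool) (k : ℤ) (j : Fin n) {x y : ℝ}
    (h : ⌊(2 : ℝ) ^ (k + 1) * x - gridOffset τ (k + 1) j⌋ =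
      ⌊(2 : ℝ) ^ (k + 1) * y - gridOffset τ (k + 1) j⌋) :
    ⌊(2 : ℝ) ^ k * x - gridOffset τ k j⌋ = ⌊(2 : ℝ) ^ k * y - gridOffset τ k j⌋ := by
  -- twice the offset at one scale differs from the offset at the next one by an integer
  obtain ⟨i, hi⟩ : ∃ i : ℤ, 2 * gridOffset τ k j = gridOffset τ (k + 1) j + i := by
    unfold gridOffset
    by_cases hτ : τ j = true
    · refine ⟨(((-1 : ℤˣ) ^ k : ℤˣ) : ℤ), ?_⟩
      rcases Int.even_or_odd k with hk | hk
      · simp [hτ, hk.neg_one_zpow, zpow_add₀]; norm_num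
      · simp [hτ, hk.neg_one_zpow, zpow_add₀]; norm_num
    · exact ⟨0, by simp [hτ]⟩
  have key : ∀ x : ℝ, ⌊(2 : ℝ) ^ k * x - gridOffset τ k j⌋ =
      (⌊(2 : ℝ) ^ (k + 1) * x - gridOffset τ (k + 1) j⌋ - i) / 2 := by
    intro x
    have : (2 : ℝ) ^ k * x - gridOffset τ k j =
        ((2 : ℝ) ^ (k + 1) * x - gridOffset τ (k + 1) j - i) / (2 : ℕ) := by
      rw [zpow_add₀ (by norm_num), zpow_one]; push_cast; linarith
    rw [this, Int.floor_div_natCast, Int.floor_sub_intCast]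
    rfl
  rw [key, key, h]

theorem floor_eq_of_le (τ : Fin n → Bool) {k l : ℤ} (hkl : k ≤ l) (j : Fin n) {x y : ℝ}
    (h : ⌊(2 : ℝ) ^ l * x - gridOffset τ l j⌋ = ⌊(2 : ℝ) ^ l * y - gridOffset τ l j⌋) :
    ⌊(2 : ℝ) ^ k * x - gridOffset τ k j⌋ = ⌊(2 : ℝ) ^ k * y - gridOffset τ k j⌋ := by
  induction l, hkl using Int.leInduction with
  | base => exact h
  | succ l _ ih => exact ih (floor_eq_of_floor_succ_eq τ l j h)

theorem isLaminar_dyadicGrid (τ : Fin n → Bool) : IsLaminar (dyadicGrid τ) := by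
  have key : ∀ (k l : ℤ) (z w : Fin n → ℤ), k ≤ l →
      gridCell τ l w ⊆ gridCell τ k z ∨ Disjoint (gridCell τ k z) (gridCell τ l w) := by
    intro k l z w hkl
    by_cases hd : Disjoint (gridCell τ k z) (gridCell τ l w)
    · exact Or.inr hd
    obtain ⟨x, hx1, hx2⟩ := Set.not_disjoint_iff.1 hd
    left
    intro y hy j
    rw [← hx1 j]
    exact floor_eq_of_le τ hkl j ((hy j).trans (hx2 j).symm)
  rintro _ ⟨⟨k, z⟩, rfl⟩ _ ⟨⟨l, w⟩, rfl⟩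
  rcases le_total k l with h | h
  · rcases key k l z w h with h' | h'
    · exact Or.inr (Or.inl h')
    · exact Or.inr (Or.inr h')
  · rcases key l k w z h with h' | h'
    · exact Or.inl h'
    · exact Or.inr (Or.inr h'.symm)

theorem volume_ne_zero_of_mem_dyadicGrid {τ : Fin n → Bool} {Q : Set (EuclideanSpace ℝ (Fin n))}
    (hQ : Q ∈ dyadicGrid τ) : volume Q ≠ 0 := by
  obtain ⟨⟨k, z⟩, rfl⟩ := hQ
  have : (0 : ℝ) < 2 ^ (-k) := by positivity
  simp only [volume_gridCell]
  exact pow_ne_zero _ (by simpa using this)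

theorem volume_ne_top_of_mem_dyadicGrid {τ : Fin n → Bool} {Q : Set (EuclideanSpace ℝ (Fin n))}
    (hQ : Q ∈ dyadicGrid τ) : volume Q ≠ ∞ := by
  obtain ⟨⟨k, z⟩, rfl⟩ := hQ
  simp only [volume_gridCell]
  exact ENNReal.pow_ne_top ENNReal.ofReal_ne_top

theorem measurableSet_of_mem_dyadicGrid {τ : Fin n → Bool} {Q : Set (EuclideanSpace ℝ (Fin n))}
    (hQ : Q ∈ dyadicGrid τ) : MeasurableSet Q := by
  obtain ⟨⟨k, z⟩, rfl⟩ := hQ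
  exact measurableSet_gridCell τ k z

open Classical in
/-- Positive powers of the volume sum like a geometric series over the cells of a grid that contain
a given point. -/
theorem sum_volume_rpow_le (τ : Fin n → Bool) (hn : n ≠ 0) (β : ℝ)
    {F : Finset (Set (EuclideanSpace ℝ (Fin n)))} (hF : (F : Set (Set _)) ⊆ dyadicGrid τ)
    {R : Set (EuclideanSpace ℝ (Fin n))} (hR : R ∈ F) (x : EuclideanSpace ℝ (Fin n)) :
    ∑ Q ∈ F with Q ⊆ R, Q.indicator (fun _ => volume Q ^ β) x ≤
      (1 - ENNReal.ofReal (2 ^ (-(n * β))))⁻¹ * volume R ^ β := by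
  have hn0 : (0 : ℝ) < n := by positivity
  have hlev : ∀ Q : Set (EuclideanSpace ℝ (Fin n)), ∃ k : ℤ, Q ∈ F → ∃ z, Q = gridCell τ k z := by
    intro Q
    by_cases hQ : Q ∈ F
    · obtain ⟨⟨k, z⟩, rfl⟩ := hF hQ
      exact ⟨k, fun _ => ⟨z, rfl⟩⟩
    · exact ⟨0, fun h => absurd h hQ⟩
  choose k hk using hlev
  have hvol : ∀ Q ∈ F, volume Q = ENNReal.ofReal ((2 : ℝ) ^ (-k Q)) ^ n := by
    intro Q hQ
    obtain ⟨z, hz⟩ := hk Q hQ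
    conv_lhs => rw [hz]
    exact volume_gridCell _ _ _
  set T := (F.filter (fun Q => Q ⊆ R)).filter (fun Q => x ∈ Q) with hT
  have hTF : ∀ Q ∈ T, Q ∈ F := fun Q hQ => (Finset.mem_filter.1 (Finset.mem_filter.1 hQ).1).1
  have hTR : ∀ Q ∈ T, Q ⊆ R := fun Q hQ => (Finset.mem_filter.1 (Finset.mem_filter.1 hQ).1).2
  have hTx : ∀ Q ∈ T, x ∈ Q := fun Q hQ => (Finset.mem_filter.1 hQ).2
  have hle : ∀ Q ∈ T, k R ≤ k Q := by
    intro Q hQ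
    have h1 : volume Q ≤ volume R := measure_mono (hTR Q hQ)
    rw [hvol Q (hTF Q hQ), hvol R hR] at h1
    have h2 := (ENNReal.pow_le_pow_left_iff hn).1 h1
    rw [ENNReal.ofReal_le_ofReal_iff (by positivity)] at h2
    have := (zpow_le_zpow_iff_right₀ (by norm_num : (1 : ℝ) < 2)).1 h2
    omega
  -- `x` lies in at most one cell of each scale
  have hinj : Set.InjOn (fun Q => (k Q - k R).toNat) (T : Set (Set _)) := by
    intro P hP Q hQ hPQ
    have h1 := hle P hP
    have h2 := hle Q hQ
    have h3 : k P = k Q := by simp only at hPQ; omega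
    obtain ⟨z, hz⟩ := hk P (hTF P hP)
    obtain ⟨w, hw⟩ := hk Q (hTF Q hQ)
    have hzx : x ∈ gridCell τ (k P) z := hz ▸ hTx P hP
    have hwx : x ∈ gridCell τ (k Q) w := hw ▸ hTx Q hQ
    have : z = w := by
      funext j
      rw [← hzx j, ← hwx j, h3]
    rw [hz, hw, h3, this]
  set r : ℝ≥0∞ := ENNReal.ofReal (2 ^ (-(n * β))) with hr
  have hterm : ∀ Q ∈ T, volume Q ^ β = r ^ (k Q - k R).toNat * volume R ^ β := by
    intro Q hQ
    rw [hvol Q (hTF Q hQ), hvol R hR]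
    simp only [← ENNReal.rpow_natCast, ← ENNReal.rpow_mul, hr]
    rw [ENNReal.ofReal_rpow_of_pos (by positivity), ENNReal.ofReal_rpow_of_pos (by positivity),
      ENNReal.ofReal_rpow_of_pos (by positivity), ← ENNReal.ofReal_mul (by positivity)]
    congr 1
    simp only [← Real.rpow_intCast, ← Real.rpow_mul (by norm_num : (0 : ℝ) ≤ 2)]
    rw [← Real.rpow_add (by norm_num)]
    congr 1
    have h3 : (((k Q - k R).toNat : ℕ) : ℝ) = (k Q : ℝ) - k R := by
      have : (((k Q - k R).toNat : ℤ)) = k Q - k R := Int.toNat_of_nonneg (by have := hle Q hQ; omega)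
      exact_mod_cast this
    rw [h3]; push_cast; ring
  calc ∑ Q ∈ F with Q ⊆ R, Q.indicator (fun _ => volume Q ^ β) x = ∑ Q ∈ T, volume Q ^ β := by
        simp only [Set.indicator_apply]
        rw [← Finset.sum_filter]
    _ = ∑ i ∈ T.image (fun Q => (k Q - k R).toNat), r ^ i * volume R ^ β := by
        rw [Finset.sum_image hinj]
        exact Finset.sum_congr rfl hterm
    _ ≤ ∑' i : ℕ, r ^ i * volume R ^ β := ENNReal.sum_le_tsum _
    _ = _ := by rw [ENNReal.tsum_mul_right, ENNReal.tsum_geometric]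

/-- The interval `(X - r, X + r]` of length at most one third contains no integer, or no translate
of an integer by one third in a given direction. -/
theorem floor_eq_or_floor_eq {X r c : ℝ} (hr : r ≤ 1 / 6) (hr0 : 0 ≤ r)
    (hc : c = 1 / 3 ∨ c = -1 / 3) :
    ⌊X - r⌋ = ⌊X + r⌋ ∨ ⌊X - r - c⌋ = ⌊X + r - c⌋ := by
  by_contra! h
  have h1 : ⌊X - r⌋ < ⌊X + r⌋ := lt_of_le_of_ne (Int.floor_le_floor (by linarith)) h.1
  have h2 : ⌊X - r - c⌋ < ⌊X + r - c⌋ := lt_of_le_of_ne (Int.floor_le_floor (by linarith)) h.2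
  have a1 : (⌊X + r⌋ : ℝ) ≤ X + r := Int.floor_le _
  have a2 : X - r < ⌊X + r⌋ := Int.floor_lt.1 h1
  have a3 : (⌊X + r - c⌋ : ℝ) ≤ X + r - c := Int.floor_le _
  have a4 : X - r - c < ⌊X + r - c⌋ := Int.floor_lt.1 h2
  have b1 : ((⌊X + r⌋ - ⌊X + r - c⌋ : ℤ) : ℝ) < 1 := by
    push_cast; rcases hc with rfl | rfl <;> linarith
  have b2 : (-1 : ℝ) < ((⌊X + r⌋ - ⌊X + r - c⌋ : ℤ) : ℝ) := by
    push_cast; rcases hc with rfl | rfl <;> linarith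
  have b3 : ⌊X + r⌋ - ⌊X + r - c⌋ = 0 := by
    have c1 : ⌊X + r⌋ - ⌊X + r - c⌋ < 1 := by exact_mod_cast b1
    have c2 : -1 < ⌊X + r⌋ - ⌊X + r - c⌋ := by exact_mod_cast b2
    omega
  have b4 : (⌊X + r⌋ : ℝ) = ⌊X + r - c⌋ := by exact_mod_cast sub_eq_zero.1 b3
  rcases hc with rfl | rfl <;> linarith

/-- The one-third trick: every point has, in one of the grids, a cell of prescribed side length
that contains a neighbourhood of the point of comparable size. -/
theorem exists_gridCell (x : EuclideanSpace ℝ (Fin n)) {D : ℝ} {k : ℤ} (hD : 0 ≤ D)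
    (hk : 6 * D ≤ 2 ^ (-k)) :
    ∃ τ : Fin n → Bool, ∃ Q ∈ dyadicGrid τ, volume Q = ENNReal.ofReal ((2 : ℝ) ^ (-k)) ^ n ∧
      ∀ y : EuclideanSpace ℝ (Fin n), ‖x - y‖ ≤ D → y ∈ Q := by
  have h2 : (0 : ℝ) < 2 ^ k := by positivity
  set r := (2 : ℝ) ^ k * D with hr
  have hr6 : r ≤ 1 / 6 := by
    have h := mul_le_mul_of_nonneg_left hk h2.le
    rw [← zpow_add₀ (by norm_num), add_neg_cancel, zpow_zero] at h
    linarith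
  have hr0 : 0 ≤ r := by positivity
  have hτ : ∀ j : Fin n, ∃ b : Bool, ∀ τ : Fin n → Bool, τ j = b →
      ⌊2 ^ k * x j - r - gridOffset τ k j⌋ = ⌊2 ^ k * x j + r - gridOffset τ k j⌋ := by
    intro j
    have hc : (-1 : ℝ) ^ k / 3 = 1 / 3 ∨ (-1 : ℝ) ^ k / 3 = -1 / 3 := by
      rcases Int.even_or_odd k with h | h
      · left; rw [h.neg_one_zpow]
      · right; rw [h.neg_one_zpow]
    rcases floor_eq_or_floor_eq (X := 2 ^ k * x j) hr6 hr0 hc with h | h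
    · exact ⟨false, fun τ hτ => by simpa [gridOffset, hτ] using h⟩
    · exact ⟨true, fun τ hτ => by simpa [gridOffset, hτ] using h⟩
  choose τ hτ using hτ
  refine ⟨τ, gridCell τ k (fun j => ⌊2 ^ k * x j - r - gridOffset τ k j⌋), ⟨⟨k, _⟩, rfl⟩,
    volume_gridCell _ _ _, ?_⟩
  intro y hy j
  have hyj : |x j - y j| ≤ D := by
    refine le_trans ?_ hy
    have := PiLp.norm_apply_le (x - y) j
    simpa [Real.norm_eq_abs] using this
  rw [abs_le] at hyj
  have h3 := hτ j τ rfl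
  have h4 : 2 ^ k * y j ≤ 2 ^ k * x j + r := by rw [hr, ← mul_add]; gcongr; linarith
  have h5 : 2 ^ k * x j - r ≤ 2 ^ k * y j := by rw [hr, ← mul_sub]; gcongr; linarith
  change _ = ⌊2 ^ k * x j - r - gridOffset τ k j⌋
  refine le_antisymm ?_ ?_
  · rw [h3]; exact Int.floor_le_floor (by linarith)
  · exact Int.floor_le_floor (by linarith)

end Dyadic

/-! ### Domination of the fractional integral by dyadic operators -/

section Domination

variable {n : ℕ}

/-- The kernel of the fractional integral is dominated by sums over the dyadic grids: a single cell
whose side length is comparable to the sum of the distances contributes enough. -/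
theorem kernel_le_sum_grid {m : ℕ} (hm : m ≠ 0) {α : ℝ} (hα : 0 < α) (hαn : α < n)
    (x : EuclideanSpace ℝ (Fin n)) (y : Fin m → EuclideanSpace ℝ (Fin n)) :
    ENNReal.ofReal (((∑ i, ‖x - y i‖) ^ ((m : ℝ) * n - α))⁻¹) ≤
      ENNReal.ofReal (12 ^ ((m : ℝ) * n - α)) * ∑ τ : Fin n → Bool, ∑' Q : dyadicGrid τ,
        (Q : Set _).indicator (fun _ => volume (Q : Set (EuclideanSpace ℝ (Fin n))) ^
          (-((m : ℝ) - α / n)) *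
          ∏ i, (Q : Set (EuclideanSpace ℝ (Fin n))).indicator (fun _ => (1 : ℝ≥0∞)) (y i)) x := by
  have hn0 : (0 : ℝ) < n := hα.trans hαn
  have hm1 : (1 : ℝ) ≤ m := by exact_mod_cast Nat.one_le_iff_ne_zero.2 hm
  have he : 0 < (m : ℝ) * n - α := by nlinarith
  set D := ∑ i, ‖x - y i‖ with hD
  have hD0 : 0 ≤ D := Finset.sum_nonneg fun i _ => norm_nonneg _
  rcases hD0.eq_or_lt with h0 | hpos
  · -- on the diagonal the kernel has the junk value `0⁻¹ = 0`
    rw [← h0, Real.zero_rpow he.ne']; simp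
  obtain ⟨j, hj1, hj2⟩ := exists_mem_Ioc_zpow (show 0 < 6 * D by positivity)
    (one_lt_two : (1 : ℝ) < 2)
  obtain ⟨τ, Q, hQ, hvol, hmem⟩ := exists_gridCell x (k := -(j + 1)) hD0 (by rw [neg_neg]; exact hj2)
  rw [neg_neg] at hvol
  have hyQ : ∀ i, y i ∈ Q := fun i => hmem _
    (Finset.single_le_sum (f := fun i => ‖x - y i‖) (fun i _ => norm_nonneg _) (Finset.mem_univ i))
  have hxQ : x ∈ Q := hmem x (by simpa using hD0)
  have h12 : (2 : ℝ) ^ (j + 1) ≤ 12 * D := by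
    rw [zpow_add₀ (by norm_num), zpow_one]; linarith
  have h2 : (0 : ℝ) < 2 ^ (j + 1) := by positivity
  calc ENNReal.ofReal ((D ^ ((m : ℝ) * n - α))⁻¹)
      ≤ ENNReal.ofReal (12 ^ ((m : ℝ) * n - α)) * volume Q ^ (-((m : ℝ) - α / n)) := by
        rw [hvol, ← ENNReal.rpow_natCast, ← ENNReal.rpow_mul, ENNReal.ofReal_rpow_of_pos h2,
          ← ENNReal.ofReal_mul (by positivity)]
        refine ENNReal.ofReal_le_ofReal ?_
        rw [show (n : ℝ) * -((m : ℝ) - α / n) = -((m : ℝ) * n - α) by field_simp, Real.rpow_neg h2.le,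
          ← div_eq_mul_inv, inv_eq_one_div, div_le_div_iff₀ (by positivity) (by positivity), one_mul,
          ← Real.mul_rpow (by norm_num) hpos.le]
        exact Real.rpow_le_rpow h2.le h12 he.le
    _ ≤ _ := by
        gcongr
        refine le_trans ?_ (Finset.single_le_sum (f := fun τ : Fin n → Bool => ∑' Q : dyadicGrid τ,
          (Q : Set _).indicator (fun _ => volume (Q : Set (EuclideanSpace ℝ (Fin n))) ^
          (-((m : ℝ) - α / n)) *
          ∏ i, (Q : Set (EuclideanSpace ℝ (Fin n))).indicator (fun _ => (1 : ℝ≥0∞)) (y i)) x)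
          (fun _ _ => zero_le) (Finset.mem_univ τ))
        refine le_trans ?_ (ENNReal.le_tsum (⟨Q, hQ⟩ : dyadicGrid τ))
        simp [Set.indicator_of_mem hxQ, Set.indicator_of_mem (hyQ _)]

/-- The multilinear fractional integral of non-negative functions is dominated by dyadic positive
operators. -/
theorem lintegral_kernel_le {m : ℕ} (hm : m ≠ 0) {α : ℝ} (hα : 0 < α) (hαn : α < n)
    (f : Fin m → EuclideanSpace ℝ (Fin n) → ℝ≥0∞) (hf : ∀ i, AEMeasurable (f i) volume)
    (x : EuclideanSpace ℝ (Fin n)) :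
    ∫⁻ y : Fin m → EuclideanSpace ℝ (Fin n),
        ENNReal.ofReal (((∑ i, ‖x - y i‖) ^ ((m : ℝ) * n - α))⁻¹) * ∏ i, f i (y i) ≤
      ENNReal.ofReal (12 ^ ((m : ℝ) * n - α)) * ∑ τ : Fin n → Bool, ∑' Q : dyadicGrid τ,
        (Q : Set _).indicator (fun _ => volume (Q : Set (EuclideanSpace ℝ (Fin n))) ^
          (-((m : ℝ) - α / n)) * ∏ i, ∫⁻ z in (Q : Set _), f i z) x := by
  set C := ENNReal.ofReal (12 ^ ((m : ℝ) * n - α))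
  have hQm : ∀ (τ : Fin n → Bool) (Q : dyadicGrid τ),
      MeasurableSet (Q : Set (EuclideanSpace ℝ (Fin n))) := fun τ Q =>
    measurableSet_of_mem_dyadicGrid Q.2
  have hmeas : ∀ (τ : Fin n → Bool) (Q : dyadicGrid τ), AEMeasurable
      (fun y : Fin m → EuclideanSpace ℝ (Fin n) => ∏ i, (Q : Set _).indicator (f i) (y i))
      volume := by
    intro τ Q
    refine Finset.aemeasurable_fun_prod _ fun i _ => ?_
    exact ((hf i).indicator (hQm τ Q)).comp_quasiMeasurePreserving
      (Measure.quasiMeasurePreserving_eval (fun _ => volume) i)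
  have : ∀ τ : Fin n → Bool, Countable (dyadicGrid τ) := fun τ => (countable_dyadicGrid τ).to_subtype
  calc ∫⁻ y : Fin m → EuclideanSpace ℝ (Fin n),
        ENNReal.ofReal (((∑ i, ‖x - y i‖) ^ ((m : ℝ) * n - α))⁻¹) * ∏ i, f i (y i)
      ≤ ∫⁻ y : Fin m → EuclideanSpace ℝ (Fin n), C * ∑ τ : Fin n → Bool, ∑' Q : dyadicGrid τ,
          (Q : Set _).indicator (fun _ => volume (Q : Set (EuclideanSpace ℝ (Fin n))) ^
            (-((m : ℝ) - α / n))) x * ∏ i, (Q : Set _).indicator (f i) (y i) := by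
        refine lintegral_mono fun y => ?_
        refine (mul_le_mul_left (kernel_le_sum_grid hm hα hαn x y) _).trans (le_of_eq ?_)
        rw [mul_assoc, Finset.sum_mul]
        congr 1
        refine Finset.sum_congr rfl fun τ _ => ?_
        rw [← ENNReal.tsum_mul_right]
        refine tsum_congr fun Q => ?_
        by_cases hx : x ∈ (Q : Set _)
        · simp only [Set.indicator_of_mem hx]
          rw [mul_assoc, ← Finset.prod_mul_distrib]
          congr 1
          refine Finset.prod_congr rfl fun i _ => ?_
          by_cases hy : y i ∈ (Q : Set _)
          · simp [Set.indicator_of_mem hy]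
          · simp [Set.indicator_of_notMem hy]
        · simp [Set.indicator_of_notMem hx]
    _ = C * ∑ τ : Fin n → Bool, ∑' Q : dyadicGrid τ,
          (Q : Set _).indicator (fun _ => volume (Q : Set (EuclideanSpace ℝ (Fin n))) ^
            (-((m : ℝ) - α / n))) x * ∫⁻ y : Fin m → EuclideanSpace ℝ (Fin n),
              ∏ i, (Q : Set _).indicator (f i) (y i) := by
        rw [lintegral_const_mul'' _ (Finset.aemeasurable_fun_sum _ fun τ _ =>
          AEMeasurable.tsum fun Q => (hmeas τ Q).const_mul _),
          lintegral_finsetSum' _ fun τ _ => AEMeasurable.tsum fun Q => (hmeas τ Q).const_mul _]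
        congr 1
        refine Finset.sum_congr rfl fun τ _ => ?_
        rw [lintegral_tsum fun Q => (hmeas τ Q).const_mul _]
        exact tsum_congr fun Q => lintegral_const_mul'' _ (hmeas τ Q)
    _ = _ := by
        congr 1
        refine Finset.sum_congr rfl fun τ _ => tsum_congr fun Q => ?_
        have hprod : ∫⁻ y : Fin m → EuclideanSpace ℝ (Fin n),
            ∏ i, (Q : Set _).indicator (f i) (y i) = ∏ i, ∫⁻ z in (Q : Set _), f i z := by
          rw [volume_pi, lintegral_fin_prod_eq_prod volume (fun i => (Q : Set _).indicator (f i))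
            fun i => (hf i).indicator (hQm τ Q)]
          exact Finset.prod_congr rfl fun i _ => lintegral_indicator (hQm τ Q) _
        rw [hprod]
        by_cases hx : x ∈ (Q : Set _)
        · simp [Set.indicator_of_mem hx]
        · simp [Set.indicator_of_notMem hx]

end Domination

section Operator

open Classical in
/-- The weighted bound for a positive operator over a finite laminar family, obtained from the
sparse case. -/
theorem familyOperator_le {X : Type*} [MeasurableSpace X] {ι : Type*} [Fintype ι] [Nonempty ι]
    {t : Option ι → ℝ} {s θ : ℝ}
    (ht : ∀ i, 1 < t (some i)) (hq : 0 < t none) (hs : ∑ k, 1 / t k = s)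
    (hsθ : s + 1 - θ = Fintype.card ι) (hθ : θ ≤ 1) (k₀ : Option ι)
    (hT : 1 < t k₀ * θ) (hmax : ∀ k, k ≠ k₀ → t k ≤ t k₀ * θ) {K : ℝ≥0∞} (hK : K ≠ ∞) :
    ∃ C : ℝ≥0, ∀ (lam : Measure X) (F : Finset (Set X)), IsLaminar (F : Set (Set X)) →
      (∀ Q ∈ F, MeasurableSet Q) → (∀ Q ∈ F, lam Q ≠ 0) → (∀ Q ∈ F, lam Q ≠ ∞) →
      (∀ R ∈ F, ∀ x ∈ R, ∑ Q ∈ F with Q ⊆ R, Q.indicator (fun _ => lam Q ^ (1 - θ)) x ≤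
        K * lam R ^ (1 - θ)) →
      ∀ (ν : Option ι → Measure X) (H : ℝ≥0∞), (∀ k, ∀ Q ∈ F, ν k Q ≠ ∞) →
      (∀ Q ∈ F, ∏ k, ν k Q ^ (1 / t k) ≤ H * lam Q ^ s) →
      (∀ W, MeasurableSet W → lam W ^ s ≤ ∏ k, ν k W ^ (1 / t k)) →
      ∀ f g : ι → X → ℝ≥0∞, (∀ i, AEMeasurable (g i) (ν (some i))) →
      (∀ i, ∫⁻ x, g i x ^ (t (some i)).conjExponent ∂(ν (some i)) ≠ ∞) →
      (∀ i, ∀ Q ∈ F, ∫⁻ x in Q, f i x ∂lam = ∫⁻ x in Q, g i x ∂(ν (some i))) →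
      ∫⁻ x, familyOperator lam s F (fun _ => lam) f x ^ t none ∂(ν none) ≤
        (C * H ^ (t k₀ * θ) * ∏ i, (∫⁻ x, g i x ^ (t (some i)).conjExponent ∂(ν (some i))) ^
          (1 / (t (some i)).conjExponent)) ^ t none := by
  obtain ⟨C, hC⟩ := sparse_operator_le (X := X) ht hq hs hsθ hθ k₀ hT hmax
  refine ⟨(2 ^ Fintype.card ι * K).toNNReal * C, ?_⟩
  intro lam F hF hm h0 h1 hgeo ν H hνt hH hW f g hg hgfin hfg
  have hKt : 2 ^ Fintype.card ι * K ≠ ∞ :=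
    ENNReal.mul_ne_top (ENNReal.pow_ne_top (by norm_num)) hK
  have hfint : ∀ Q ∈ F, ∀ i, ∫⁻ x in Q, f i x ∂lam ≠ ∞ := by
    intro Q hQ i
    rw [hfg i Q hQ]
    have h1 := one_lt_conjExponent (ht i)
    refine ne_top_of_le_ne_top ?_ (setLIntegral_le_of_lintegral_rpow (ν (some i)) h1 (hg i) Q)
    refine ENNReal.mul_ne_top (ENNReal.rpow_ne_top_of_nonneg (by positivity) (hgfin i))
      (ENNReal.rpow_ne_top_of_nonneg ?_ (hνt _ Q hQ))
    rw [sub_nonneg, div_le_one (by linarith)]; exact h1.le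
  -- the coefficients in terms of averages
  have hcoef : ∀ Q ∈ F, lam Q ^ (-s) * ∏ i, ∫⁻ y in Q, f i y ∂lam =
      lam Q ^ (1 - θ) * ∏ i, ⨍⁻ y in Q, f i y ∂lam := by
    intro Q hQ
    rw [Finset.prod_congr rfl fun i _ => setLIntegral_eq_mul_setLAverage lam (f i) (h0 Q hQ)
      (h1 Q hQ), Finset.prod_mul_distrib, Finset.prod_const, Finset.card_univ, ← mul_assoc,
      ← ENNReal.rpow_natCast, ← ENNReal.rpow_add _ _ (h0 Q hQ) (h1 Q hQ), ← hsθ]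
    congr 2
    ring
  -- members with a vanishing product of averages are dropped, since levels need positive values
  set F' := F.filter (fun Q => ∏ i, ⨍⁻ y in Q, f i y ∂lam ≠ 0) with hF'
  have hF'F : F' ⊆ F := Finset.filter_subset _ _
  obtain ⟨S, hSF, E, hSE, hdom⟩ := exists_isSparse lam (hF.mono hF'F)
    (fun Q hQ => hm Q (hF'F hQ)) (fun Q hQ => h0 Q (hF'F hQ)) (fun Q hQ => h1 Q (hF'F hQ))
    (fun Q hQ => hfint Q (hF'F hQ)) (fun Q hQ => (Finset.mem_filter.1 hQ).2)
    (c := fun Q => lam Q ^ (1 - θ)) (K := K) (by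
      intro R hR x hx
      refine le_trans (Finset.sum_le_sum_of_subset ?_) (hgeo R (hF'F hR) x hx)
      exact Finset.filter_subset_filter _ hF'F)
  have hSF' : S ⊆ F := hSF.trans hF'F
  have hpt : ∀ x, familyOperator lam s F (fun _ => lam) f x ≤
      2 ^ Fintype.card ι * K * familyOperator lam s S (fun i => ν (some i)) g x := by
    intro x
    have e1 : familyOperator lam s F (fun _ => lam) f x =
        ∑ Q ∈ F', Q.indicator (fun _ => lam Q ^ (1 - θ) * ∏ i, ⨍⁻ y in Q, f i y ∂lam) x := by
      rw [hF', Finset.sum_filter]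
      refine Finset.sum_congr rfl fun Q hQ => ?_
      rw [hcoef Q hQ]
      split_ifs with h
      · rfl
      · rw [not_not] at h
        simp [h]
    have e2 : familyOperator lam s S (fun i => ν (some i)) g x =
        ∑ Q ∈ S, Q.indicator (fun _ => lam Q ^ (1 - θ) * ∏ i, ⨍⁻ y in Q, f i y ∂lam) x := by
      refine Finset.sum_congr rfl fun Q hQ => ?_
      rw [← hcoef Q (hSF' hQ), Finset.prod_congr rfl fun i _ => (hfg i Q (hSF' hQ)).symm]
    rw [e1, e2]
    exact hdom x
  have hop := hC lam S E hSE ν H (fun k Q hQ => hνt k Q (hSF' hQ)) (fun Q hQ => hH Q (hSF' hQ)) hW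
    g hg hgfin
  have hmS : Measurable (familyOperator lam s S (fun i => ν (some i)) g) :=
    Finset.measurable_sum _ fun Q hQ => measurable_const.indicator (hm Q (hSF' hQ))
  calc ∫⁻ x, familyOperator lam s F (fun _ => lam) f x ^ t none ∂(ν none)
      ≤ ∫⁻ x, (2 ^ Fintype.card ι * K) ^ t none *
          familyOperator lam s S (fun i => ν (some i)) g x ^ t none ∂(ν none) := by
        refine lintegral_mono fun x => ?_
        rw [← ENNReal.mul_rpow_of_nonneg _ _ hq.le]
        exact ENNReal.rpow_le_rpow (hpt x) hq.le
    _ = (2 ^ Fintype.card ι * K) ^ t none *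
          ∫⁻ x, familyOperator lam s S (fun i => ν (some i)) g x ^ t none ∂(ν none) :=
        lintegral_const_mul _ (hmS.pow_const _)
    _ ≤ (2 ^ Fintype.card ι * K) ^ t none * _ := mul_le_mul_right hop _
    _ = _ := by
        rw [← ENNReal.mul_rpow_of_nonneg _ _ hq.le, ENNReal.coe_mul, ENNReal.coe_toNNReal hKt]
        congr 1
        simp only [mul_assoc]

end Operator

/-! ### Exponents and multiple weights -/

section Exponents

/-- The exponents `q, p₁', …, p_m'` of the measures `u_w, σ₁, …, σ_m`. -/
noncomputable def weightExponent {m : ℕ} (p : Fin m → ℝ) (q : ℝ) (k : Option (Fin m)) : ℝ :=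
  k.elim q fun i => (p i).conjExponent

variable {m n : ℕ} {α q : ℝ} {p : Fin m → ℝ}

theorem weightExponent_pos (hq : 0 < q) (hp : ∀ i, 1 < p i) (k : Option (Fin m)) :
    0 < weightExponent p q k := by
  rcases k with _ | i
  · exact hq
  · exact zero_lt_one.trans (one_lt_conjExponent (hp i))

theorem sum_one_div_weightExponent (hp : ∀ i, 1 < p i) (hom : ∑ i, 1 / p i = 1 / q + α / n) :
    ∑ k, 1 / weightExponent p q k = m - α / n := by
  rw [Fintype.sum_option]
  simp only [weightExponent, Option.elim, one_div_conjExponent (hp _), Finset.sum_sub_distrib, hom]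
  simp; ring

theorem ne_zero_of_sum_eq (hα : 0 < α) (hαn : α < n) (hq : 0 < q)
    (hom : ∑ i, 1 / p i = 1 / q + α / n) : m ≠ 0 := by
  rintro rfl
  have : 0 < 1 / q + α / n := add_pos (by positivity) (div_pos hα (hα.trans hαn))
  simp at hom
  simp at this
  linarith

theorem conjExponent_conjExponent {t : ℝ} (ht : 1 < t) : t.conjExponent.conjExponent = t :=
  (Real.HolderConjugate.conjExponent ht).symm.conjugate_eq.symm

/-- The condition on the exponents singles out an index whose exponent dominates all the others,
even after multiplication by `1 - α / n`. -/
theorem exists_distinguished (hα : 0 < α) (hαn : α < n) (hq : 0 < q) (hp : ∀ i, 1 < p i)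
    (hom : ∑ i, 1 / p i = 1 / q + α / n)
    (hmin : min ((⨆ i, (p i).conjExponent) / q)
        (⨅ j, (⨆ i, if i = j then q else (p i).conjExponent) / (p j).conjExponent)
      ≤ 1 - α / n) :
    ∃ k₀ : Option (Fin m), 1 < weightExponent p q k₀ * (1 - α / n) ∧
      (∀ k, k ≠ k₀ → weightExponent p q k ≤ weightExponent p q k₀ * (1 - α / n)) ∧
      weightExponent p q k₀ * (1 - α / n) / q ≤ sharpExponent n α p q := by
  have hm := ne_zero_of_sum_eq hα hαn hq hom
  have hn0 : (0 : ℝ) < n := hα.trans hαn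
  have hne : Nonempty (Fin m) := ⟨⟨0, Nat.pos_of_ne_zero hm⟩⟩
  have hθ0 : 0 < 1 - α / n := by rw [sub_pos, div_lt_one hn0]; exact hαn
  have hαn0 : 0 < α / n := div_pos hα hn0
  set θ := 1 - α / n with hθ
  have hp' : ∀ i, 1 < (p i).conjExponent := fun i => one_lt_conjExponent (hp i)
  have hbdd : ∀ g : Fin m → ℝ, BddAbove (Set.range g) := fun g => (Set.finite_range g).bddAbove
  -- the first term of the minimum singles out `q`, the second one the minimizing `pⱼ'`
  rcases min_le_iff.1 hmin with h | h
  · have hle : ∀ i, (p i).conjExponent ≤ q * θ := by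
      intro i
      rw [div_le_iff₀ hq] at h
      calc (p i).conjExponent ≤ ⨆ i, (p i).conjExponent :=
            le_ciSup (hbdd fun i => (p i).conjExponent) i
        _ ≤ q * θ := by linarith
    refine ⟨none, ?_, ?_, ?_⟩
    · exact (hp' hne.some).trans_le (hle _)
    · rintro (_ | i) hk
      · exact absurd rfl hk
      · exact hle i
    · change q * θ / q ≤ θ * ⨆ i, max 1 ((p i).conjExponent / q)
      rw [mul_div_cancel_left₀ _ hq.ne']
      have : 1 ≤ ⨆ i, max 1 ((p i).conjExponent / q) :=
        (le_max_left _ _).trans (le_ciSup (hbdd fun i => max 1 ((p i).conjExponent / q)) hne.some)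
      nlinarith
  · obtain ⟨j, hj⟩ := exists_eq_ciInf_of_finite
      (f := fun j => (⨆ i, if i = j then q else (p i).conjExponent) / (p j).conjExponent)
    rw [← hj] at h
    have hj0 : 0 < (p j).conjExponent := zero_lt_one.trans (hp' j)
    rw [div_le_iff₀ hj0] at h
    have hle : ∀ i, (if i = j then q else (p i).conjExponent) ≤ (p j).conjExponent * θ := by
      intro i
      calc _ ≤ ⨆ i, if i = j then q else (p i).conjExponent :=
            le_ciSup (hbdd fun i => if i = j then q else (p i).conjExponent) i
        _ ≤ _ := by linarith
    have hqle : q ≤ (p j).conjExponent * θ := by simpa using hle j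
    refine ⟨some j, ?_, ?_, ?_⟩
    · change 1 < (p j).conjExponent * θ
      rcases lt_or_ge 1 q with h1 | h1
      · exact h1.trans_le hqle
      · -- for `q ≤ 1` the homogeneity relation forces `m ≥ 2`
        obtain ⟨i, hi⟩ : ∃ i, i ≠ j := by
          by_contra! hall
          have hsum : ∑ i, 1 / p i = 1 / p j := by
            refine Finset.sum_eq_single j (fun i _ hi => absurd (hall i) hi) ?_
            intro h; exact absurd (Finset.mem_univ j) h
          have h2 : 1 / p j < 1 := by
            rw [div_lt_one (by linarith [hp j])]; exact hp j
          have h3 : 1 ≤ 1 / q := by rw [le_div_iff₀ hq]; linarith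
          rw [hsum] at hom
          linarith
        have := hle i
        rw [if_neg hi] at this
        exact (hp' i).trans_le this
    · rintro (_ | i) hk
      · exact hqle
      · have hij : i ≠ j := fun h => hk (by rw [h])
        have := hle i
        rwa [if_neg hij] at this
    · change (p j).conjExponent * θ / q ≤ θ * ⨆ i, max 1 ((p i).conjExponent / q)
      have : (p j).conjExponent / q ≤ ⨆ i, max 1 ((p i).conjExponent / q) :=
        (le_max_right _ _).trans (le_ciSup (hbdd fun i => max 1 ((p i).conjExponent / q)) j)
      calc (p j).conjExponent * θ / q = θ * ((p j).conjExponent / q) := by ring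
        _ ≤ _ := by gcongr

end Exponents

section Weights

variable {m n : ℕ} {q : ℝ} {p : Fin m → ℝ} {w : Fin m → EuclideanSpace ℝ (Fin n) → ℝ}

theorem IsWeight.aemeasurable {w : EuclideanSpace ℝ (Fin n) → ℝ} (hw : IsWeight w) :
    AEMeasurable w volume := hw.locallyIntegrable.aestronglyMeasurable.aemeasurable

theorem aemeasurable_productWeight (hw : ∀ i, IsWeight (w i)) :
    AEMeasurable (productWeight q w) volume :=
  (Finset.aemeasurable_fun_prod _ fun i _ => (hw i).aemeasurable.ennreal_ofReal).pow_const q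

theorem aemeasurable_dualWeight {p : ℝ} {w : EuclideanSpace ℝ (Fin n) → ℝ} (hw : IsWeight w) :
    AEMeasurable (dualWeight p w) volume :=
  hw.aemeasurable.ennreal_ofReal.pow_const _

/-- The measure `u_w dx` for the index `none` and the measures `σᵢ dx` for the indices `some i`. -/
noncomputable def weightMeasure (p : Fin m → ℝ) (q : ℝ)
    (w : Fin m → EuclideanSpace ℝ (Fin n) → ℝ) (k : Option (Fin m)) :
    Measure (EuclideanSpace ℝ (Fin n)) :=
  volume.withDensity (k.elim (productWeight q w) fun i => dualWeight (p i) (w i))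

theorem aemeasurable_weightDensity (hw : ∀ i, IsWeight (w i)) (k : Option (Fin m)) :
    AEMeasurable (k.elim (productWeight q w) fun i => dualWeight (p i) (w i)) volume := by
  rcases k with _ | i
  · exact aemeasurable_productWeight hw
  · exact aemeasurable_dualWeight (hw i)

theorem dualWeight_ne_zero {p : ℝ} (w : EuclideanSpace ℝ (Fin n) → ℝ) (hp : 1 < p)
    (x : EuclideanSpace ℝ (Fin n)) : dualWeight p w x ≠ 0 := by
  have := one_lt_conjExponent hp
  unfold dualWeight
  rw [ne_eq, ENNReal.rpow_eq_zero_iff]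
  push Not
  exact ⟨fun _ => by linarith, fun h => absurd h ENNReal.ofReal_ne_top⟩

theorem ENNReal.rpow_sum_of_ne {ι : Type*} {x : ℝ≥0∞} (h0 : x ≠ 0) (ht : x ≠ ∞) (s : Finset ι)
    (f : ι → ℝ) : x ^ ∑ i ∈ s, f i = ∏ i ∈ s, x ^ f i := by
  classical
  induction s using Finset.induction_on with
  | empty => simp
  | insert i s hi ih => rw [Finset.sum_insert hi, Finset.prod_insert hi, ENNReal.rpow_add _ _ h0 ht, ih]

theorem setLAverage_mul_prod_le (p : Fin m → ℝ) (q : ℝ)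
    (w : Fin m → EuclideanSpace ℝ (Fin n) → ℝ) (a : EuclideanSpace ℝ (Fin n)) {l : ℝ}
    (hl : 0 < l) :
    (⨍⁻ x in cube a l, productWeight q w x ∂volume) *
      ∏ i, (⨍⁻ x in cube a l, dualWeight (p i) (w i) x ∂volume) ^ (q / (p i).conjExponent) ≤
      multiWeightConst p q w :=
  le_iSup_of_le a (le_iSup_of_le l (le_iSup_of_le hl le_rfl))

theorem volume_cube_ne_zero (a : EuclideanSpace ℝ (Fin n)) {l : ℝ} (hl : 0 < l) :
    volume (cube a l) ≠ 0 := by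
  rw [volume_cube]; exact pow_ne_zero _ (by simpa using hl)

theorem volume_cube_ne_top (a : EuclideanSpace ℝ (Fin n)) (l : ℝ) : volume (cube a l) ≠ ∞ := by
  rw [volume_cube]; exact ENNReal.pow_ne_top ENNReal.ofReal_ne_top

theorem setLIntegral_dualWeight_ne_zero {p : ℝ} (hp : 1 < p) {w : EuclideanSpace ℝ (Fin n) → ℝ}
    (hw : IsWeight w) {Q : Set (EuclideanSpace ℝ (Fin n))} (hQ : volume Q ≠ 0) :
    ∫⁻ x in Q, dualWeight p w x ≠ 0 := by
  rw [ne_eq, lintegral_eq_zero_iff' (aemeasurable_dualWeight hw).restrict]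
  intro h
  have : ∀ᵐ x ∂(volume.restrict Q), False := by
    filter_upwards [h] with x hx
    exact dualWeight_ne_zero w hp x hx
  rw [Filter.eventually_false_iff_eq_bot, ae_eq_bot, Measure.restrict_eq_zero] at this
  exact hQ this

theorem weightMeasure_apply (k : Option (Fin m)) {Q : Set (EuclideanSpace ℝ (Fin n))}
    (hQ : MeasurableSet Q) : weightMeasure p q w k Q =
      ∫⁻ x in Q, (k.elim (productWeight q w) fun i => dualWeight (p i) (w i)) x :=
  withDensity_apply _ hQ

/-- If the weight constant is finite and `u_w` charges a cube, the measures `u_w dx` and `σᵢ dx`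
are finite on that cube. -/
theorem weightMeasure_cube_ne_top (hw : IsMultiWeight p q w) (hq : 0 < q) (hp : ∀ i, 1 < p i)
    (a : EuclideanSpace ℝ (Fin n)) {l : ℝ} (hl : 0 < l)
    (hu : ∫⁻ x in cube a l, productWeight q w x ≠ 0) (k : Option (Fin m)) :
    weightMeasure p q w k (cube a l) ≠ ∞ := by
  have hV0 := volume_cube_ne_zero a hl
  have hVt := volume_cube_ne_top a l
  have hA := (setLAverage_mul_prod_le p q w a hl).trans_lt hw.2
  simp only [setLAverage_eq] at hA
  have hp0 : ∀ i, 0 < q / (p i).conjExponent := fun i =>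
    div_pos hq (zero_lt_one.trans (one_lt_conjExponent (hp i)))
  have hσ0 : ∀ i, ((∫⁻ x in cube a l, dualWeight (p i) (w i) x) / volume (cube a l)) ^
      (q / (p i).conjExponent) ≠ 0 := by
    intro i h
    rw [ENNReal.rpow_eq_zero_iff_of_pos (hp0 i), ENNReal.div_eq_zero_iff] at h
    rcases h with h | h
    · exact setLIntegral_dualWeight_ne_zero (hp i) (hw.1 i) hV0 h
    · exact hVt h
  have hu0 : (∫⁻ x in cube a l, productWeight q w x) / volume (cube a l) ≠ 0 := by
    rw [ne_eq, ENNReal.div_eq_zero_iff]; push Not; exact ⟨hu, hVt⟩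
  rw [weightMeasure_apply k (measurableSet_cube a l)]
  rcases k with _ | i
  · intro h
    change ∫⁻ x in cube a l, productWeight q w x = ∞ at h
    rw [h, ENNReal.top_div_of_ne_top hVt, ENNReal.top_mul] at hA
    · exact hA.ne rfl
    · exact Finset.prod_ne_zero_iff.2 fun i _ => hσ0 i
  · intro h
    change ∫⁻ x in cube a l, dualWeight (p i) (w i) x = ∞ at h
    rw [← Finset.mul_prod_erase _ _ (Finset.mem_univ i), h, ENNReal.top_div_of_ne_top hVt,
      ENNReal.top_rpow_of_pos (hp0 i), ENNReal.top_mul, ENNReal.mul_top hu0] at hA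
    · exact hA.ne rfl
    · exact Finset.prod_ne_zero_iff.2 fun i _ => hσ0 i

/-- A non-zero measure charges all sufficiently large centred cubes. -/
theorem exists_forall_measure_cube_ne_zero {μ : Measure (EuclideanSpace ℝ (Fin n))}
    (hμ : μ ≠ 0) : ∃ N : ℕ, ∀ M : ℕ, N ≤ M →
      μ (cube (WithLp.toLp 2 fun _ => -(M + 1 : ℝ)) (2 * (M + 1))) ≠ 0 := by
  have hmono : ∀ {N M : ℕ}, N ≤ M →
      cube (n := n) (WithLp.toLp 2 fun _ => -(N + 1 : ℝ)) (2 * (N + 1)) ⊆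
      cube (WithLp.toLp 2 fun _ => -(M + 1 : ℝ)) (2 * (M + 1)) := by
    intro N M hNM x hx k
    have h : (N : ℝ) ≤ M := by exact_mod_cast hNM
    have := hx k
    simp only at this ⊢
    constructor <;> linarith [this.1, this.2]
  have hU : (⋃ N : ℕ, cube (n := n) (WithLp.toLp 2 fun _ => -(N + 1 : ℝ)) (2 * (N + 1))) =
      Set.univ := by
    refine Set.eq_univ_of_forall fun x => ?_
    obtain ⟨N, hN⟩ := exists_nat_gt ‖x‖
    refine Set.mem_iUnion.2 ⟨N, fun k => ?_⟩
    have h1 := PiLp.norm_apply_le x k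
    rw [Real.norm_eq_abs] at h1
    have h2 := abs_le.1 (h1.trans hN.le)
    simp only
    constructor <;> linarith [h2.1, h2.2]
  by_contra! h
  refine hμ (Measure.measure_univ_eq_zero.1 ?_)
  rw [← hU, measure_iUnion_null_iff]
  intro N
  obtain ⟨M, hM, h0⟩ := h N
  exact measure_mono_null (hmono hM) h0

/-- Either `u_w` vanishes almost everywhere, or all the weights are positive almost everywhere. In
the first case the norm inequality is trivial. -/
theorem productMeasure_eq_zero_or (hw : IsMultiWeight p q w) (hq : 0 < q) (hp : ∀ i, 1 < p i) :
    productMeasure q w = 0 ∨ ∀ i, ∀ᵐ x, 0 < w i x := by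
  by_contra h
  rw [not_or, not_forall] at h
  obtain ⟨hu, i, hi⟩ := h
  have hZ : volume.restrict {x | ¬ 0 < w i x} ≠ 0 := by
    rw [ne_eq, Measure.restrict_eq_zero]
    exact fun h => hi (ae_iff.2 h)
  obtain ⟨N, hN⟩ := exists_forall_measure_cube_ne_zero hu
  obtain ⟨N', hN'⟩ := exists_forall_measure_cube_ne_zero hZ
  set M := max N N'
  have h1 := hN M (le_max_left _ _)
  have h2 := hN' M (le_max_right _ _)
  have hl : (0 : ℝ) < 2 * (M + 1) := by positivity
  -- a cube charged by `u_w dx` on which `w i` vanishes in a set of positive measure; there `σᵢ` is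
  -- infinite, which contradicts the finiteness of the weight constant
  set Q := cube (n := n) (WithLp.toLp 2 fun _ => -(M + 1 : ℝ)) (2 * (M + 1)) with hQ
  have hQm : MeasurableSet Q := measurableSet_cube _ _
  rw [productMeasure, withDensity_apply _ hQm] at h1
  rw [Measure.restrict_apply hQm] at h2
  have h3 := weightMeasure_cube_ne_top hw hq hp _ hl h1 (some i)
  rw [weightMeasure_apply _ (measurableSet_cube _ _)] at h3
  have h4 := ae_lt_top' (aemeasurable_dualWeight (p := p i) (hw.1 i)).restrict h3
  have h5 : ∀ᵐ x ∂volume.restrict Q, 0 < w i x := by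
    filter_upwards [h4] with x hx
    by_contra hx0
    have h6 := one_lt_conjExponent (hp i)
    change dualWeight (p i) (w i) x < ∞ at hx
    rw [dualWeight, ENNReal.ofReal_of_nonpos (not_lt.1 hx0),
      ENNReal.zero_rpow_of_neg (by linarith)] at hx
    exact lt_irrefl _ hx
  rw [ae_iff, Measure.restrict_apply' hQm] at h5
  exact h2 (by rwa [Set.inter_comm])

/-- The product of the densities with the exponents `1 / q`, `1 / pᵢ'` equals `1`. -/
theorem prod_weightDensity_rpow (hq : 0 < q) (hp : ∀ i, 1 < p i) {x : EuclideanSpace ℝ (Fin n)}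
    (hx : ∀ i, 0 < w i x) :
    ∏ k : Option (Fin m), (k.elim (productWeight q w) (fun i => dualWeight (p i) (w i)) x) ^
      (1 / weightExponent p q k) = 1 := by
  rw [Fintype.prod_option]
  simp only [Option.elim, weightExponent, productWeight, dualWeight, ← ENNReal.rpow_mul]
  rw [mul_one_div_cancel hq.ne', ENNReal.rpow_one, ← Finset.prod_mul_distrib]
  refine Finset.prod_eq_one fun i _ => ?_
  have := one_lt_conjExponent (hp i)
  rw [neg_mul, mul_one_div_cancel (by linarith), ENNReal.rpow_neg_one,
    ENNReal.mul_inv_cancel (by simpa using hx i) ENNReal.ofReal_ne_top]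

/-- Lebesgue measure is controlled by the weighted measures, by Hölder's inequality. -/
theorem volume_rpow_le_prod_weightMeasure (hw : ∀ i, IsWeight (w i)) (hq : 0 < q)
    (hp : ∀ i, 1 < p i) (hpos : ∀ i, ∀ᵐ x, 0 < w i x) {s : ℝ}
    (hs : ∑ k, 1 / weightExponent p q k = s) {W : Set (EuclideanSpace ℝ (Fin n))}
    (hW : MeasurableSet W) :
    volume W ^ s ≤ ∏ k, weightMeasure p q w k W ^ (1 / weightExponent p q k) := by
  have ht := weightExponent_pos hq hp
  have hs0 : 0 < s := by
    rw [← hs]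
    exact Finset.sum_pos (fun k _ => one_div_pos.2 (ht k)) ⟨none, Finset.mem_univ _⟩
  set ρ : Option (Fin m) → EuclideanSpace ℝ (Fin n) → ℝ≥0∞ := fun k =>
    k.elim (productWeight q w) (fun i => dualWeight (p i) (w i)) with hρ
  have h1 : volume W ≤ ∏ k, (weightMeasure p q w k W) ^ (1 / weightExponent p q k / s) := by
    calc volume W = ∫⁻ x in W, ∏ k, ρ k x ^ (1 / weightExponent p q k / s) := by
          rw [← setLIntegral_one]
          refine lintegral_congr_ae (ae_restrict_of_ae ?_)
          filter_upwards [ae_all_iff.2 hpos] with x hx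
          have := prod_weightDensity_rpow (p := p) hq hp hx
          simp only [div_eq_mul_inv _ s, ENNReal.rpow_mul]
          rw [ENNReal.prod_rpow_of_nonneg (by positivity), this, ENNReal.one_rpow]
      _ ≤ ∏ k, (∫⁻ x in W, ρ k x) ^ (1 / weightExponent p q k / s) := by
          refine ENNReal.lintegral_prod_norm_pow_le _
            (fun k _ => (aemeasurable_weightDensity hw k).restrict) ?_ ?_
          · rw [← Finset.sum_div, hs, div_self hs0.ne']
          · intro k _
            have := ht k
            positivity
      _ = _ := by
          refine Finset.prod_congr rfl fun k _ => ?_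
          rw [weightMeasure_apply k hW]
  calc volume W ^ s ≤ (∏ k, (weightMeasure p q w k W) ^ (1 / weightExponent p q k / s)) ^ s :=
        ENNReal.rpow_le_rpow h1 hs0.le
    _ = _ := by
        rw [← ENNReal.prod_rpow_of_nonneg hs0.le]
        refine Finset.prod_congr rfl fun k _ => ?_
        rw [← ENNReal.rpow_mul, div_mul_cancel₀ _ hs0.ne']

/-- The defining property of the weight constant, in terms of the weighted measures of a cube. -/
theorem prod_weightMeasure_cube_le (hq : 0 < q) (hp : ∀ i, 1 < p i) {s : ℝ}
    (hs : ∑ k, 1 / weightExponent p q k = s) (a : EuclideanSpace ℝ (Fin n)) {l : ℝ} (hl : 0 < l) :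
    ∏ k, weightMeasure p q w k (cube a l) ^ (1 / weightExponent p q k) ≤
      multiWeightConst p q w ^ (1 / q) * volume (cube a l) ^ s := by
  have ht := weightExponent_pos hq hp
  have hV0 := volume_cube_ne_zero a hl
  have hVt := volume_cube_ne_top a l
  have hVs : volume (cube a l) ^ s = ∏ k, volume (cube a l) ^ (1 / weightExponent p q k) := by
    rw [← hs]
    exact ENNReal.rpow_sum_of_ne hV0 hVt _ _
  have hA := ENNReal.rpow_le_rpow (setLAverage_mul_prod_le p q w a hl) (one_div_pos.2 hq).le
  rw [ENNReal.mul_rpow_of_nonneg _ _ (one_div_pos.2 hq).le,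
    ← ENNReal.prod_rpow_of_nonneg (one_div_pos.2 hq).le] at hA
  calc ∏ k, weightMeasure p q w k (cube a l) ^ (1 / weightExponent p q k)
      = (∏ k, (weightMeasure p q w k (cube a l) / volume (cube a l)) ^
          (1 / weightExponent p q k)) * volume (cube a l) ^ s := by
        rw [hVs, ← Finset.prod_mul_distrib]
        refine Finset.prod_congr rfl fun k _ => ?_
        rw [← ENNReal.mul_rpow_of_nonneg _ _ (one_div_pos.2 (ht k)).le,
          ENNReal.div_mul_cancel hV0 hVt]
    _ ≤ _ := by
        refine mul_le_mul_left ?_ _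
        refine le_trans (le_of_eq ?_) hA
        rw [Fintype.prod_option]
        simp only [weightMeasure_apply _ (measurableSet_cube a l), setLAverage_eq, Option.elim,
          weightExponent, ← ENNReal.rpow_mul]
        congr 1
        refine Finset.prod_congr rfl fun i _ => ?_
        congr 1
        field_simp

theorem one_le_multiWeightConst (hw : ∀ i, IsWeight (w i)) (hq : 0 < q)
    (hp : ∀ i, 1 < p i) (hpos : ∀ i, ∀ᵐ x, 0 < w i x) : 1 ≤ multiWeightConst p q w := by
  have h1 := volume_rpow_le_prod_weightMeasure (p := p) hw hq hp hpos rfl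
    (measurableSet_cube (0 : EuclideanSpace ℝ (Fin n)) 1)
  have h2 := prod_weightMeasure_cube_le (w := w) hq hp rfl (0 : EuclideanSpace ℝ (Fin n)) one_pos
  have h3 := h1.trans h2
  rw [volume_cube] at h3
  simp only [ENNReal.ofReal_one, one_pow, ENNReal.one_rpow, mul_one] at h3
  have h4 := ENNReal.rpow_le_rpow h3 hq.le
  rwa [ENNReal.one_rpow, ← ENNReal.rpow_mul, one_div_mul_cancel hq.ne', ENNReal.rpow_one] at h4

end Weights

/-! ### The norm inequality -/

theorem lintegral_tsum_rpow_le {X ι : Type*} [MeasurableSpace X] [Countable ι] (μ : Measure X)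
    {a : ι → X → ℝ≥0∞} (ha : ∀ i, Measurable (a i)) {q : ℝ} (hq : 0 < q) {B : ℝ≥0∞}
    (h : ∀ s : Finset ι, ∫⁻ x, (∑ i ∈ s, a i x) ^ q ∂μ ≤ B) :
    ∫⁻ x, (∑' i, a i x) ^ q ∂μ ≤ B := by
  have e : ∀ x, (∑' i, a i x) ^ q = ⨆ s : Finset ι, (∑ i ∈ s, a i x) ^ q := by
    intro x
    rw [ENNReal.tsum_eq_iSup_sum]
    exact (ENNReal.orderIsoRpow q hq).map_iSup _
  simp only [e]
  rw [lintegral_iSup_directed]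
  · exact iSup_le h
  · exact fun s => ((Finset.measurable_fun_sum s fun i _ => ha i).pow_const q).aemeasurable
  · refine Monotone.directed_le fun s t hst x => ?_
    exact ENNReal.rpow_le_rpow (Finset.sum_le_sum_of_subset hst) hq.le

theorem ENNReal.rpow_sum_le_card_rpow_mul_sum {ι : Type*} (s : Finset ι) (a : ι → ℝ≥0∞) {q : ℝ}
    (hq : 0 < q) : (∑ i ∈ s, a i) ^ q ≤ (s.card : ℝ≥0∞) ^ q * ∑ i ∈ s, a i ^ q := by
  rcases s.eq_empty_or_nonempty with rfl | hne
  · simp [hq]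
  obtain ⟨j, hj, hmax⟩ := s.exists_max_image a hne
  calc (∑ i ∈ s, a i) ^ q ≤ (s.card * a j) ^ q := by
        refine ENNReal.rpow_le_rpow ?_ hq.le
        rw [← nsmul_eq_mul]
        exact Finset.sum_le_card_nsmul s a _ hmax
    _ = (s.card : ℝ≥0∞) ^ q * a j ^ q := ENNReal.mul_rpow_of_nonneg _ _ hq.le
    _ ≤ _ := by
        gcongr
        exact Finset.single_le_sum (f := fun i => a i ^ q) (fun _ _ => zero_le) hj

section UpperBound

variable {n : ℕ}

/-- The norm inequality for the multilinear fractional integral of non-negative functions. -/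
theorem lintegral_fracKernel_le {m : ℕ} {α q : ℝ} {p : Fin m → ℝ}
    (hα : 0 < α) (hαn : α < n) (hq : 0 < q) (hp : ∀ i, 1 < p i)
    (hom : ∑ i, 1 / p i = 1 / q + α / n)
    (hmin : min ((⨆ i, (p i).conjExponent) / q)
        (⨅ j, (⨆ i, if i = j then q else (p i).conjExponent) / (p j).conjExponent)
      ≤ 1 - α / n) :
    ∃ C : ℝ≥0, ∀ w : Fin m → EuclideanSpace ℝ (Fin n) → ℝ, IsMultiWeight p q w →
      (∀ i, ∀ᵐ x, 0 < w i x) →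
      ∀ f : Fin m → EuclideanSpace ℝ (Fin n) → ℝ≥0∞, (∀ i, AEMeasurable (f i) volume) →
      (∀ i, ∫⁻ x, f i x ^ p i ∂(powMeasure (p i) (w i)) ≠ ∞) →
      ∫⁻ x, (∫⁻ y : Fin m → EuclideanSpace ℝ (Fin n),
        ENNReal.ofReal (((∑ i, ‖x - y i‖) ^ ((m : ℝ) * n - α))⁻¹) * ∏ i, f i (y i)) ^ q
          ∂(productMeasure q w) ≤
      (C * multiWeightConst p q w ^ sharpExponent n α p q *
        ∏ i, (∫⁻ x, f i x ^ p i ∂(powMeasure (p i) (w i))) ^ (1 / p i)) ^ q := by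
  classical
  obtain ⟨k₀, hT, hmax, hsharp⟩ := exists_distinguished hα hαn hq hp hom hmin
  have hm := ne_zero_of_sum_eq hα hαn hq hom
  have hn0 : (0 : ℝ) < n := hα.trans hαn
  have hn : n ≠ 0 := by rintro rfl; simp at hn0
  have hne : Nonempty (Fin m) := ⟨⟨0, Nat.pos_of_ne_zero hm⟩⟩
  have hβ : 0 < α / n := div_pos hα hn0
  have hs := sum_one_div_weightExponent hp hom
  set K : ℝ≥0∞ := (1 - ENNReal.ofReal (2 ^ (-(n * (α / n)))))⁻¹ with hKdef
  have hK : K ≠ ∞ := by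
    rw [hKdef, ENNReal.inv_ne_top, ne_eq, tsub_eq_zero_iff_le, not_le, ENNReal.ofReal_lt_one]
    exact Real.rpow_lt_one_of_one_lt_of_neg (by norm_num) (by
      have : 0 < n * (α / n) := by positivity
      linarith)
  obtain ⟨C, hC⟩ := familyOperator_le (X := EuclideanSpace ℝ (Fin n)) (t := weightExponent p q)
    (s := m - α / n) (θ := 1 - α / n) (fun i => one_lt_conjExponent (hp i)) hq hs
    (by rw [Fintype.card_fin]; ring) (by linarith) k₀ hT hmax hK
  set N : ℝ≥0 := ((Finset.univ : Finset (Fin n → Bool)).card : ℝ≥0) with hN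
  refine ⟨(12 ^ ((m : ℝ) * n - α) : ℝ).toNNReal * N * N ^ (1 / q) * C, ?_⟩
  intro w hw hpos f hf hfin
  set A := multiWeightConst p q w with hA
  have hA1 : 1 ≤ A := one_le_multiWeightConst hw.1 hq hp hpos
  set P := ∏ i, (∫⁻ x, f i x ^ p i ∂(powMeasure (p i) (w i))) ^ (1 / p i) with hP
  -- the functions relative to the measures `σᵢ dx`
  set g : Fin m → EuclideanSpace ℝ (Fin n) → ℝ≥0∞ := fun i x =>
    f i x * ENNReal.ofReal (w i x) ^ (p i).conjExponent with hg
  have hwm : ∀ i, AEMeasurable (fun x => ENNReal.ofReal (w i x)) volume := fun i =>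
    (hw.1 i).aemeasurable.ennreal_ofReal
  have hgm : ∀ i, AEMeasurable (g i) volume := fun i => (hf i).mul ((hwm i).pow_const _)
  have hgσ : ∀ i, ∀ᵐ x, dualWeight (p i) (w i) x * g i x = f i x := by
    intro i
    filter_upwards [hpos i] with x hx
    have h0 : ENNReal.ofReal (w i x) ≠ 0 := by simpa using hx
    simp only [hg, dualWeight]
    rw [mul_comm, mul_assoc, ← ENNReal.rpow_add _ _ h0 ENNReal.ofReal_ne_top, add_neg_cancel,
      ENNReal.rpow_zero, mul_one]
  have hgp : ∀ i, ∫⁻ x, g i x ^ (weightExponent p q (some i)).conjExponent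
      ∂(weightMeasure p q w (some i)) = ∫⁻ x, f i x ^ p i ∂(powMeasure (p i) (w i)) := by
    intro i
    have hp0 : 0 < p i := zero_lt_one.trans (hp i)
    change ∫⁻ x, g i x ^ ((p i).conjExponent).conjExponent
      ∂(volume.withDensity (dualWeight (p i) (w i))) = _
    rw [conjExponent_conjExponent (hp i), powMeasure,
      lintegral_withDensity_eq_lintegral_mul₀ (aemeasurable_dualWeight (hw.1 i))
        ((hgm i).pow_const _),
      lintegral_withDensity_eq_lintegral_mul₀ ((hwm i).pow_const _) ((hf i).pow_const _)]
    refine lintegral_congr_ae ?_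
    filter_upwards [hpos i] with x hx
    have h0 : ENNReal.ofReal (w i x) ≠ 0 := by simpa using hx
    simp only [Pi.mul_apply, hg, dualWeight]
    rw [ENNReal.mul_rpow_of_nonneg _ _ hp0.le, ← ENNReal.rpow_mul, mul_left_comm,
      ← ENNReal.rpow_add _ _ h0 ENNReal.ofReal_ne_top, mul_comm]
    congr 2
    have := (Real.HolderConjugate.conjExponent (hp i)).sub_one_mul_conj
    linarith
  set T : ℝ≥0∞ := C * (A ^ (1 / q)) ^ (weightExponent p q k₀ * (1 - α / n)) * P with hTdef
  have hTle : T ≤ C * A ^ sharpExponent n α p q * P := by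
    rw [hTdef, ← ENNReal.rpow_mul]
    gcongr
    rw [one_div_mul_eq_div]; exact hsharp
  set S : (Fin n → Bool) → EuclideanSpace ℝ (Fin n) → ℝ≥0∞ := fun τ x => ∑' Q : dyadicGrid τ,
        (Q : Set _).indicator (fun _ => volume (Q : Set (EuclideanSpace ℝ (Fin n))) ^
          (-((m : ℝ) - α / n)) * ∏ i, ∫⁻ z in (Q : Set _), f i z) x with hS
  have hc : ∀ τ : Fin n → Bool, Countable (dyadicGrid τ) := fun τ =>
    (countable_dyadicGrid τ).to_subtype
  have hSm : ∀ τ, Measurable (S τ) := fun τ => Measurable.tsum fun Q =>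
    measurable_const.indicator (measurableSet_of_mem_dyadicGrid Q.2)
  have hu0 : ∀ (τ : Fin n → Bool), ∀ Q ∈ dyadicGrid τ, ∀ k, weightMeasure p q w k Q ≠ ∞ := by
    rintro τ _ ⟨⟨k, z⟩, rfl⟩ κ
    simp only
    rw [gridCell_eq_cube]
    refine weightMeasure_cube_ne_top hw hq hp _ (by positivity) ?_ κ
    have h := volume_rpow_le_prod_weightMeasure (p := p) hw.1 hq hp hpos rfl
      (measurableSet_gridCell τ k z)
    have := ne_zero_of_rpow_le_prod (lam := volume) (weightExponent_pos hq hp)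
      (volume_ne_top_of_mem_dyadicGrid ⟨⟨k, z⟩, rfl⟩)
      (volume_ne_zero_of_mem_dyadicGrid ⟨⟨k, z⟩, rfl⟩) h none
    rwa [weightMeasure_apply _ (measurableSet_gridCell τ k z), gridCell_eq_cube] at this
  -- each grid separately, by exhaustion with finite families
  have hgrid : ∀ τ, ∫⁻ x, S τ x ^ q ∂(productMeasure q w) ≤ T ^ q := by
    intro τ
    refine lintegral_tsum_rpow_le _ (fun Q =>
      measurable_const.indicator (measurableSet_of_mem_dyadicGrid Q.2)) hq fun s => ?_
    set F : Finset (Set (EuclideanSpace ℝ (Fin n))) := s.map (Function.Embedding.subtype _) with hF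
    have hFτ : ∀ Q ∈ F, Q ∈ dyadicGrid τ := by
      intro Q hQ
      obtain ⟨R, _, rfl⟩ := Finset.mem_map.1 hQ
      exact R.2
    have h := hC volume F ((isLaminar_dyadicGrid τ).mono fun Q hQ => hFτ Q hQ)
      (fun Q hQ => measurableSet_of_mem_dyadicGrid (hFτ Q hQ))
      (fun Q hQ => volume_ne_zero_of_mem_dyadicGrid (hFτ Q hQ))
      (fun Q hQ => volume_ne_top_of_mem_dyadicGrid (hFτ Q hQ))
      (fun R hR x _ => by
        simp only [sub_sub_cancel]
        exact sum_volume_rpow_le τ hn (α / n) (fun Q hQ => hFτ Q hQ) hR x)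
      (weightMeasure p q w) (A ^ (1 / q)) (fun k Q hQ => hu0 τ Q (hFτ Q hQ) k)
      (fun Q hQ => by
        obtain ⟨⟨k, z⟩, rfl⟩ := hFτ Q hQ
        simp only
        rw [gridCell_eq_cube]
        exact prod_weightMeasure_cube_le hq hp hs _ (by positivity))
      (fun W hW => volume_rpow_le_prod_weightMeasure hw.1 hq hp hpos hs hW)
      f g (fun i => (hgm i).mono_ac (withDensity_absolutelyContinuous _ _))
      (fun i => by rw [hgp i]; exact hfin i)
      (fun i Q hQ => by
        have hQm := measurableSet_of_mem_dyadicGrid (hFτ Q hQ)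
        change _ = ∫⁻ x in Q, g i x ∂(volume.withDensity (dualWeight (p i) (w i)))
        rw [restrict_withDensity hQm, lintegral_withDensity_eq_lintegral_mul₀
          (aemeasurable_dualWeight (hw.1 i)).restrict (hgm i).restrict]
        refine lintegral_congr_ae (ae_restrict_of_ae ?_)
        filter_upwards [hgσ i] with x hx
        exact hx.symm)
    have e1 : ∀ i, (∫⁻ x, g i x ^ (weightExponent p q (some i)).conjExponent
        ∂(weightMeasure p q w (some i))) ^ (1 / (weightExponent p q (some i)).conjExponent) =
        (∫⁻ x, f i x ^ p i ∂(powMeasure (p i) (w i))) ^ (1 / p i) := by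
      intro i
      rw [hgp i, show weightExponent p q (some i) = (p i).conjExponent from rfl,
        conjExponent_conjExponent (hp i)]
    simp only [e1] at h
    refine le_trans (le_of_eq ?_) h
    refine lintegral_congr fun x => ?_
    simp only [familyOperator, hF, Finset.sum_map, Function.Embedding.subtype_apply]
    rfl
  set c₁ : ℝ≥0∞ := ENNReal.ofReal (12 ^ ((m : ℝ) * n - α)) with hc₁
  have hNe : (N : ℝ≥0∞) = ((Finset.univ : Finset (Fin n → Bool)).card : ℝ≥0∞) := by
    rw [hN]; rfl
  calc ∫⁻ x, (∫⁻ y : Fin m → EuclideanSpace ℝ (Fin n),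
        ENNReal.ofReal (((∑ i, ‖x - y i‖) ^ ((m : ℝ) * n - α))⁻¹) * ∏ i, f i (y i)) ^ q
          ∂(productMeasure q w)
      ≤ ∫⁻ x, c₁ ^ q * ((N : ℝ≥0∞) ^ q * ∑ τ, S τ x ^ q) ∂(productMeasure q w) := by
        refine lintegral_mono fun x => ?_
        calc _ ≤ (c₁ * ∑ τ, S τ x) ^ q :=
              ENNReal.rpow_le_rpow (lintegral_kernel_le hm hα hαn f hf x) hq.le
          _ = c₁ ^ q * (∑ τ, S τ x) ^ q := ENNReal.mul_rpow_of_nonneg _ _ hq.le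
          _ ≤ _ := by
              rw [hNe]
              exact mul_le_mul_right (ENNReal.rpow_sum_le_card_rpow_mul_sum _ _ hq) _
    _ = c₁ ^ q * ((N : ℝ≥0∞) ^ q * ∑ τ, ∫⁻ x, S τ x ^ q ∂(productMeasure q w)) := by
        rw [lintegral_const_mul _ ((Finset.measurable_fun_sum _ fun τ _ =>
            (hSm τ).pow_const q).const_mul _),
          lintegral_const_mul _ (Finset.measurable_fun_sum _ fun τ _ => (hSm τ).pow_const q),
          lintegral_finsetSum _ fun τ _ => (hSm τ).pow_const q]
    _ ≤ c₁ ^ q * ((N : ℝ≥0∞) ^ q * (N * T ^ q)) := by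
        gcongr
        rw [hNe, ← nsmul_eq_mul]
        exact Finset.sum_le_card_nsmul _ _ _ fun τ _ => hgrid τ
    _ = (c₁ * N * N ^ (1 / q) * T) ^ q := by
        have : ((N : ℝ≥0∞) ^ (1 / q)) ^ q = N := by
          rw [← ENNReal.rpow_mul, one_div_mul_cancel hq.ne', ENNReal.rpow_one]
        simp only [ENNReal.mul_rpow_of_nonneg _ _ hq.le, this]
        ring
    _ ≤ (c₁ * N * N ^ (1 / q) * (C * A ^ sharpExponent n α p q * P)) ^ q := by
        gcongr
    _ = _ := by
        rw [ENNReal.coe_mul, ENNReal.coe_mul, ENNReal.coe_mul,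
          ENNReal.coe_rpow_of_nonneg _ (one_div_pos.2 hq).le]
        congr 1
        change _ = c₁ * N * N ^ (1 / q) * C * A ^ sharpExponent n α p q * P
        ring

variable {𝕜 : Type*} [RCLike 𝕜]

theorem enorm_fracIntegrand {m : ℕ} (α : ℝ) (f : Fin m → EuclideanSpace ℝ (Fin n) → 𝕜)
    (x : EuclideanSpace ℝ (Fin n)) (y : Fin m → EuclideanSpace ℝ (Fin n)) :
    ‖fracIntegrand α f x y‖ₑ =
      ENNReal.ofReal (((∑ i, ‖x - y i‖) ^ ((m : ℝ) * n - α))⁻¹) * ∏ i, ‖f i (y i)‖ₑ := by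
  have h0 : 0 ≤ ((∑ i, ‖x - y i‖) ^ ((m : ℝ) * n - α))⁻¹ := by positivity
  rw [fracIntegrand, enorm_smul, Real.enorm_of_nonneg h0]
  congr 1
  simp only [enorm_eq_nnnorm, nnnorm_prod, ENNReal.ofNNReal_finsetProd]

theorem aestronglyMeasurable_fracIntegrand_prod {m : ℕ} (α : ℝ)
    {f : Fin m → EuclideanSpace ℝ (Fin n) → 𝕜} (hf : ∀ i, AEStronglyMeasurable (f i) volume)
    (μ : Measure (EuclideanSpace ℝ (Fin n))) [SFinite μ] :
    AEStronglyMeasurable (fun z : EuclideanSpace ℝ (Fin n) × (Fin m → EuclideanSpace ℝ (Fin n)) =>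
      fracIntegrand α f z.1 z.2) (μ.prod volume) := by
  have h1 : Measurable (fun z : EuclideanSpace ℝ (Fin n) × (Fin m → EuclideanSpace ℝ (Fin n)) =>
      ((∑ i, ‖z.1 - z.2 i‖) ^ ((m : ℝ) * n - α))⁻¹) := by fun_prop
  refine h1.aestronglyMeasurable.smul ?_
  have h2 : AEStronglyMeasurable (fun y : Fin m → EuclideanSpace ℝ (Fin n) => ∏ i, f i (y i))
      volume := by
    refine Finset.aestronglyMeasurable_fun_prod _ fun i _ => ?_
    exact (hf i).comp_quasiMeasurePreserving
      (Measure.quasiMeasurePreserving_eval (fun _ => volume) i)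
  exact h2.comp_snd

theorem aestronglyMeasurable_fracIntegrand {m : ℕ} (α : ℝ)
    {f : Fin m → EuclideanSpace ℝ (Fin n) → 𝕜} (hf : ∀ i, AEStronglyMeasurable (f i) volume)
    (x : EuclideanSpace ℝ (Fin n)) : AEStronglyMeasurable (fracIntegrand α f x) volume := by
  have h1 : Measurable (fun y : Fin m → EuclideanSpace ℝ (Fin n) =>
      ((∑ i, ‖x - y i‖) ^ ((m : ℝ) * n - α))⁻¹) := by fun_prop
  refine h1.aestronglyMeasurable.smul ?_
  refine Finset.aestronglyMeasurable_fun_prod _ fun i _ => ?_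
  exact (hf i).comp_quasiMeasurePreserving
    (Measure.quasiMeasurePreserving_eval (fun _ => volume) i)

theorem lintegral_enorm_rpow_eq {X : Type*} [MeasurableSpace X] {μ : Measure X} {p : ℝ}
    (hp : 0 < p) (f : X → 𝕜) :
    (∫⁻ x, ‖f x‖ₑ ^ p ∂μ) ^ (1 / p) = eLpNorm f (ENNReal.ofReal p) μ := by
  rw [eLpNorm_eq_lintegral_rpow_enorm_toReal (by simpa using hp) ENNReal.ofReal_ne_top,
    ENNReal.toReal_ofReal hp.le]

/-- Hence a function that is almost everywhere measurable for `w ^ p dx` is so for Lebesgue measure,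
if `w` is positive almost everywhere. -/
theorem volume_absolutelyContinuous_powMeasure {p : ℝ} {w : EuclideanSpace ℝ (Fin n) → ℝ}
    (hw : IsWeight w) (hpos : ∀ᵐ x, 0 < w x) : volume ≪ powMeasure p w := by
  refine withDensity_absolutelyContinuous' (hw.aemeasurable.ennreal_ofReal.pow_const p) ?_
  filter_upwards [hpos] with x hx
  have : 0 < ENNReal.ofReal (w x) := by simpa using hx
  exact (ENNReal.rpow_pos this ENNReal.ofReal_ne_top).ne'

/-- The strong type inequality for the multilinear fractional integral, with the dependence on the
weight constant. -/
theorem fracIntegral_bound (m n : ℕ) (α q : ℝ) (p : Fin m → ℝ)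
    (hα : 0 < α) (hαn : α < n) (hq : 0 < q) (hp : ∀ i, 1 < p i)
    (hom : ∑ i, 1 / p i = 1 / q + α / n)
    (hmin : min ((⨆ i, (p i).conjExponent) / q)
        (⨅ j, (⨆ i, if i = j then q else (p i).conjExponent) / (p j).conjExponent)
      ≤ 1 - α / n) :
    ∃ C : ℝ≥0, ∀ w : Fin m → EuclideanSpace ℝ (Fin n) → ℝ, IsMultiWeight p q w →
      ∀ f : Fin m → EuclideanSpace ℝ (Fin n) → 𝕜,
        (∀ i, MemLp (f i) (ENNReal.ofReal (p i)) (powMeasure (p i) (w i))) →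
        (∀ᵐ x ∂(productMeasure q w), Integrable (fracIntegrand α f x) volume) ∧
        MemLp (fracIntegral α f) (ENNReal.ofReal q) (productMeasure q w) ∧
        eLpNorm (fracIntegral α f) (ENNReal.ofReal q) (productMeasure q w) ≤
          C * multiWeightConst p q w ^ sharpExponent n α p q *
            ∏ i, eLpNorm (f i) (ENNReal.ofReal (p i)) (powMeasure (p i) (w i)) := by
  obtain ⟨C, hC⟩ := lintegral_fracKernel_le hα hαn hq hp hom hmin
  refine ⟨C, fun w hw f hf => ?_⟩
  rcases productMeasure_eq_zero_or hw hq hp with h0 | hpos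
  · rw [h0]; simp
  have hp0 : ∀ i, 0 < p i := fun i => zero_lt_one.trans (hp i)
  have hfm : ∀ i, AEStronglyMeasurable (f i) volume := fun i =>
    (hf i).1.mono_ac (volume_absolutelyContinuous_powMeasure (hw.1 i) (hpos i))
  have hfin : ∀ i, ∫⁻ x, ‖f i x‖ₑ ^ p i ∂(powMeasure (p i) (w i)) ≠ ∞ := by
    intro i h
    have := (hf i).2
    rw [← lintegral_enorm_rpow_eq (hp0 i), h, ENNReal.top_rpow_of_pos (one_div_pos.2 (hp0 i))]
      at this
    exact this.ne rfl
  have hmain := hC w hw hpos (fun i x => ‖f i x‖ₑ) (fun i => (hfm i).enorm) hfin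
  simp only [lintegral_enorm_rpow_eq (hp0 _), ← enorm_fracIntegrand] at hmain
  set B := C * multiWeightConst p q w ^ sharpExponent n α p q *
    ∏ i, eLpNorm (f i) (ENNReal.ofReal (p i)) (powMeasure (p i) (w i)) with hB
  have hsharp0 : 0 ≤ sharpExponent n α p q := by
    have hn0 : (0 : ℝ) < n := hα.trans hαn
    refine mul_nonneg ?_ (Real.iSup_nonneg fun i => zero_le_one.trans (le_max_left _ _))
    rw [sub_nonneg, div_le_one hn0]; exact hαn.le
  have hBt : B ≠ ∞ :=
    ENNReal.mul_ne_top (ENNReal.mul_ne_top ENNReal.coe_ne_top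
      (ENNReal.rpow_ne_top_of_nonneg hsharp0 hw.2.ne)) (ENNReal.prod_ne_top fun i _ => (hf i).2.ne)
  have hac : productMeasure q w ≪ volume := withDensity_absolutelyContinuous _ _
  have hjoint := aestronglyMeasurable_fracIntegrand_prod α hfm
    (volume : Measure (EuclideanSpace ℝ (Fin n)))
  have hTm : AEMeasurable (fun x => ∫⁻ y, ‖fracIntegrand α f x y‖ₑ) volume :=
    hjoint.enorm.lintegral_prod_right'
  have hbound : eLpNorm (fracIntegral α f) (ENNReal.ofReal q) (productMeasure q w) ≤ B := by
    rw [← lintegral_enorm_rpow_eq hq]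
    calc (∫⁻ x, ‖fracIntegral α f x‖ₑ ^ q ∂(productMeasure q w)) ^ (1 / q)
        ≤ (B ^ q) ^ (1 / q) := by
          refine ENNReal.rpow_le_rpow (le_trans (lintegral_mono fun x => ?_) hmain)
            (one_div_pos.2 hq).le
          exact ENNReal.rpow_le_rpow (enorm_integral_le_lintegral_enorm _) hq.le
      _ = B := by rw [← ENNReal.rpow_mul, mul_one_div_cancel hq.ne', ENNReal.rpow_one]
  refine ⟨?_, ⟨?_, hbound.trans_lt hBt.lt_top⟩, hbound⟩
  · have h1 := ae_lt_top' ((hTm.mono_ac hac).pow_const q)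
      (ne_top_of_le_ne_top (ENNReal.rpow_ne_top_of_nonneg hq.le hBt) hmain)
    filter_upwards [h1] with x hx
    refine ⟨aestronglyMeasurable_fracIntegrand α hfm x, ?_⟩
    exact (ENNReal.rpow_lt_top_iff_of_pos hq).1 hx
  · exact hjoint.integral_prod_right'.mono_ac hac

end UpperBound

/-! ### Power weights: averages over cubes -/

section Radial

variable {n : ℕ}

/-- The surface measure `n |B(0, 1)|` of the unit sphere. -/
noncomputable def sphereConst (n : ℕ) : ℝ :=
  n * volume.real (Metric.ball (0 : EuclideanSpace ℝ (Fin n)) 1)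

theorem sphereConst_pos (hn : n ≠ 0) : 0 < sphereConst n := by
  have h1 : (0 : ℝ) < n := by positivity
  refine mul_pos h1 (ENNReal.toReal_pos ?_ measure_ball_lt_top.ne)
  exact (Metric.measure_ball_pos _ _ one_pos).ne'

/-- The integral of a power of the norm over a ball, in polar coordinates. -/
theorem setLIntegral_ball_norm_rpow (hn : n ≠ 0) {γ R : ℝ} (hγ : 0 < γ) (hR : 0 ≤ R) :
    ∫⁻ x in Metric.ball (0 : EuclideanSpace ℝ (Fin n)) R, ENNReal.ofReal (‖x‖ ^ (γ - n)) =
      ENNReal.ofReal (sphereConst n * (R ^ γ / γ)) := by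
  have hn0 : (0 : ℝ) < n := by positivity
  have hfr : Module.finrank ℝ (EuclideanSpace ℝ (Fin n)) = n := by simp
  have : Nontrivial (EuclideanSpace ℝ (Fin n)) :=
    Module.nontrivial_of_finrank_pos (R := ℝ) (by rw [hfr]; omega)
  have hrad : ∀ y ∈ Set.Ioi (0 : ℝ), y ^ (n - 1) • (Set.Iio R).indicator (fun r => r ^ (γ - n)) y =
      (Set.Ioo 0 R).indicator (fun r : ℝ => r ^ (γ - 1)) y := by
    intro y hy
    have hy0 : (0 : ℝ) < y := hy
    by_cases h : y < R
    · rw [Set.indicator_of_mem (show y ∈ Set.Iio R from h),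
        Set.indicator_of_mem (show y ∈ Set.Ioo 0 R from ⟨hy0, h⟩), smul_eq_mul,
        ← Real.rpow_natCast, ← Real.rpow_add hy0]
      congr 1
      rw [Nat.cast_sub (by omega)]; push_cast; ring
    · rw [Set.indicator_of_notMem (show y ∉ Set.Iio R from h),
        Set.indicator_of_notMem (fun h' => h h'.2), smul_zero]
  have hint1 : IntegrableOn (fun r : ℝ => r ^ (γ - 1)) (Set.Ioo 0 R) := by
    rcases hR.eq_or_lt with h | h
    · simp [← h]
    · rw [intervalIntegral.integrableOn_Ioo_rpow_iff h]; linarith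
  have hball : ∀ x : EuclideanSpace ℝ (Fin n),
      (Metric.ball (0 : EuclideanSpace ℝ (Fin n)) R).indicator (fun x => ‖x‖ ^ (γ - n)) x =
        (Set.Iio R).indicator (fun r => r ^ (γ - n)) ‖x‖ := by
    intro x
    by_cases h : ‖x‖ < R
    · rw [Set.indicator_of_mem (mem_ball_zero_iff.2 h),
        Set.indicator_of_mem (show ‖x‖ ∈ Set.Iio R from h)]
    · rw [Set.indicator_of_notMem (fun h' => h (mem_ball_zero_iff.1 h')),
        Set.indicator_of_notMem (show ‖x‖ ∉ Set.Iio R from h)]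
  have hint : Integrable (fun x : EuclideanSpace ℝ (Fin n) =>
      (Set.Iio R).indicator (fun r => r ^ (γ - n)) ‖x‖) volume := by
    rw [integrable_fun_norm_addHaar volume (f := (Set.Iio R).indicator (fun r => r ^ (γ - n))), hfr,
      integrableOn_congr_fun hrad measurableSet_Ioi]
    exact ((integrable_indicator_iff measurableSet_Ioo).2 hint1).integrableOn
  have hnn : ∀ x : EuclideanSpace ℝ (Fin n),
      0 ≤ (Set.Iio R).indicator (fun r => r ^ (γ - n)) ‖x‖ := by
    intro x
    by_cases h : ‖x‖ < R
    · rw [Set.indicator_of_mem (show ‖x‖ ∈ Set.Iio R from h)]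
      exact Real.rpow_nonneg (norm_nonneg _) _
    · rw [Set.indicator_of_notMem (show ‖x‖ ∉ Set.Iio R from h)]
  calc ∫⁻ x in Metric.ball (0 : EuclideanSpace ℝ (Fin n)) R, ENNReal.ofReal (‖x‖ ^ (γ - n))
      = ∫⁻ x : EuclideanSpace ℝ (Fin n),
          ENNReal.ofReal ((Set.Iio R).indicator (fun r => r ^ (γ - n)) ‖x‖) := by
        rw [← lintegral_indicator measurableSet_ball]
        refine lintegral_congr fun x => ?_
        rw [← hball]
        by_cases h : x ∈ Metric.ball (0 : EuclideanSpace ℝ (Fin n)) R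
        · simp only [Set.indicator_of_mem h]
        · simp only [Set.indicator_of_notMem h, ENNReal.ofReal_zero]
    _ = ENNReal.ofReal (∫ x : EuclideanSpace ℝ (Fin n),
          (Set.Iio R).indicator (fun r => r ^ (γ - n)) ‖x‖) :=
        (ofReal_integral_eq_lintegral_ofReal hint (Filter.Eventually.of_forall hnn)).symm
    _ = _ := by
        rw [integral_fun_norm_addHaar volume (f := (Set.Iio R).indicator (fun r => r ^ (γ - n))),
          hfr, setIntegral_congr_fun measurableSet_Ioi hrad,
          setIntegral_indicator measurableSet_Ioo,
          Set.inter_eq_right.2 (fun y hy => hy.1), ← integral_Ioc_eq_integral_Ioo,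
          ← intervalIntegral.integral_of_le hR, integral_rpow (Or.inl (by linarith)),
          sub_add_cancel, Real.zero_rpow hγ.ne', sub_zero, sphereConst]
        simp only [nsmul_eq_mul, smul_eq_mul, mul_assoc]

theorem norm_sub_le_of_mem_cube (hn : n ≠ 0) {a : EuclideanSpace ℝ (Fin n)} {l : ℝ} (hl : 0 < l)
    {x y : EuclideanSpace ℝ (Fin n)} (hx : x ∈ cube a l) (hy : y ∈ cube a l) :
    ‖x - y‖ ≤ n * l := by
  have hn1 : (1 : ℝ) ≤ n := by exact_mod_cast Nat.one_le_iff_ne_zero.2 hn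
  rw [EuclideanSpace.norm_eq]
  refine Real.sqrt_le_iff.2 ⟨by positivity, ?_⟩
  calc ∑ k, ‖(x - y) k‖ ^ 2 ≤ ∑ _k : Fin n, l ^ 2 := by
        refine Finset.sum_le_sum fun k _ => ?_
        gcongr
        rw [Real.norm_eq_abs, abs_le]
        have h1 := hx k
        have h2 := hy k
        simp only [PiLp.sub_apply]
        constructor <;> linarith [h1.1, h1.2, h2.1, h2.2]
    _ = n * l ^ 2 := by simp
    _ ≤ (n * l) ^ 2 := by nlinarith [sq_nonneg l]

/-- The Muckenhoupt-type constant of a power weight with almost critical exponent grows at most like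
`1 / δ`. -/
theorem setLAverage_norm_rpow_mul_le (hn : n ≠ 0) {a₀ : ℝ} (ha : 0 < a₀) {δ : ℝ} (hδ : 0 < δ)
    (hδ1 : δ ≤ 1) (a : EuclideanSpace ℝ (Fin n)) {l : ℝ} (hl : 0 < l) :
    (⨍⁻ x in cube a l, ENNReal.ofReal (‖x‖ ^ (a₀ * (n - δ))) ∂volume) *
      (⨍⁻ x in cube a l, ENNReal.ofReal (‖x‖ ^ (δ - n)) ∂volume) ^ a₀ ≤
      ENNReal.ofReal (((4 * n) ^ n * sphereConst n + 4 ^ n) / δ) ^ a₀ := by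
  have hn1 : (1 : ℝ) ≤ n := by exact_mod_cast Nat.one_le_iff_ne_zero.2 hn
  have hS := sphereConst_pos hn
  have hV0 := volume_cube_ne_zero a hl
  have hVt := volume_cube_ne_top a l
  have hN : 0 ≤ n - δ := by linarith
  set d := n * l with hd
  have hd0 : 0 < d := by positivity
  have hav : ∀ (f : EuclideanSpace ℝ (Fin n) → ℝ≥0∞) (c : ℝ≥0∞), (∀ x ∈ cube a l, f x ≤ c) →
      ⨍⁻ x in cube a l, f x ∂volume ≤ c := by
    intro f c h
    rw [setLAverage_eq]
    refine ENNReal.div_le_of_le_mul ?_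
    calc ∫⁻ x in cube a l, f x ≤ ∫⁻ _x in cube a l, c :=
          setLIntegral_mono' (measurableSet_cube a l) h
      _ = c * volume (cube a l) := setLIntegral_const _ _
  by_cases hc : ∃ x₀ ∈ cube a l, ‖x₀‖ ≤ 2 * d
  · -- cubes close to the origin are compared with a ball
    obtain ⟨x₀, hx₀, hx₀d⟩ := hc
    have hR : ∀ x ∈ cube a l, ‖x‖ < 4 * d := by
      intro x hx
      have h1 := norm_sub_le_of_mem_cube hn hl hx hx₀
      have h2 : ‖x‖ ≤ ‖x - x₀‖ + ‖x₀‖ := by simpa using norm_add_le (x - x₀) x₀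
      linarith
    have h1 : ⨍⁻ x in cube a l, ENNReal.ofReal (‖x‖ ^ (a₀ * (n - δ))) ∂volume ≤
        ENNReal.ofReal ((4 * d) ^ (n - δ)) ^ a₀ := by
      refine hav _ _ fun x hx => ?_
      rw [ENNReal.ofReal_rpow_of_nonneg (by positivity) ha.le, ← Real.rpow_mul (by positivity),
        mul_comm (n - δ) a₀]
      exact ENNReal.ofReal_le_ofReal
        (Real.rpow_le_rpow (norm_nonneg _) (hR x hx).le (by positivity))
    have h2 : ⨍⁻ x in cube a l, ENNReal.ofReal (‖x‖ ^ (δ - n)) ∂volume ≤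
        ENNReal.ofReal (sphereConst n * ((4 * d) ^ δ / δ) / l ^ n) := by
      rw [setLAverage_eq, volume_cube, ENNReal.ofReal_div_of_pos (by positivity),
        ENNReal.ofReal_pow hl.le]
      gcongr
      rw [← setLIntegral_ball_norm_rpow hn hδ (by positivity)]
      exact lintegral_mono_set fun x hx => mem_ball_zero_iff.2 (hR x hx)
    calc _ ≤ ENNReal.ofReal ((4 * d) ^ (n - δ)) ^ a₀ *
          ENNReal.ofReal (sphereConst n * ((4 * d) ^ δ / δ) / l ^ n) ^ a₀ := by gcongr
      _ = ENNReal.ofReal ((4 * d) ^ (n - δ) * (sphereConst n * ((4 * d) ^ δ / δ) / l ^ n)) ^ a₀ := by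
          rw [← ENNReal.mul_rpow_of_nonneg _ _ ha.le, ← ENNReal.ofReal_mul (by positivity)]
      _ ≤ _ := by
          gcongr
          have e1 : (4 * d) ^ (n - δ) * (4 * d) ^ δ = (4 * d) ^ n := by
            rw [← Real.rpow_add (by positivity), sub_add_cancel, Real.rpow_natCast]
          calc (4 * d) ^ (n - δ) * (sphereConst n * ((4 * d) ^ δ / δ) / l ^ n)
              = ((4 * d) ^ (n - δ) * (4 * d) ^ δ) * (sphereConst n / δ / l ^ n) := by ring
            _ = (4 * n) ^ n * sphereConst n / δ := by
                rw [e1, hd, show 4 * (n * l) = 4 * n * l by ring, mul_pow]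
                field_simp
            _ ≤ _ := by gcongr; linarith [show (0 : ℝ) < 4 ^ n by positivity]
  · -- on the other cubes the weight is almost constant
    push Not at hc
    have hca : a ∈ cube a l := fun k => ⟨le_rfl, by linarith⟩
    set r := ‖a‖ with hr
    have hr0 : 2 * d < r := hc a hca
    have hrpos : 0 < r := by linarith
    have hup : ∀ x ∈ cube a l, ‖x‖ ≤ 2 * r := by
      intro x hx
      have h1 := norm_sub_le_of_mem_cube hn hl hx hca
      have h2 : ‖x‖ ≤ ‖x - a‖ + ‖a‖ := by simpa using norm_add_le (x - a) a
      linarith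
    have hlow : ∀ x ∈ cube a l, r / 2 ≤ ‖x‖ := by
      intro x hx
      have h1 := norm_sub_le_of_mem_cube hn hl hca hx
      have h2 : ‖a‖ ≤ ‖a - x‖ + ‖x‖ := by simpa using norm_add_le (a - x) x
      linarith
    have h1 : ⨍⁻ x in cube a l, ENNReal.ofReal (‖x‖ ^ (a₀ * (n - δ))) ∂volume ≤
        ENNReal.ofReal ((2 * r) ^ (n - δ)) ^ a₀ := by
      refine hav _ _ fun x hx => ?_
      rw [ENNReal.ofReal_rpow_of_nonneg (by positivity) ha.le, ← Real.rpow_mul (by positivity),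
        mul_comm (n - δ) a₀]
      exact ENNReal.ofReal_le_ofReal
        (Real.rpow_le_rpow (norm_nonneg _) (hup x hx) (by positivity))
    have h2 : ⨍⁻ x in cube a l, ENNReal.ofReal (‖x‖ ^ (δ - n)) ∂volume ≤
        ENNReal.ofReal ((r / 2) ^ (δ - n)) := by
      refine hav _ _ fun x hx => ENNReal.ofReal_le_ofReal ?_
      exact Real.rpow_le_rpow_of_nonpos (by positivity) (hlow x hx) (by linarith)
    calc _ ≤ ENNReal.ofReal ((2 * r) ^ (n - δ)) ^ a₀ * ENNReal.ofReal ((r / 2) ^ (δ - n)) ^ a₀ := by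
          gcongr
      _ = ENNReal.ofReal ((2 * r) ^ (n - δ) * (r / 2) ^ (δ - n)) ^ a₀ := by
          rw [← ENNReal.mul_rpow_of_nonneg _ _ ha.le, ← ENNReal.ofReal_mul (by positivity)]
      _ ≤ _ := by
          gcongr
          calc (2 * r) ^ (n - δ) * (r / 2) ^ (δ - n) = 4 ^ (n - δ) := by
                rw [show δ - n = -(n - δ) by ring, Real.rpow_neg (by positivity), ← div_eq_mul_inv,
                  ← Real.div_rpow (by positivity) (by positivity)]
                congr 1
                field_simp
                norm_num
            _ ≤ 4 ^ (n : ℝ) := Real.rpow_le_rpow_of_exponent_le (by norm_num) (by linarith)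
            _ = 4 ^ n := Real.rpow_natCast _ _
            _ ≤ ((4 * n) ^ n * sphereConst n + 4 ^ n) / 1 := by
                rw [div_one]; linarith [show 0 < (4 * (n : ℝ)) ^ n * sphereConst n by positivity]
            _ ≤ _ := by gcongr

/-- A lower bound for the fractional integral in terms of integrals over a set close to the
point. -/
theorem prod_setLIntegral_le_fracKernel {m : ℕ} (hm : m ≠ 0) {e : ℝ} (he : 0 ≤ e)
    (f : Fin m → EuclideanSpace ℝ (Fin n) → ℝ≥0∞) (hf : ∀ i, AEMeasurable (f i) volume)
    (x : EuclideanSpace ℝ (Fin n)) {A : Set (EuclideanSpace ℝ (Fin n))} (hA : MeasurableSet A)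
    {ρ : ℝ} (hx : x ∉ A) (hρ : ∀ y ∈ A, ‖x - y‖ ≤ ρ) :
    ENNReal.ofReal (((m * ρ) ^ e)⁻¹) * ∏ i, ∫⁻ y in A, f i y ≤
      ∫⁻ y : Fin m → EuclideanSpace ℝ (Fin n) in Set.univ.pi fun _ => A,
        ENNReal.ofReal (((∑ i, ‖x - y i‖) ^ e)⁻¹) * ∏ i, f i (y i) := by
  have hprod : ∏ i, ∫⁻ y in A, f i y =
      ∫⁻ y : Fin m → EuclideanSpace ℝ (Fin n) in Set.univ.pi fun _ => A, ∏ i, f i (y i) := by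
    rw [volume_pi, Measure.restrict_pi_pi]
    exact (lintegral_fin_prod_eq_prod _ f fun i => (hf i).restrict).symm
  have hm' : AEMeasurable (fun y : Fin m → EuclideanSpace ℝ (Fin n) => ∏ i, f i (y i)) volume :=
    Finset.aemeasurable_fun_prod _ fun i _ => (hf i).comp_quasiMeasurePreserving
      (Measure.quasiMeasurePreserving_eval (fun _ => volume) i)
  rw [hprod, ← lintegral_const_mul'' _ hm'.restrict]
  refine setLIntegral_mono' (MeasurableSet.univ_pi fun _ => hA) fun y hy => ?_
  gcongr
  · -- the sum of distances is positive, since `x ∉ A`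
    refine Real.rpow_pos_of_pos ?_ _
    have i₀ : Fin m := ⟨0, Nat.pos_of_ne_zero hm⟩
    have h1 : 0 < ‖x - y i₀‖ := by
      rw [norm_pos_iff, sub_ne_zero]
      rintro rfl
      exact hx (hy i₀ (Set.mem_univ _))
    exact h1.trans_le (Finset.single_le_sum (f := fun i => ‖x - y i‖)
      (fun i _ => norm_nonneg _) (Finset.mem_univ i₀))
  · calc ∑ i, ‖x - y i‖ ≤ ∑ _i : Fin m, ρ := Finset.sum_le_sum fun i _ => hρ _ (hy i (Set.mem_univ _))
      _ = m * ρ := by simp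

/-- For non-negative functions the fractional integral is given by a Lebesgue integral. -/
theorem enorm_fracIntegral_eq {𝕜 : Type*} [RCLike 𝕜] {m : ℕ} (α : ℝ)
    {φ : Fin m → EuclideanSpace ℝ (Fin n) → ℝ} (hφ : ∀ i x, 0 ≤ φ i x)
    {x : EuclideanSpace ℝ (Fin n)}
    (hint : Integrable (fracIntegrand α (fun i x => (φ i x : 𝕜)) x) volume) :
    ‖fracIntegral α (fun i x => (φ i x : 𝕜)) x‖ₑ =
      ∫⁻ y : Fin m → EuclideanSpace ℝ (Fin n),
        ENNReal.ofReal (((∑ i, ‖x - y i‖) ^ ((m : ℝ) * n - α))⁻¹) *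
          ∏ i, ENNReal.ofReal (φ i (y i)) := by
  set h : (Fin m → EuclideanSpace ℝ (Fin n)) → ℝ := fun y =>
    ((∑ i, ‖x - y i‖) ^ ((m : ℝ) * n - α))⁻¹ * ∏ i, φ i (y i) with hh
  have h0 : ∀ y, 0 ≤ h y := fun y =>
    mul_nonneg (by positivity) (Finset.prod_nonneg fun i _ => hφ i _)
  have heq : fracIntegrand α (fun i x => (φ i x : 𝕜)) x = fun y => (h y : 𝕜) := by
    funext y
    simp only [fracIntegrand, hh]
    rw [RCLike.real_smul_eq_coe_mul]
    push_cast
    rfl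
  have hint' : Integrable h volume := by
    rw [heq] at hint
    have := hint.re
    simpa using this
  rw [fracIntegral, heq, integral_ofReal, ← ofReal_norm, RCLike.norm_ofReal,
    abs_of_nonneg (integral_nonneg h0), ofReal_integral_eq_lintegral_ofReal hint'
      (Filter.Eventually.of_forall h0)]
  refine lintegral_congr fun y => ?_
  simp only [hh]
  rw [ENNReal.ofReal_mul (by positivity), ENNReal.ofReal_prod_of_nonneg fun i _ => hφ i _]

end Radial

/-! ### Power weights: constants and test functions -/

section PowerWeights

variable {n : ℕ}

theorem ae_norm_pos (hn : n ≠ 0) : ∀ᵐ x : EuclideanSpace ℝ (Fin n), 0 < ‖x‖ := by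
  have : Nonempty (Fin n) := ⟨⟨0, Nat.pos_of_ne_zero hn⟩⟩
  have : Nontrivial (EuclideanSpace ℝ (Fin n)) :=
    Module.nontrivial_of_finrank_pos (R := ℝ) (by simp; omega)
  filter_upwards [(measure_eq_zero_iff_ae_notMem.1
    (measure_singleton (μ := (volume : Measure (EuclideanSpace ℝ (Fin n)))) 0))] with x hx
  exact norm_pos_iff.2 hx

theorem isWeight_norm_rpow (hn : n ≠ 0) {b : ℝ} (hb : -(n : ℝ) < b) :
    IsWeight fun x : EuclideanSpace ℝ (Fin n) => ‖x‖ ^ b := by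
  refine ⟨fun x => Real.rpow_nonneg (norm_nonneg _) _, ?_⟩
  refine locallyIntegrable_of_norm_le_rpow (C := 1) (α := -b) ?_ ?_ ?_ ?_
  · simpa using Nat.one_le_iff_ne_zero.2 hn
  · simp only [finrank_euclideanSpace, Fintype.card_fin]; linarith
  · refine Filter.Eventually.of_forall fun x => ?_
    rw [neg_neg, one_mul, Real.norm_of_nonneg (Real.rpow_nonneg (norm_nonneg _) _)]
  · exact (measurable_norm.pow_const b).aestronglyMeasurable

/-- The test function, for which `‖f‖ ^ p w ^ p = ‖x‖ ^ (δ - n)` on the unit ball if the weight is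
`w = ‖x‖ ^ b`. -/
noncomputable def testFun (n : ℕ) (δ p b : ℝ) : EuclideanSpace ℝ (Fin n) → ℝ :=
  (Metric.ball 0 1).indicator fun x => ‖x‖ ^ ((δ - n) / p - b)

theorem testFun_nonneg (δ p b : ℝ) (x : EuclideanSpace ℝ (Fin n)) : 0 ≤ testFun n δ p b x :=
  Set.indicator_nonneg (fun _ _ => Real.rpow_nonneg (norm_nonneg _) _) x

theorem testFun_of_norm_lt {δ p b : ℝ} {x : EuclideanSpace ℝ (Fin n)} (hx : ‖x‖ < 1) :
    testFun n δ p b x = ‖x‖ ^ ((δ - n) / p - b) :=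
  Set.indicator_of_mem (mem_ball_zero_iff.2 hx) _

theorem measurable_testFun (δ p b : ℝ) : Measurable (testFun n δ p b) :=
  (measurable_norm.pow_const _).indicator measurableSet_ball

variable {𝕜 : Type*} [RCLike 𝕜]

theorem eLpNorm_testFun (hn : n ≠ 0) {δ p : ℝ} (hδ : 0 < δ) (hp : 0 < p) (b : ℝ) :
    eLpNorm (fun x => (testFun n δ p b x : 𝕜)) (ENNReal.ofReal p) (powMeasure p fun x => ‖x‖ ^ b) =
      ENNReal.ofReal (sphereConst n / δ) ^ (1 / p) := by
  have hm : Measurable fun x : EuclideanSpace ℝ (Fin n) => (testFun n δ p b x : 𝕜) :=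
    RCLike.measurable_ofReal.comp (measurable_testFun δ p b)
  rw [← lintegral_enorm_rpow_eq hp, powMeasure, lintegral_withDensity_eq_lintegral_mul₀
    ((measurable_norm.pow_const b).ennreal_ofReal.pow_const p).aemeasurable
    (hm.enorm.pow_const p).aemeasurable]
  congr 1
  have h1 := setLIntegral_ball_norm_rpow hn hδ zero_le_one
  rw [Real.one_rpow, mul_one_div] at h1
  rw [← h1, ← lintegral_indicator measurableSet_ball]
  refine lintegral_congr_ae ?_
  filter_upwards [ae_norm_pos hn] with x hx
  by_cases h : ‖x‖ < 1
  · simp only [Pi.mul_apply]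
    rw [testFun_of_norm_lt h, Set.indicator_of_mem (mem_ball_zero_iff.2 h), ← ofReal_norm,
      RCLike.norm_ofReal, abs_of_nonneg (by positivity), ENNReal.ofReal_rpow_of_pos (by positivity),
      ENNReal.ofReal_rpow_of_pos (by positivity), ← ENNReal.ofReal_mul (by positivity),
      ← Real.rpow_mul hx.le, ← Real.rpow_mul hx.le, ← Real.rpow_add hx]
    congr 2
    field_simp
    ring
  · have h0 : x ∉ Metric.ball (0 : EuclideanSpace ℝ (Fin n)) 1 :=
      fun h' => h (mem_ball_zero_iff.1 h')
    rw [Set.indicator_of_notMem h0]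
    simp [testFun, Set.indicator_of_notMem h0, hp]

theorem memLp_testFun (hn : n ≠ 0) {δ p : ℝ} (hδ : 0 < δ) (hp : 0 < p) (b : ℝ) :
    MemLp (fun x => (testFun n δ p b x : 𝕜)) (ENNReal.ofReal p)
      (powMeasure p fun x => ‖x‖ ^ b) := by
  refine ⟨(RCLike.measurable_ofReal.comp (measurable_testFun δ p b)).aestronglyMeasurable, ?_⟩
  rw [eLpNorm_testFun hn hδ hp]
  exact ENNReal.rpow_lt_top_of_nonneg (by positivity) ENNReal.ofReal_ne_top

theorem productWeight_norm_rpow {m : ℕ} (b : Fin m → ℝ) {q : ℝ} {x : EuclideanSpace ℝ (Fin n)}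
    (hx : 0 < ‖x‖) :
    productWeight q (fun i x => ‖x‖ ^ b i) x = ENNReal.ofReal (‖x‖ ^ (q * ∑ i, b i)) := by
  rw [productWeight, ← ENNReal.ofReal_prod_of_nonneg fun i _ => Real.rpow_nonneg hx.le _,
    ENNReal.ofReal_rpow_of_pos (Finset.prod_pos fun i _ => Real.rpow_pos_of_pos hx _),
    ← Real.rpow_sum_of_pos hx, ← Real.rpow_mul hx.le, mul_comm q]

theorem dualWeight_norm_rpow (p b : ℝ) {x : EuclideanSpace ℝ (Fin n)} (hx : 0 < ‖x‖) :
    dualWeight p (fun x => ‖x‖ ^ b) x = ENNReal.ofReal (‖x‖ ^ (-(b * p.conjExponent))) := by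
  rw [dualWeight, ENNReal.ofReal_rpow_of_pos (Real.rpow_pos_of_pos hx _), ← Real.rpow_mul hx.le,
    mul_neg]

theorem setLAverage_congr_of_norm_pos (hn : n ≠ 0) (a : EuclideanSpace ℝ (Fin n)) (l : ℝ)
    {f g : EuclideanSpace ℝ (Fin n) → ℝ≥0∞} (h : ∀ x, 0 < ‖x‖ → f x = g x) :
    ⨍⁻ x in cube a l, f x ∂volume = ⨍⁻ x in cube a l, g x ∂volume := by
  refine laverage_congr (ae_restrict_of_ae ?_)
  filter_upwards [ae_norm_pos hn] with x hx
  exact h x hx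

theorem setLAverage_one_cube (a : EuclideanSpace ℝ (Fin n)) {l : ℝ} (hl : 0 < l) :
    ⨍⁻ _x in cube a l, (1 : ℝ≥0∞) ∂volume = 1 := by
  rw [setLAverage_eq, setLIntegral_const, one_mul,
    ENNReal.div_self (volume_cube_ne_zero a hl) (volume_cube_ne_top a l)]

/-- If only the weight with index `j` is non-trivial, the constant `[w]` involves only `u_w` and
`σ_j`. -/
theorem multiWeightConst_single_le {m : ℕ} (hn : n ≠ 0) {p : Fin m → ℝ} {q : ℝ} (j : Fin m) (b : ℝ)
    {B : ℝ≥0∞} (hB : ∀ (a : EuclideanSpace ℝ (Fin n)) (l : ℝ), 0 < l →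
      (⨍⁻ x in cube a l, ENNReal.ofReal (‖x‖ ^ (q * b)) ∂volume) *
        (⨍⁻ x in cube a l, ENNReal.ofReal (‖x‖ ^ (-(b * (p j).conjExponent))) ∂volume) ^
          (q / (p j).conjExponent) ≤ B) :
    multiWeightConst p q (fun i (x : EuclideanSpace ℝ (Fin n)) =>
      ‖x‖ ^ (Pi.single j b : Fin m → ℝ) i) ≤ B := by
  refine iSup_le fun a => iSup_le fun l => iSup_le fun hl => le_trans (le_of_eq ?_) (hB a l hl)
  congr 1
  · refine setLAverage_congr_of_norm_pos hn a l fun x hx => ?_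
    rw [productWeight_norm_rpow _ hx, Finset.sum_pi_single']
    simp
  · rw [Finset.prod_eq_single j]
    · congr 1
      refine setLAverage_congr_of_norm_pos hn a l fun x hx => ?_
      simp only [Pi.single_eq_same]
      exact dualWeight_norm_rpow _ _ hx
    · intro i _ hij
      have : ⨍⁻ x in cube a l, dualWeight (p i)
          (fun x : EuclideanSpace ℝ (Fin n) => ‖x‖ ^ (Pi.single j b : Fin m → ℝ) i) x ∂volume = 1 := by
        rw [← setLAverage_one_cube a hl]
        refine setLAverage_congr_of_norm_pos hn a l fun x hx => ?_
        rw [dualWeight_norm_rpow _ _ hx]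
        simp [hij]
      rw [this, ENNReal.one_rpow]
    · simp

/-- A pointwise lower bound for the fractional integral on a ball gives a lower bound for its
norm. -/
theorem le_eLpNorm_of_norm_rpow_le (hn : n ≠ 0) {m : ℕ} {b : Fin m → ℝ} {q : ℝ} (hq : 0 < q)
    {g : EuclideanSpace ℝ (Fin n) → 𝕜} {t κ R γ : ℝ} (ht : 0 ≤ t) (hR : 0 ≤ R) (hγ : 0 < γ)
    (hκ : q * κ + q * ∑ i, b i = γ - n)
    (h : ∀ᵐ x : EuclideanSpace ℝ (Fin n), ‖x‖ < R → ENNReal.ofReal (t * ‖x‖ ^ κ) ≤ ‖g x‖ₑ) :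
    ENNReal.ofReal (t * (sphereConst n * (R ^ γ / γ)) ^ (1 / q)) ≤
      eLpNorm g (ENNReal.ofReal q) (productMeasure q fun i x => ‖x‖ ^ b i) := by
  have hS := sphereConst_pos hn
  have hRγ : 0 ≤ R ^ γ := Real.rpow_nonneg hR _
  have hmeas : AEMeasurable (productWeight q fun i (x : EuclideanSpace ℝ (Fin n)) => ‖x‖ ^ b i)
      volume :=
    (Finset.aemeasurable_fun_prod _ fun i _ =>
      (measurable_norm.pow_const (b i)).ennreal_ofReal.aemeasurable).pow_const q
  rw [← lintegral_enorm_rpow_eq hq, ENNReal.ofReal_mul ht,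
    ← ENNReal.ofReal_rpow_of_nonneg (by positivity) (by positivity),
    ← ENNReal.rpow_le_rpow_iff hq, ENNReal.mul_rpow_of_nonneg _ _ hq.le, ← ENNReal.rpow_mul,
    ← ENNReal.rpow_mul, one_div_mul_cancel hq.ne', ENNReal.rpow_one, ENNReal.rpow_one,
    ← setLIntegral_ball_norm_rpow hn hγ hR, ← lintegral_const_mul' _ _ (by
      exact ENNReal.rpow_ne_top_of_nonneg hq.le ENNReal.ofReal_ne_top), productMeasure,
    lintegral_withDensity_eq_lintegral_mul_non_measurable₀ _ hmeas (by
      filter_upwards [ae_norm_pos hn] with x hx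
      rw [productWeight_norm_rpow _ hx]
      exact ENNReal.ofReal_lt_top)]
  rw [← lintegral_indicator measurableSet_ball]
  refine lintegral_mono_ae ?_
  filter_upwards [h, ae_norm_pos hn] with x hx hx0
  by_cases hxR : ‖x‖ < R
  · rw [Set.indicator_of_mem (mem_ball_zero_iff.2 hxR), Pi.mul_apply, productWeight_norm_rpow _ hx0]
    calc ENNReal.ofReal t ^ q * ENNReal.ofReal (‖x‖ ^ (γ - n))
        = ENNReal.ofReal (‖x‖ ^ (q * ∑ i, b i)) * ENNReal.ofReal (t * ‖x‖ ^ κ) ^ q := by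
          rw [ENNReal.ofReal_mul ht, ENNReal.mul_rpow_of_nonneg _ _ hq.le,
            ENNReal.ofReal_rpow_of_pos (x := ‖x‖ ^ κ) (by positivity), ← Real.rpow_mul hx0.le,
            mul_left_comm, ← ENNReal.ofReal_mul (by positivity), ← Real.rpow_add hx0, ← hκ]
          congr 3
          ring
      _ ≤ _ := by gcongr; exact hx hxR
  · rw [Set.indicator_of_notMem fun h' => hxR (mem_ball_zero_iff.1 h')]
    exact zero_le

end PowerWeights

/-! ### Lower bounds for the fractional integral of the test functions -/

section LowerBounds

variable {m n : ℕ}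

/-- The homogeneity of `testFun` at the origin, increased by the dimension. -/
noncomputable def testOrder (n : ℕ) (δ p b : ℝ) : ℝ := n + (δ - n) / p - b

/-- The multilinear fractional integral of the test functions, as a Lebesgue integral. -/
noncomputable def lfracTest (n : ℕ) (α δ : ℝ) (p b : Fin m → ℝ)
    (x : EuclideanSpace ℝ (Fin n)) : ℝ≥0∞ :=
  ∫⁻ y : Fin m → EuclideanSpace ℝ (Fin n),
    ENNReal.ofReal (((∑ i, ‖x - y i‖) ^ ((m : ℝ) * n - α))⁻¹) *
      ∏ i, ENNReal.ofReal (testFun n δ (p i) (b i) (y i))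

/-- The contribution of `A × ⋯ × A` to the fractional integral of the test functions at a point
outside `A`, when all distances from the point to `A` are at most `2 * ρ`. -/
theorem rpow_inv_mul_prod_le_lfracTest (hm : m ≠ 0) {α δ : ℝ} (hE : 0 ≤ (m : ℝ) * n - α)
    {p b : Fin m → ℝ} {x : EuclideanSpace ℝ (Fin n)} {A : Set (EuclideanSpace ℝ (Fin n))}
    (hA : MeasurableSet A) (hx : x ∉ A) {ρ : ℝ} (hρ0 : 0 < ρ) (hρ : ∀ y ∈ A, ‖x - y‖ ≤ 2 * ρ)
    {c : Fin m → ℝ} (hc0 : ∀ i, 0 ≤ c i)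
    (hc : ∀ i, ENNReal.ofReal (c i * ρ ^ testOrder n δ (p i) (b i)) ≤
      ∫⁻ y in A, ENNReal.ofReal (testFun n δ (p i) (b i) y)) :
    ENNReal.ofReal (((2 * m : ℝ) ^ ((m : ℝ) * n - α))⁻¹ * (∏ i, c i) *
        ρ ^ (∑ i, testOrder n δ (p i) (b i) - (m * n - α))) ≤
      ∫⁻ y : Fin m → EuclideanSpace ℝ (Fin n) in Set.univ.pi fun _ => A,
        ENNReal.ofReal (((∑ i, ‖x - y i‖) ^ ((m : ℝ) * n - α))⁻¹) *
          ∏ i, ENNReal.ofReal (testFun n δ (p i) (b i) (y i)) := by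
  refine le_trans ?_ (prod_setLIntegral_le_fracKernel hm hE
    (fun i y => ENNReal.ofReal (testFun n δ (p i) (b i) y))
    (fun i => (measurable_testFun _ _ _).ennreal_ofReal.aemeasurable) x hA hx hρ)
  calc _ = ENNReal.ofReal (((m * (2 * ρ)) ^ ((m : ℝ) * n - α))⁻¹) *
        ∏ i, ENNReal.ofReal (c i * ρ ^ testOrder n δ (p i) (b i)) := by
        rw [← ENNReal.ofReal_prod_of_nonneg fun i _ => mul_nonneg (hc0 i) (by positivity),
          ← ENNReal.ofReal_mul (by positivity), Finset.prod_mul_distrib,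
          ← Real.rpow_sum_of_pos hρ0, Real.rpow_sub hρ0,
          show (m : ℝ) * (2 * ρ) = 2 * m * ρ by ring, Real.mul_rpow (by positivity) hρ0.le]
        congr 1
        rw [mul_inv]
        ring
    _ ≤ _ := by
        gcongr with i
        exact hc i

/-- A lower bound near the origin that sees the full mass of the test functions in a ball. -/
theorem ofReal_le_lfracTest_ball (hm : m ≠ 0) (hn : n ≠ 0) {α δ : ℝ} (hE : 0 ≤ (m : ℝ) * n - α)
    {p b : Fin m → ℝ} (hγ : ∀ i, 0 < testOrder n δ (p i) (b i))
    {x : EuclideanSpace ℝ (Fin n)} (hx0 : 0 < ‖x‖) (hx1 : ‖x‖ < 1) :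
    ENNReal.ofReal (((2 * m : ℝ) ^ ((m : ℝ) * n - α))⁻¹ *
        (∏ i, sphereConst n / testOrder n δ (p i) (b i)) *
        ‖x‖ ^ (∑ i, testOrder n δ (p i) (b i) - (m * n - α))) ≤ lfracTest n α δ p b x := by
  have hS := sphereConst_pos hn
  refine le_trans (rpow_inv_mul_prod_le_lfracTest hm hE measurableSet_ball
    (A := Metric.ball (0 : EuclideanSpace ℝ (Fin n)) ‖x‖)
    (fun h => lt_irrefl _ (mem_ball_zero_iff.1 h)) hx0 ?_
    (fun i => (div_pos hS (hγ i)).le) ?_) (setLIntegral_le_lintegral _ _)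
  · intro y hy
    have := mem_ball_zero_iff.1 hy
    linarith [norm_sub_le x y]
  · intro i
    rw [div_mul_eq_mul_div, mul_div_assoc, ← setLIntegral_ball_norm_rpow hn (hγ i) (norm_nonneg x)]
    refine le_of_eq (setLIntegral_congr_fun measurableSet_ball fun y hy => ?_)
    rw [testFun_of_norm_lt ((mem_ball_zero_iff.1 hy).trans hx1), testOrder]
    congr 2
    ring

/-- The annulus with radii `2 ^ (-k - 1)` and `2 ^ (-k)`. -/
def annulus (n k : ℕ) : Set (EuclideanSpace ℝ (Fin n)) :=
  Metric.ball 0 (2⁻¹ ^ k) \ Metric.ball 0 (2⁻¹ ^ (k + 1))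

theorem measurableSet_annulus (n k : ℕ) : MeasurableSet (annulus n k) :=
  measurableSet_ball.diff measurableSet_ball

theorem mem_annulus {k : ℕ} {x : EuclideanSpace ℝ (Fin n)} :
    x ∈ annulus n k ↔ ‖x‖ < 2⁻¹ ^ k ∧ 2⁻¹ ^ (k + 1) ≤ ‖x‖ := by
  rw [annulus, Set.mem_sdiff, mem_ball_zero_iff, mem_ball_zero_iff, not_lt]

theorem disjoint_annulus {k k' : ℕ} (h : k < k') : Disjoint (annulus n k) (annulus n k') := by
  rw [Set.disjoint_left]
  intro x hx hx'
  have h1 : (2⁻¹ : ℝ) ^ k' ≤ 2⁻¹ ^ (k + 1) :=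
    pow_le_pow_of_le_one (by norm_num) (by norm_num) h
  linarith [(mem_annulus.1 hx).2, (mem_annulus.1 hx').1]

theorem le_volume_annulus (hn : n ≠ 0) (k : ℕ) :
    ENNReal.ofReal (sphereConst n / n / 2 * (2⁻¹ ^ k) ^ n) ≤ volume (annulus n k) := by
  have hn0 : (0 : ℝ) < n := by positivity
  have hS := sphereConst_pos hn
  have hball : ∀ R : ℝ, 0 ≤ R → volume (Metric.ball (0 : EuclideanSpace ℝ (Fin n)) R) =
      ENNReal.ofReal (sphereConst n / n * R ^ n) := by
    intro R hR
    have := setLIntegral_ball_norm_rpow hn hn0 hR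
    simp only [sub_self, Real.rpow_zero, ENNReal.ofReal_one, setLIntegral_const, one_mul,
      Real.rpow_natCast] at this
    rw [this]
    congr 1
    ring
  rw [annulus, measure_sdiff (Metric.ball_subset_ball
    (pow_le_pow_of_le_one (by norm_num) (by norm_num) (Nat.le_succ k)))
    measurableSet_ball.nullMeasurableSet measure_ball_lt_top.ne, hball _ (by positivity),
    hball _ (by positivity), ← ENNReal.ofReal_sub _ (by positivity)]
  refine ENNReal.ofReal_le_ofReal ?_
  have h1 : ((2⁻¹ : ℝ) ^ (k + 1)) ^ n ≤ 2⁻¹ * (2⁻¹ ^ k) ^ n := by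
    rw [pow_succ, mul_pow, mul_comm]
    gcongr
    exact pow_le_of_le_one (by norm_num) (by norm_num) hn
  calc sphereConst n / n / 2 * (2⁻¹ ^ k) ^ n
      = sphereConst n / n * (2⁻¹ ^ k) ^ n - sphereConst n / n * (2⁻¹ * (2⁻¹ ^ k) ^ n) := by ring
    _ ≤ _ := by gcongr

theorem le_setLIntegral_annulus_testFun (hn : n ≠ 0) {δ p b : ℝ} (hγ : testOrder n δ p b ≤ 2 * n)
    (k : ℕ) :
    ENNReal.ofReal (2⁻¹ ^ n * (sphereConst n / n / 2) * (2⁻¹ ^ k) ^ testOrder n δ p b) ≤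
      ∫⁻ y in annulus n k, ENNReal.ofReal (testFun n δ p b y) := by
  have hS := sphereConst_pos hn
  have hn0 : (0 : ℝ) < n := by positivity
  set r : ℝ := 2⁻¹ ^ k with hr
  have hr0 : 0 < r := by positivity
  have hr1 : r ≤ 1 := pow_le_one₀ (by norm_num) (by norm_num)
  have hlow : ∀ y ∈ annulus n k, ENNReal.ofReal (2⁻¹ ^ n * r ^ (testOrder n δ p b - n)) ≤
      ENNReal.ofReal (testFun n δ p b y) := by
    intro y hy
    obtain ⟨h1, h2⟩ := mem_annulus.1 hy
    rw [pow_succ] at h2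
    have hy0 : 0 < ‖y‖ := lt_of_lt_of_le (by positivity) h2
    rw [testFun_of_norm_lt (h1.trans_le hr1),
      show (δ - n) / p - b = testOrder n δ p b - n by rw [testOrder]; ring]
    refine ENNReal.ofReal_le_ofReal ?_
    -- `‖y‖ / r` lies in `[1 / 2, 1)`, and the exponent is at most `n`
    calc 2⁻¹ ^ n * r ^ (testOrder n δ p b - n)
        ≤ (‖y‖ / r) ^ (n : ℝ) * r ^ (testOrder n δ p b - n) := by
          rw [Real.rpow_natCast]
          gcongr
          rw [le_div_iff₀ hr0]
          linarith
      _ ≤ (‖y‖ / r) ^ (testOrder n δ p b - n) * r ^ (testOrder n δ p b - n) := by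
          refine mul_le_mul_of_nonneg_right ?_ (by positivity)
          refine Real.rpow_le_rpow_of_exponent_ge (by positivity) ?_ (by linarith)
          rw [div_le_one hr0]
          exact h1.le
      _ = ‖y‖ ^ (testOrder n δ p b - n) := by
          rw [Real.div_rpow hy0.le hr0.le, div_mul_cancel₀]
          positivity
  calc ENNReal.ofReal (2⁻¹ ^ n * (sphereConst n / n / 2) * r ^ testOrder n δ p b)
      = ENNReal.ofReal (2⁻¹ ^ n * r ^ (testOrder n δ p b - n)) *
          ENNReal.ofReal (sphereConst n / n / 2 * r ^ n) := by
        rw [← ENNReal.ofReal_mul (by positivity), Real.rpow_sub hr0, Real.rpow_natCast]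
        congr 1
        field_simp
    _ ≤ ENNReal.ofReal (2⁻¹ ^ n * r ^ (testOrder n δ p b - n)) * volume (annulus n k) := by
        gcongr
        exact le_volume_annulus hn k
    _ = ∫⁻ _y in annulus n k, ENNReal.ofReal (2⁻¹ ^ n * r ^ (testOrder n δ p b - n)) :=
        (setLIntegral_const _ _).symm
    _ ≤ _ := setLIntegral_mono' (measurableSet_annulus n k) hlow

/-- If the test functions are jointly almost critical, all annuli around a point near the origin
contribute the same amount to the fractional integral. -/
theorem ofReal_le_lfracTest_annuli (hm : m ≠ 0) (hn : n ≠ 0) {α δ : ℝ}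
    (hE : 0 ≤ (m : ℝ) * n - α) {p b : Fin m → ℝ} (hγ : ∀ i, testOrder n δ (p i) (b i) ≤ 2 * n)
    {K : ℕ} (hη0 : 0 ≤ ∑ i, testOrder n δ (p i) (b i) - (m * n - α))
    (hη : K * (∑ i, testOrder n δ (p i) (b i) - (m * n - α)) ≤ 1)
    {x : EuclideanSpace ℝ (Fin n)} (hx : ‖x‖ < 2⁻¹ ^ K) :
    ENNReal.ofReal (K * (((2 * m : ℝ) ^ ((m : ℝ) * n - α))⁻¹ *
        (2⁻¹ ^ n * (sphereConst n / n / 2)) ^ m * 2⁻¹)) ≤ lfracTest n α δ p b x := by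
  have hS := sphereConst_pos hn
  set c : ℝ := 2⁻¹ ^ n * (sphereConst n / n / 2) with hc
  set η := ∑ i, testOrder n δ (p i) (b i) - (m * n - α) with hηdef
  have hc0 : 0 ≤ c := by positivity
  set G : (Fin m → EuclideanSpace ℝ (Fin n)) → ℝ≥0∞ := fun y =>
    ENNReal.ofReal (((∑ i, ‖x - y i‖) ^ ((m : ℝ) * n - α))⁻¹) *
      ∏ i, ENNReal.ofReal (testFun n δ (p i) (b i) (y i)) with hG
  have hk : ∀ k ∈ Finset.range K,
      ENNReal.ofReal (((2 * m : ℝ) ^ ((m : ℝ) * n - α))⁻¹ * c ^ m * 2⁻¹) ≤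
        ∫⁻ y in Set.univ.pi fun _ => annulus n k, G y := by
    intro k hk
    have hkK : k + 1 ≤ K := Finset.mem_range.1 hk
    have hle : (2⁻¹ : ℝ) ^ K ≤ 2⁻¹ ^ (k + 1) :=
      pow_le_pow_of_le_one (by norm_num) (by norm_num) hkK
    have hle' : (2⁻¹ : ℝ) ^ (k + 1) ≤ 2⁻¹ ^ k :=
      pow_le_pow_of_le_one (by norm_num) (by norm_num) (Nat.le_succ k)
    refine le_trans (ENNReal.ofReal_le_ofReal ?_) (rpow_inv_mul_prod_le_lfracTest hm hE
      (ρ := 2⁻¹ ^ k) (c := fun _ => c) (measurableSet_annulus n k) (fun h => ?_) (by positivity)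
      (fun y hy => ?_) (fun _ => hc0) fun i => le_setLIntegral_annulus_testFun hn (hγ i) k)
    · rw [Finset.prod_const, Finset.card_univ, Fintype.card_fin, ← hηdef]
      gcongr
      rw [← Real.rpow_natCast, ← Real.rpow_mul (by norm_num)]
      calc (2⁻¹ : ℝ) = 2⁻¹ ^ (1 : ℝ) := (Real.rpow_one _).symm
        _ ≤ _ := by
          refine Real.rpow_le_rpow_of_exponent_ge (by norm_num) (by norm_num) (le_trans ?_ hη)
          gcongr
          omega
    · linarith [(mem_annulus.1 h).2]
    · linarith [norm_sub_le x y, (mem_annulus.1 hy).1]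
  calc ENNReal.ofReal (K * (((2 * m : ℝ) ^ ((m : ℝ) * n - α))⁻¹ * c ^ m * 2⁻¹))
      = ∑ k ∈ Finset.range K,
          ENNReal.ofReal (((2 * m : ℝ) ^ ((m : ℝ) * n - α))⁻¹ * c ^ m * 2⁻¹) := by
        rw [Finset.sum_const, Finset.card_range, nsmul_eq_mul, ENNReal.ofReal_mul (by positivity),
          ENNReal.ofReal_natCast]
    _ ≤ ∑ k ∈ Finset.range K, ∫⁻ y in Set.univ.pi fun _ => annulus n k, G y :=
        Finset.sum_le_sum hk
    _ = ∫⁻ y in ⋃ k ∈ Finset.range K, Set.univ.pi fun _ => annulus n k, G y := by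
        refine (lintegral_biUnion_finset (fun k _ k' _ hkk' => ?_)
          (fun k _ => MeasurableSet.univ_pi fun _ => measurableSet_annulus n k) G).symm
        have hdis : Disjoint (annulus n k) (annulus n k') := by
          rcases lt_or_gt_of_ne hkk' with h | h
          · exact disjoint_annulus h
          · exact (disjoint_annulus h).symm
        rw [Function.onFun, Set.disjoint_left]
        intro y hy hy'
        have i₀ : Fin m := ⟨0, Nat.pos_of_ne_zero hm⟩
        exact Set.disjoint_left.1 hdis (hy i₀ (Set.mem_univ _)) (hy' i₀ (Set.mem_univ _))
    _ ≤ lfracTest n α δ p b x := setLIntegral_le_lintegral _ _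

variable {𝕜 : Type*} [RCLike 𝕜]

theorem le_eLpNorm_fracIntegral_testFun (hn : n ≠ 0) {p b : Fin m → ℝ} {q α δ : ℝ} (hq : 0 < q)
    (hint : ∀ᵐ x ∂(productMeasure q fun i (x : EuclideanSpace ℝ (Fin n)) => ‖x‖ ^ b i),
      Integrable (fracIntegrand α (fun i x => (testFun n δ (p i) (b i) x : 𝕜)) x) volume)
    {t κ R γ : ℝ} (ht : 0 ≤ t) (hR : 0 ≤ R) (hγ : 0 < γ) (hκ : q * κ + q * ∑ i, b i = γ - n)
    (h : ∀ x : EuclideanSpace ℝ (Fin n), 0 < ‖x‖ → ‖x‖ < R →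
      ENNReal.ofReal (t * ‖x‖ ^ κ) ≤ lfracTest n α δ p b x) :
    ENNReal.ofReal (t * (sphereConst n * (R ^ γ / γ)) ^ (1 / q)) ≤
      eLpNorm (fracIntegral α fun i x => (testFun n δ (p i) (b i) x : 𝕜)) (ENNReal.ofReal q)
        (productMeasure q fun i x => ‖x‖ ^ b i) := by
  refine le_eLpNorm_of_norm_rpow_le hn hq ht hR hγ hκ ?_
  have hac : (volume : Measure (EuclideanSpace ℝ (Fin n))) ≪
      productMeasure q fun i (x : EuclideanSpace ℝ (Fin n)) => ‖x‖ ^ b i := by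
    refine withDensity_absolutelyContinuous' ?_ ?_
    · exact (Finset.aemeasurable_fun_prod _ fun i _ =>
        (measurable_norm.pow_const (b i)).ennreal_ofReal.aemeasurable).pow_const q
    · filter_upwards [ae_norm_pos hn] with x hx
      rw [productWeight_norm_rpow _ hx]
      exact (ENNReal.ofReal_pos.2 (Real.rpow_pos_of_pos hx _)).ne'
  filter_upwards [hac.ae_le hint, ae_norm_pos hn] with x hx hx0 hxR
  rw [enorm_fracIntegral_eq α (fun i x => testFun_nonneg _ _ _ x) hx]
  exact h x hx0 hxR

end LowerBounds

/-! ### Sharpness of the exponent -/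

section Sharpness

variable {m n : ℕ} {α q : ℝ} {p : Fin m → ℝ} {𝕜 : Type*} [RCLike 𝕜]

/-- Sharpness follows from power weights whose constant grows at most like `K ^ e`, while the norm
of the fractional integral of the test functions with `δ = 1 / K` grows like `K ^ (1 + 1 / q)`. -/
theorem not_exists_bound_of_examples (hα : 0 < α) (hαn : α < n) (hq : 0 < q) (hp : ∀ i, 1 < p i)
    (hom : ∑ i, 1 / p i = 1 / q + α / n) {e C₀ c₁ s : ℝ} (he : 0 ≤ e)
    (hs : e * max s 0 < 1 - α / n) (hC₀ : 0 < C₀) (hc₁ : 0 < c₁)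
    (hex : ∀ K : ℕ, 2 ≤ K → ∃ b : Fin m → ℝ, (∀ i, -(n : ℝ) < b i) ∧
      multiWeightConst p q (fun i (x : EuclideanSpace ℝ (Fin n)) => ‖x‖ ^ b i) ≤
        ENNReal.ofReal (C₀ * K) ^ e ∧
      ((∀ᵐ x ∂(productMeasure q fun i (x : EuclideanSpace ℝ (Fin n)) => ‖x‖ ^ b i),
        Integrable (fracIntegrand α (fun i x => (testFun n (1 / K) (p i) (b i) x : 𝕜)) x)
          volume) →
      ENNReal.ofReal (c₁ * (K : ℝ) ^ (1 + 1 / q)) ≤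
        eLpNorm (fracIntegral α fun i x => (testFun n (1 / K) (p i) (b i) x : 𝕜))
          (ENNReal.ofReal q) (productMeasure q fun i x => ‖x‖ ^ b i)))
    {C₁ : ℝ≥0}
    (hint : ∀ w : Fin m → EuclideanSpace ℝ (Fin n) → ℝ, IsMultiWeight p q w →
      ∀ f : Fin m → EuclideanSpace ℝ (Fin n) → 𝕜,
        (∀ i, MemLp (f i) (ENNReal.ofReal (p i)) (powMeasure (p i) (w i))) →
        ∀ᵐ x ∂(productMeasure q w), Integrable (fracIntegrand α f x) volume)
    (hbound : ∀ w : Fin m → EuclideanSpace ℝ (Fin n) → ℝ, IsMultiWeight p q w →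
      ∀ f : Fin m → EuclideanSpace ℝ (Fin n) → 𝕜,
        (∀ i, MemLp (f i) (ENNReal.ofReal (p i)) (powMeasure (p i) (w i))) →
        eLpNorm (fracIntegral α f) (ENNReal.ofReal q) (productMeasure q w) ≤
          C₁ * multiWeightConst p q w ^ s *
            ∏ i, eLpNorm (f i) (ENNReal.ofReal (p i)) (powMeasure (p i) (w i))) : False := by
  have hn0 : (0 : ℝ) < n := hα.trans hαn
  have hn : n ≠ 0 := by rintro rfl; simp at hn0
  have hS := sphereConst_pos hn
  have hp0 : ∀ i, 0 < p i := fun i => zero_lt_one.trans (hp i)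
  set s' := max s 0 with hs'
  have hs'0 : 0 ≤ s' := le_max_right _ _
  set D : ℝ := C₁ * C₀ ^ (e * s') * sphereConst n ^ (1 / q + α / n) / c₁ with hD
  have key : ∀ K : ℕ, 2 ≤ K → (K : ℝ) ^ (1 - α / n - e * s') ≤ D := by
    intro K hK
    have hK0 : (0 : ℝ) < K := by positivity
    obtain ⟨b, hb, hconst, hlow⟩ := hex K hK
    have hw : ∀ i, IsWeight fun x : EuclideanSpace ℝ (Fin n) => ‖x‖ ^ b i :=
      fun i => isWeight_norm_rpow hn (hb i)
    have hmw : IsMultiWeight p q fun i (x : EuclideanSpace ℝ (Fin n)) => ‖x‖ ^ b i :=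
      ⟨hw, hconst.trans_lt (ENNReal.rpow_lt_top_of_nonneg he ENNReal.ofReal_ne_top)⟩
    have hone := one_le_multiWeightConst hw hq hp fun i => by
      filter_upwards [ae_norm_pos hn] with x hx
      positivity
    have hδ : (0 : ℝ) < 1 / K := by positivity
    have hf : ∀ i, MemLp (fun x => (testFun n (1 / K) (p i) (b i) x : 𝕜)) (ENNReal.ofReal (p i))
        (powMeasure (p i) fun x => ‖x‖ ^ b i) := fun i => memLp_testFun hn hδ (hp0 i) (b i)
    have h1 := (hlow (hint _ hmw _ hf)).trans (hbound _ hmw _ hf)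
    simp only [eLpNorm_testFun hn hδ (hp0 _)] at h1
    have h2 : multiWeightConst p q (fun i (x : EuclideanSpace ℝ (Fin n)) => ‖x‖ ^ b i) ^ s ≤
        ENNReal.ofReal (C₀ * K) ^ (e * s') := by
      rw [ENNReal.rpow_mul]
      exact (ENNReal.rpow_le_rpow_of_exponent_le hone (le_max_left _ _)).trans
        (ENNReal.rpow_le_rpow hconst hs'0)
    have hSK : 0 < sphereConst n / (1 / K) := by positivity
    rw [← ENNReal.rpow_sum_of_ne (ENNReal.ofReal_pos.2 hSK).ne' ENNReal.ofReal_ne_top, hom] at h1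
    have h3 : ENNReal.ofReal (c₁ * (K : ℝ) ^ (1 + 1 / q)) ≤ ENNReal.ofReal
        (C₁ * (C₀ * K) ^ (e * s') * (sphereConst n * K) ^ (1 / q + α / n)) := by
      refine h1.trans ?_
      rw [ENNReal.ofReal_mul (by positivity), ENNReal.ofReal_mul (by positivity),
        ENNReal.ofReal_coe_nnreal, ← ENNReal.ofReal_rpow_of_pos (by positivity),
        ← ENNReal.ofReal_rpow_of_pos (by positivity), div_div_eq_mul_div, div_one]
      gcongr
    rw [ENNReal.ofReal_le_ofReal_iff (by positivity), Real.mul_rpow hC₀.le hK0.le,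
      Real.mul_rpow hS.le hK0.le] at h3
    have h4 : (K : ℝ) ^ (1 + 1 / q) = (K : ℝ) ^ (1 - α / n - e * s') *
        ((K : ℝ) ^ (e * s') * (K : ℝ) ^ (1 / q + α / n)) := by
      rw [← Real.rpow_add hK0, ← Real.rpow_add hK0]
      congr 1
      ring
    rw [hD, le_div_iff₀ hc₁]
    refine le_of_mul_le_mul_right (a := (K : ℝ) ^ (e * s') * (K : ℝ) ^ (1 / q + α / n)) ?_
      (by positivity)
    calc _ = c₁ * (K : ℝ) ^ (1 + 1 / q) := by rw [h4]; ring
      _ ≤ _ := h3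
      _ = _ := by ring
  -- `hs` makes the exponent of `K` positive, so that the bound `D` is exceeded eventually
  have hlim := (tendsto_rpow_atTop (sub_pos.2 hs)).comp tendsto_natCast_atTop_atTop
  obtain ⟨K, hK2, hKD⟩ := ((Filter.eventually_ge_atTop 2).and
    (hlim.eventually_gt_atTop D)).exists
  exact absurd (key K hK2) (not_le.2 hKD)

/-- The homogeneity of the fractional integral of the test functions at the origin. -/
theorem sum_testOrder_single (hom : ∑ i, 1 / p i = 1 / q + α / n) (δ : ℝ) (j : Fin m) (β : ℝ) :
    ∑ i, testOrder n δ (p i) ((Pi.single j β : Fin m → ℝ) i) - (m * n - α) =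
      α + (δ - n) * (1 / q + α / n) - β := by
  simp only [testOrder, Finset.sum_sub_distrib, Finset.sum_add_distrib, Finset.sum_pi_single',
    Finset.mem_univ, if_true]
  rw [← hom, Finset.mul_sum]
  simp only [mul_one_div, Finset.sum_const, Finset.card_univ, Fintype.card_fin, nsmul_eq_mul]
  ring

theorem natCast_mul_sub_nonneg (hm : m ≠ 0) (hαn : α < n) : 0 ≤ (m : ℝ) * n - α := by
  have h1 : (1 : ℝ) ≤ m := by exact_mod_cast Nat.one_le_iff_ne_zero.2 hm
  nlinarith [(Nat.cast_nonneg n : (0 : ℝ) ≤ n)]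

/-- The examples for an index `j` with `q ≤ pⱼ'`: the weight `w_j` has a zero at the origin, and its
dual weight `σ_j = ‖x‖ ^ (δ - n)` is almost not integrable. The constant `[w]` grows at most like
`K ^ (q / pⱼ')`, where `K = 1 / δ`. -/
theorem exists_example_of_le (hα : 0 < α) (hαn : α < n) (hq : 0 < q) (hp : ∀ i, 1 < p i)
    (hom : ∑ i, 1 / p i = 1 / q + α / n) (j : Fin m) :
    ∃ C₀ > 0, ∃ c₁ > 0, ∀ K : ℕ, 2 ≤ K → ∃ b : Fin m → ℝ, (∀ i, -(n : ℝ) < b i) ∧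
      multiWeightConst p q (fun i (x : EuclideanSpace ℝ (Fin n)) => ‖x‖ ^ b i) ≤
        ENNReal.ofReal (C₀ * K) ^ (q / (p j).conjExponent) ∧
      ((∀ᵐ x ∂(productMeasure q fun i (x : EuclideanSpace ℝ (Fin n)) => ‖x‖ ^ b i),
        Integrable (fracIntegrand α (fun i x => (testFun n (1 / K) (p i) (b i) x : 𝕜)) x)
          volume) →
      ENNReal.ofReal (c₁ * (K : ℝ) ^ (1 + 1 / q)) ≤
        eLpNorm (fracIntegral α fun i x => (testFun n (1 / K) (p i) (b i) x : 𝕜))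
          (ENNReal.ofReal q) (productMeasure q fun i x => ‖x‖ ^ b i)) := by
  have hn0 : (0 : ℝ) < n := hα.trans hαn
  have hn : n ≠ 0 := by rintro rfl; simp at hn0
  have hn1 : (1 : ℝ) ≤ n := by exact_mod_cast Nat.one_le_iff_ne_zero.2 hn
  have hm := ne_zero_of_sum_eq hα hαn hq hom
  have hm0 : (0 : ℝ) < m := by positivity
  have hS := sphereConst_pos hn
  have hE := natCast_mul_sub_nonneg hm hαn
  have hp' : 0 < (p j).conjExponent := zero_lt_one.trans (one_lt_conjExponent (hp j))
  set γ₀ := 1 + q * (α / n) with hγ₀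
  have hγ₀0 : 0 < γ₀ := by positivity
  set c₂ := ((2 * m : ℝ) ^ ((m : ℝ) * n - α))⁻¹ *
    (sphereConst n * (sphereConst n / n) ^ (m - 1)) with hc₂
  have hc₂0 : 0 < c₂ := by positivity
  refine ⟨(4 * n) ^ n * sphereConst n + 4 ^ n, by positivity,
    c₂ * (sphereConst n / γ₀) ^ (1 / q), by positivity, fun K hK => ?_⟩
  have hK0 : (0 : ℝ) < K := by positivity
  have hK1 : (1 : ℝ) ≤ K := by exact_mod_cast (by omega : 1 ≤ K)
  set δ : ℝ := 1 / K with hδ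
  have hδ0 : 0 < δ := by positivity
  have hδ1 : δ ≤ 1 := (div_le_one hK0).2 hK1
  have hN : 0 ≤ n - δ := by linarith
  set β : ℝ := (n - δ) / (p j).conjExponent with hβ
  have hβ0 : 0 ≤ β := by positivity
  have hoj : testOrder n δ (p j) β = δ := by
    have h1 := one_div_conjExponent (hp j)
    have h2 : β = (n - δ) * (1 / (p j).conjExponent) := by rw [hβ]; ring
    rw [testOrder, h2, h1]
    ring
  have hoi : ∀ i, i ≠ j → testOrder n δ (p i) 0 ≤ n ∧ 0 < testOrder n δ (p i) 0 := by
    intro i _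
    have h0 : 0 < p i := zero_lt_one.trans (hp i)
    have h1 : (n - δ) / p i ≤ n - δ := div_le_self hN (hp i).le
    have h2 : 0 ≤ (n - δ) / p i := by positivity
    have h3 : (δ - n) / p i = -((n - δ) / p i) := by ring
    rw [testOrder, h3]
    constructor <;> linarith
  have hγ : ∀ i, 0 < testOrder n δ (p i) ((Pi.single j β : Fin m → ℝ) i) := by
    intro i
    by_cases hij : i = j
    · subst hij
      rw [Pi.single_eq_same, hoj]
      exact hδ0
    · rw [Pi.single_eq_of_ne hij]
      exact (hoi i hij).2
  refine ⟨Pi.single j β, fun i => ?_, ?_, fun hint => ?_⟩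
  · have : 0 ≤ (Pi.single j β : Fin m → ℝ) i := by
      rw [Pi.single_apply]
      split_ifs <;> [exact hβ0; exact le_rfl]
    linarith
  · refine multiWeightConst_single_le hn j β fun a l hl => ?_
    have h1 := setLAverage_norm_rpow_mul_le hn (a₀ := q / (p j).conjExponent) (by positivity) hδ0
      hδ1 a hl
    rw [show q * β = q / (p j).conjExponent * (n - δ) by rw [hβ]; ring,
      show -(β * (p j).conjExponent) = δ - n by rw [hβ, div_mul_cancel₀ _ hp'.ne']; ring]
    rwa [hδ, div_div_eq_mul_div, div_one, ← hδ] at h1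
  · have h1 : ∀ x : EuclideanSpace ℝ (Fin n), 0 < ‖x‖ → ‖x‖ < 1 →
        ENNReal.ofReal (c₂ * K * ‖x‖ ^ (α + (δ - n) * (1 / q + α / n) - β)) ≤
          lfracTest n α δ p (Pi.single j β : Fin m → ℝ) x := by
      intro x hx0 hx1
      refine le_trans (ENNReal.ofReal_le_ofReal ?_) (ofReal_le_lfracTest_ball hm hn hE hγ hx0 hx1)
      rw [sum_testOrder_single hom]
      refine mul_le_mul_of_nonneg_right ?_ (by positivity)
      rw [hc₂, mul_assoc]
      refine mul_le_mul_of_nonneg_left ?_ (by positivity)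
      rw [← Finset.mul_prod_erase _ _ (Finset.mem_univ j), Pi.single_eq_same, hoj, hδ,
        div_div_eq_mul_div, div_one, ← hδ, mul_right_comm]
      gcongr
      calc (sphereConst n / n) ^ (m - 1)
          = ∏ _i ∈ Finset.univ.erase j, sphereConst n / n := by
            rw [Finset.prod_const, Finset.card_erase_of_mem (Finset.mem_univ j), Finset.card_univ,
              Fintype.card_fin]
        _ ≤ _ := by
            refine Finset.prod_le_prod (fun _ _ => by positivity) fun i hi => ?_
            have hij := Finset.ne_of_mem_erase hi
            rw [Pi.single_eq_of_ne hij]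
            exact div_le_div_of_nonneg_left hS.le (hoi i hij).2 (hoi i hij).1
    have h2 := le_eLpNorm_fracIntegral_testFun hn hq hint (t := c₂ * K) (R := 1) (γ := δ * γ₀)
      (by positivity) zero_le_one (by positivity) (by
        rw [Finset.sum_pi_single', if_pos (Finset.mem_univ j), hγ₀]
        field_simp
        ring) h1
    refine le_trans (le_of_eq ?_) h2
    congr 1
    rw [Real.one_rpow, hδ, show sphereConst n * (1 / (1 / (K : ℝ) * γ₀)) = sphereConst n / γ₀ * K by
      field_simp, Real.mul_rpow (by positivity) hK0.le, Real.rpow_add hK0, Real.rpow_one]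
    ring

/-- The examples for an index `j` with `pⱼ' < q`: the weight `w_j` has a pole at the origin, and
`u_w = ‖x‖ ^ (δ - n)` is almost not integrable. The constant `[w]` grows at most like `K = 1 / δ`. -/
theorem exists_example_of_gt (hα : 0 < α) (hαn : α < n) (hp : ∀ i, 1 < p i)
    (hom : ∑ i, 1 / p i = 1 / q + α / n) (j : Fin m) (hj : (p j).conjExponent < q) :
    ∃ C₀ > 0, ∃ c₁ > 0, ∀ K : ℕ, 2 ≤ K → ∃ b : Fin m → ℝ, (∀ i, -(n : ℝ) < b i) ∧
      multiWeightConst p q (fun i (x : EuclideanSpace ℝ (Fin n)) => ‖x‖ ^ b i) ≤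
        ENNReal.ofReal (C₀ * K) ^ (1 : ℝ) ∧
      ((∀ᵐ x ∂(productMeasure q fun i (x : EuclideanSpace ℝ (Fin n)) => ‖x‖ ^ b i),
        Integrable (fracIntegrand α (fun i x => (testFun n (1 / K) (p i) (b i) x : 𝕜)) x)
          volume) →
      ENNReal.ofReal (c₁ * (K : ℝ) ^ (1 + 1 / q)) ≤
        eLpNorm (fracIntegral α fun i x => (testFun n (1 / K) (p i) (b i) x : 𝕜))
          (ENNReal.ofReal q) (productMeasure q fun i x => ‖x‖ ^ b i)) := by
  have hn0 : (0 : ℝ) < n := hα.trans hαn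
  have hn : n ≠ 0 := by rintro rfl; simp at hn0
  have hn1 : (1 : ℝ) ≤ n := by exact_mod_cast Nat.one_le_iff_ne_zero.2 hn
  have hp1 := one_lt_conjExponent (hp j)
  have hp' : 0 < (p j).conjExponent := zero_lt_one.trans hp1
  have hq1 : 1 < q := hp1.trans hj
  have hq : 0 < q := zero_lt_one.trans hq1
  have hm := ne_zero_of_sum_eq hα hαn hq hom
  have hm0 : (0 : ℝ) < m := by positivity
  have hS := sphereConst_pos hn
  have hE := natCast_mul_sub_nonneg hm hαn
  set c₂ := ((2 * m : ℝ) ^ ((m : ℝ) * n - α))⁻¹ *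
    (2⁻¹ ^ n * (sphereConst n / n / 2)) ^ m * 2⁻¹ with hc₂
  have hc₂0 : 0 < c₂ := by positivity
  refine ⟨(4 * n) ^ n * sphereConst n + 4 ^ n, by positivity,
    c₂ * (sphereConst n * 2⁻¹) ^ (1 / q), by positivity, fun K hK => ?_⟩
  have hK0 : (0 : ℝ) < K := by positivity
  have hK1 : (1 : ℝ) ≤ K := by exact_mod_cast (by omega : 1 ≤ K)
  set δ : ℝ := 1 / K with hδ
  have hδ0 : 0 < δ := by positivity
  have hδ1 : δ ≤ 1 := (div_le_one hK0).2 hK1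
  have hN : 0 ≤ n - δ := by linarith
  set β : ℝ := (δ - n) / q with hβ
  have hβ1 : -β ≤ n - δ := by
    rw [hβ, ← neg_div, neg_sub]
    exact div_le_self hN hq1.le
  have hβ0 : 0 ≤ -β := by
    rw [hβ, ← neg_div, neg_sub]
    positivity
  have hbi : ∀ i, -(n - δ) ≤ (Pi.single j β : Fin m → ℝ) i := by
    intro i
    rw [Pi.single_apply]
    split_ifs <;> linarith
  have hη : ∑ i, testOrder n δ (p i) ((Pi.single j β : Fin m → ℝ) i) - (m * n - α) =
      δ * (α / n) := by
    rw [sum_testOrder_single hom, hβ]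
    field_simp
    ring
  have hγ : ∀ i, testOrder n δ (p i) ((Pi.single j β : Fin m → ℝ) i) ≤ 2 * n := by
    intro i
    have h0 : 0 < p i := zero_lt_one.trans (hp i)
    have h1 : 0 ≤ (n - δ) / p i := by positivity
    have h2 : (δ - n) / p i = -((n - δ) / p i) := by ring
    rw [testOrder, h2]
    linarith [hbi i]
  refine ⟨Pi.single j β, fun i => by linarith [hbi i], ?_, fun hint => ?_⟩
  · refine multiWeightConst_single_le hn j β fun a l hl => ?_
    have h1 := setLAverage_norm_rpow_mul_le hn (a₀ := (p j).conjExponent / q) (by positivity) hδ0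
      hδ1 a hl
    rw [show q * β = δ - n by rw [hβ]; field_simp,
      show -(β * (p j).conjExponent) = (p j).conjExponent / q * (n - δ) by rw [hβ]; ring]
    rw [hδ, div_div_eq_mul_div, div_one, ← hδ] at h1
    -- the roles of the two averages are exchanged by raising to the power `q / pⱼ'`
    have h2 := ENNReal.rpow_le_rpow h1 (z := q / (p j).conjExponent) (by positivity)
    have e1 : (p j).conjExponent / q * (q / (p j).conjExponent) = 1 := by field_simp
    rw [ENNReal.rpow_one]
    rwa [ENNReal.mul_rpow_of_nonneg _ _ (by positivity), ← ENNReal.rpow_mul, ← ENNReal.rpow_mul,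
      e1, ENNReal.rpow_one, ENNReal.rpow_one, mul_comm] at h2
  · have h1 : ∀ x : EuclideanSpace ℝ (Fin n), 0 < ‖x‖ → ‖x‖ < 2⁻¹ ^ K →
        ENNReal.ofReal (K * c₂ * ‖x‖ ^ (0 : ℝ)) ≤
          lfracTest n α δ p (Pi.single j β : Fin m → ℝ) x := by
      intro x _ hx1
      rw [Real.rpow_zero, mul_one]
      refine ofReal_le_lfracTest_annuli hm hn hE hγ ?_ ?_ hx1
      · rw [hη]; positivity
      · rw [hη, hδ, ← mul_assoc, mul_one_div_cancel hK0.ne', one_mul, div_le_one hn0]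
        exact hαn.le
    have h2 := le_eLpNorm_fracIntegral_testFun hn hq hint (t := K * c₂) (R := 2⁻¹ ^ K) (γ := δ)
      (by positivity) (by positivity) hδ0 (by
        rw [Finset.sum_pi_single', if_pos (Finset.mem_univ j), hβ]
        field_simp
        ring) h1
    refine le_trans (le_of_eq ?_) h2
    congr 1
    have e1 : ((2⁻¹ : ℝ) ^ K) ^ δ = 2⁻¹ := by
      rw [← Real.rpow_natCast, ← Real.rpow_mul (by norm_num), hδ, mul_one_div_cancel hK0.ne',
        Real.rpow_one]
    rw [e1, hδ, show sphereConst n * (2⁻¹ / (1 / (K : ℝ))) = sphereConst n * 2⁻¹ * K by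
      field_simp, Real.mul_rpow (by positivity) hK0.le, Real.rpow_add hK0, Real.rpow_one]
    ring

end Sharpness

/-- The exponent `sharpExponent n α p q` cannot be lowered. -/
theorem not_exists_fracIntegral_bound {𝕜 : Type*} [RCLike 𝕜] (m n : ℕ) (α q : ℝ) (p : Fin m → ℝ)
    (hα : 0 < α) (hαn : α < n) (hq : 0 < q) (hp : ∀ i, 1 < p i)
    (hom : ∑ i, 1 / p i = 1 / q + α / n)
    (hint : ∀ w : Fin m → EuclideanSpace ℝ (Fin n) → ℝ, IsMultiWeight p q w →
      ∀ f : Fin m → EuclideanSpace ℝ (Fin n) → 𝕜,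
        (∀ i, MemLp (f i) (ENNReal.ofReal (p i)) (powMeasure (p i) (w i))) →
        ∀ᵐ x ∂(productMeasure q w), Integrable (fracIntegrand α f x) volume)
    (s : ℝ) (hs : s < sharpExponent n α p q) :
    ¬ ∃ C : ℝ≥0, ∀ w : Fin m → EuclideanSpace ℝ (Fin n) → ℝ, IsMultiWeight p q w →
      ∀ f : Fin m → EuclideanSpace ℝ (Fin n) → 𝕜,
        (∀ i, MemLp (f i) (ENNReal.ofReal (p i)) (powMeasure (p i) (w i))) →
        eLpNorm (fracIntegral α f) (ENNReal.ofReal q) (productMeasure q w) ≤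
          C * multiWeightConst p q w ^ s *
            ∏ i, eLpNorm (f i) (ENNReal.ofReal (p i)) (powMeasure (p i) (w i)) := by
  rintro ⟨C, hC⟩
  have hn0 : (0 : ℝ) < n := hα.trans hαn
  have hθ : 0 < 1 - α / n := by rw [sub_pos, div_lt_one hn0]; exact hαn
  have hm := ne_zero_of_sum_eq hα hαn hq hom
  have : Nonempty (Fin m) := ⟨⟨0, Nat.pos_of_ne_zero hm⟩⟩
  obtain ⟨j, hj⟩ := exists_eq_ciSup_of_finite (f := fun i => max 1 ((p i).conjExponent / q))
  rw [sharpExponent, ← hj] at hs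
  have hp' : 0 < (p j).conjExponent := zero_lt_one.trans (one_lt_conjExponent (hp j))
  rcases le_or_gt q (p j).conjExponent with h | h
  · have h1 : 1 ≤ (p j).conjExponent / q := (one_le_div hq).2 h
    simp only [max_eq_right h1] at hs
    obtain ⟨C₀, hC₀, c₁, hc₁, hex⟩ := exists_example_of_le (𝕜 := 𝕜) hα hαn hq hp hom j
    refine not_exists_bound_of_examples hα hαn hq hp hom (by positivity) ?_ hC₀ hc₁ hex hint hC
    have h2 : max s 0 < (1 - α / n) * ((p j).conjExponent / q) := max_lt hs (by positivity)
    calc q / (p j).conjExponent * max s 0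
        < q / (p j).conjExponent * ((1 - α / n) * ((p j).conjExponent / q)) := by gcongr
      _ = 1 - α / n := by field_simp
  · have h1 : (p j).conjExponent / q ≤ 1 := (div_le_one hq).2 h.le
    simp only [max_eq_left h1, mul_one] at hs
    obtain ⟨C₀, hC₀, c₁, hc₁, hex⟩ := exists_example_of_gt (𝕜 := 𝕜) hα hαn hp hom j h
    refine not_exists_bound_of_examples hα hαn hq hp hom zero_le_one ?_ hC₀ hc₁ hex hint hC
    rw [one_mul]
    exact max_lt hs hθ

/-- In the hypothesis `hmin`, the expression `⨆ i, if i = j then q else (p i).conjExponent` is the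
maximum of `q` and of all `pᵢ'` with `i ≠ j`. -/
theorem theorem1p2 {𝕜 : Type*} [RCLike 𝕜] (m n : ℕ) (α q : ℝ) (p : Fin m → ℝ)
    (hα : 0 < α) (hαn : α < n) (hq : 0 < q) (hp : ∀ i, 1 < p i)
    (hom : ∑ i, 1 / p i = 1 / q + α / n)
    (hmin : min ((⨆ i, (p i).conjExponent) / q)
        (⨅ j, (⨆ i, if i = j then q else (p i).conjExponent) / (p j).conjExponent)
      ≤ 1 - α / n) :
    (∃ C : ℝ≥0, ∀ w : Fin m → EuclideanSpace ℝ (Fin n) → ℝ, IsMultiWeight p q w →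
      ∀ f : Fin m → EuclideanSpace ℝ (Fin n) → 𝕜,
        (∀ i, MemLp (f i) (ENNReal.ofReal (p i)) (powMeasure (p i) (w i))) →
        (∀ᵐ x ∂(productMeasure q w), Integrable (fracIntegrand α f x) volume) ∧
        MemLp (fracIntegral α f) (ENNReal.ofReal q) (productMeasure q w) ∧
        eLpNorm (fracIntegral α f) (ENNReal.ofReal q) (productMeasure q w) ≤
          C * multiWeightConst p q w ^ sharpExponent n α p q *
            ∏ i, eLpNorm (f i) (ENNReal.ofReal (p i)) (powMeasure (p i) (w i))) ∧
    (∀ s : ℝ, s < sharpExponent n α p q →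
      ¬ ∃ C : ℝ≥0, ∀ w : Fin m → EuclideanSpace ℝ (Fin n) → ℝ, IsMultiWeight p q w →
        ∀ f : Fin m → EuclideanSpace ℝ (Fin n) → 𝕜,
          (∀ i, MemLp (f i) (ENNReal.ofReal (p i)) (powMeasure (p i) (w i))) →
          eLpNorm (fracIntegral α f) (ENNReal.ofReal q) (productMeasure q w) ≤
            C * multiWeightConst p q w ^ s *
              ∏ i, eLpNorm (f i) (ENNReal.ofReal (p i)) (powMeasure (p i) (w i))) := by
  obtain ⟨C, hC⟩ := fracIntegral_bound (𝕜 := 𝕜) m n α q p hα hαn hq hp hom hmin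
  exact ⟨⟨C, hC⟩, not_exists_fracIntegral_bound m n α q p hα hαn hq hp hom
    fun w hw f hf => (hC w hw f hf).1⟩
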